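/- Let $\mathbb{T}=\{\zeta\in\mathbb{C}:|\zeta|=1\}$ carry normalized arc length, and for $f\in L^1(\mathbb{T})$ let $\hat f(n)=\frac1{2\pi}\int_0^{2\pi}f(e^{it})e^{-int}\,dt$. For $1<p<\infty$ let $P_+:L^p(\mathbb{T})\to L^p(\mathbb{T})$ be the Riesz projection: $P_+f$ is the unique element of $L^p(\mathbb{T})$ whose Fourier series is $\sum_{n\ge0}\hat f(n)\zeta^n$. Let $P_-=I-P_+$. All functions are complex-valued. For $1<p<\infty$ and $0<s<\infty$, let $B_{p,s}$ be the least real constant $B$ such that $$\|f\|_{L^p(\mathbb{T})}\le B\,\bigl\|(|P_+f|^s+|P_-f|^s)^{1/s}\bigr\|_{L^p(\mathbb{T})}\qquad\text{for all } f\in L^p(\mathbb{T}).$$ Then: 1. if $1<p\le2$ and $s\ge p$, then $B_{p,s}=2^{1-\frac1s}\sin\frac{\pi}{2p}$; 2. if $p\ge9$ and $s\ge\frac{p}{p-1}$, then $B_{p,s}=2^{1-\frac1s}\cos\frac{\pi}{2p}$; 3. if $0<s\le1$ and $1<p<\infty$, then $B_{p,s}=1$. In each case the inequality holds with the stated constant,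 and it fails for some $f\in L^p(\mathbb{T})$ with any smaller constant. -/

import Mathlib

open MeasureTheory AddCircle

noncomputable section

/-- The circle `𝕋 = ℝ / 2πℤ` (the point `t` stands for `e ^ (i t)`) has positive circumference. -/
instance factTwoPiPos : Fact ((0 : ℝ) < 2 * Real.pi) := ⟨Real.two_pi_pos⟩

/-- The unit circle, parametrized by the angle. -/
abbrev CircleT : Type := AddCircle (2 * Real.pi)

/-- Normalized arc length `dt / 2π` on the circle. -/
abbrev arcLength : Measure CircleT := haarAddCircle

/-- The Lebesgue space `L^p(𝕋)` of complex-valued functions. -/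
abbrev LpT (p : ℝ) : Type := Lp ℂ (ENNReal.ofReal p) arcLength

/-- `g ∈ L^p(𝕋)` is the analytic projection of `f ∈ L^p(𝕋)`: the Fourier series of `g` is
`∑_{n ≥ 0} f̂(n) ζ ^ n`. -/
def IsRieszProjection {p : ℝ} (f g : LpT p) : Prop :=
  ∀ n : ℤ, fourierCoeff (g : CircleT → ℂ) n =
    if 0 ≤ n then fourierCoeff (f : CircleT → ℂ) n else 0

open Classical in
/-- The Riesz projection `P₊ f` of `f ∈ L^p(𝕋)`: the element of `L^p(𝕋)` whose Fourier series is
`∑_{n ≥ 0} f̂(n) ζ ^ n`. A function in `L^p(𝕋)`, `p ≥ 1`, is determined by its Fourier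
coefficients, and for `1 < p < ∞` such an element exists for every `f` by M. Riesz's theorem, so
for these `p` the default value is never used. -/
def rieszPlus {p : ℝ} (f : LpT p) : LpT p :=
  if h : ∃ g : LpT p, IsRieszProjection f g then h.choose else 0

/-- The co-analytic projection `P₋ = I - P₊`. -/
def rieszMinus {p : ℝ} (f : LpT p) : LpT p := f - rieszPlus f

/-- The set of all real constants `B` with
`‖f‖_{L^p} ≤ B ‖(|P₊ f|^s + |P₋ f|^s)^{1/s}‖_{L^p}` for every `f ∈ L^p(𝕋)`. -/
def reverseRieszConstants (p s : ℝ) : Set ℝ :=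
  {B : ℝ | ∀ f : LpT p,
    eLpNorm (f : CircleT → ℂ) (ENNReal.ofReal p) arcLength ≤
      ENNReal.ofReal B *
        eLpNorm (fun t : CircleT =>
          (‖(rieszPlus f : CircleT → ℂ) t‖ ^ s + ‖(rieszMinus f : CircleT → ℂ) t‖ ^ s) ^ (1 / s))
          (ENNReal.ofReal p) arcLength}

end

/-!
The upper bounds for `1 < p ≤ 2` and for `p ≥ 9` come from pointwise inequalities
`‖z + conj w‖ ^ p ≤ A (‖z‖ ^ s + ‖w‖ ^ s) ^ (p / s) - M u (± z w)`, with `M ≥ 0` and `u` a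
subharmonic function on the plane, homogeneous of degree `p / 2`
(`norm_add_conj_rpow_le_of_le_two` with `s = p` and `u = rePow (p / 2)`,
`norm_add_conj_rpow_le_of_nine_le` with `s = p / (p - 1)` and `u = negRePow (p / 2)`). For a
trigonometric polynomial `f` write `P₊ f = G` and `P₋ f = conj H` on the circle. Then `G H` extends
to an entire function vanishing at the origin, so the mean of `u (± G H)` is nonnegative
(`integral_comp_nonneg`) and integrating the pointwise inequality with `z = G`, `w = H` gives the
bound. Larger `s` follow from the power mean inequality, and general `f` by density.

Subharmonicity enters through `HasAnalyticMinorants`: off the origin, `u` is touched from below by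
real parts of analytic functions. This is enough for a maximum principle
(`comp_sub_re_le_of_forall_sphere`), hence for the sub-mean value inequality.

In the coordinates `‖z‖ = √(a b) e ^ t`, `‖w‖ = √(a b) e ^ (-t)`, `τ = |arg (± z w)| / 2` the
pointwise inequalities become inequalities in `t` and `τ`. At `t = 0` they hold because
`sin (p τ) / (sin τ cos ^ (p - 1) τ)` is monotone, with equality at an angle determined by the
constant. For `p ≤ 2` a negative minimum at `t > 0` is excluded by its critical point equations
(`smallGap_nonneg`); for `p ≥ 9` the gap is bounded below by explicit functions of `1 / cosh t`
(`largeGap_nonneg`).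

The theorem of M. Riesz is needed for the Riesz projection to be what it should be. Its proof is the
same argument with a non-sharp pointwise inequality, which compactness provides
(`exists_norm_rpow_add_le`, `tendsto_analyticLp`).

The constants are sharp because of `f = G - conj G` for `p ≤ 2` and `f = G + conj G` for `p ≥ 9`,
where `G = (1 - r ζ) ^ (-1 / p) - 1` and `r → 1`: near `ζ = 1` the argument of `1 - r ζ` is close to
`± π / 2`, so that `|f|` is about `2 sin (π / 2p) |G|` or at least about `2 cos (π / 2p) |G|`, while
`‖G‖_p → ∞` (`sin_le_of_mem_reverseRieszConstants`, `cos_le_of_mem_reverseRieszConstants`). For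
`s ≤ 1` the upper bound is the triangle inequality and `f = 1` is extremal.
-/

/-! ### Points of the circle, mean values and trigonometric polynomials -/

/-- The point `e ^ (i t)` of the complex plane. -/
noncomputable def circlePt (t : CircleT) : ℂ := (AddCircle.toCircle t : ℂ)

lemma norm_circlePt (t : CircleT) : ‖circlePt t‖ = 1 := Circle.norm_coe _

lemma continuous_circlePt : Continuous circlePt :=
  continuous_subtype_val.comp AddCircle.continuous_toCircle

lemma conj_circlePt (t : CircleT) : (starRingEnd ℂ) (circlePt t) = (circlePt t)⁻¹ := by
  rw [Complex.inv_def, Complex.normSq_eq_norm_sq, norm_circlePt]; simp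

lemma fourier_eq_circlePt_zpow (n : ℤ) (t : CircleT) : fourier n t = circlePt t ^ n := by
  rw [fourier_apply, AddCircle.toCircle_zsmul]; simp [circlePt]

lemma circlePt_coe (x : ℝ) : circlePt (x : CircleT) = circleMap 0 1 x := by
  have : (2 * Real.pi / (2 * Real.pi) : ℝ) = 1 := div_self (by positivity)
  simp [circlePt, AddCircle.toCircle_apply_mk, circleMap, Circle.coe_exp, Real.pi_ne_zero]

lemma integral_comp_circlePt {E : Type*} [NormedAddCommGroup E] [NormedSpace ℝ E] (Q : ℂ → E) :
    ∫ t, Q (circlePt t) ∂arcLength = Real.circleAverage Q 0 1 := by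
  rw [integral_haarAddCircle, Real.circleAverage_def,
    ← AddCircle.intervalIntegral_preimage (2 * Real.pi) 0, zero_add]
  simp_rw [circlePt_coe]

/-- The mean value property, for integrals over the circle. -/
lemma integral_comp_circlePt_of_diffContOnCl {Q : ℂ → ℂ}
    (hQ : DiffContOnCl ℂ Q (Metric.ball 0 1)) : ∫ t, Q (circlePt t) ∂arcLength = Q 0 := by
  rw [integral_comp_circlePt]
  exact DiffContOnCl.circleAverage (by simpa using hQ)

lemma integrable_of_continuous {E : Type*} [NormedAddCommGroup E] {f : CircleT → E}
    (hf : Continuous f) : Integrable f arcLength := by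
  rw [← integrableOn_univ]
  exact hf.continuousOn.integrableOn_compact isCompact_univ

/-- The polynomial `∑_{n ≥ 0} c_n z ^ n` that induces the analytic part of the trigonometric
polynomial `∑ c_n ζ ^ n`. -/
noncomputable def analyticPart (c : ℤ →₀ ℂ) (z : ℂ) : ℂ :=
  ∑ n ∈ c.support with 0 ≤ n, c n * z ^ n.toNat

/-- The polynomial `∑_{n < 0} conj (c_n) z ^ (-n)`: on the circle, its complex conjugate is the
co-analytic part of the trigonometric polynomial `∑ c_n ζ ^ n`. -/
noncomputable def coanalyticPart (c : ℤ →₀ ℂ) (z : ℂ) : ℂ :=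
  ∑ n ∈ c.support with ¬ 0 ≤ n, (starRingEnd ℂ) (c n) * z ^ (-n).toNat

/-- The trigonometric polynomial `∑ c_n ζ ^ n`. -/
noncomputable def trigPoly (c : ℤ →₀ ℂ) (t : CircleT) : ℂ := c.sum fun n a => a * fourier n t

lemma differentiable_analyticPart (c : ℤ →₀ ℂ) : Differentiable ℂ (analyticPart c) := by
  unfold analyticPart; fun_prop

lemma differentiable_coanalyticPart (c : ℤ →₀ ℂ) : Differentiable ℂ (coanalyticPart c) := by
  unfold coanalyticPart; fun_prop

lemma coanalyticPart_zero (c : ℤ →₀ ℂ) : coanalyticPart c 0 = 0 := by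
  refine Finset.sum_eq_zero fun n hn => ?_
  have : (-n).toNat ≠ 0 := by have := (Finset.mem_filter.1 hn).2; omega
  simp [this]

lemma analyticPart_circlePt (c : ℤ →₀ ℂ) (t : CircleT) :
    analyticPart c (circlePt t) = ∑ n ∈ c.support with 0 ≤ n, c n * fourier n t := by
  refine Finset.sum_congr rfl fun n hn => ?_
  have h := (Finset.mem_filter.1 hn).2
  rw [fourier_eq_circlePt_zpow, ← zpow_natCast, Int.toNat_of_nonneg h]

lemma conj_coanalyticPart_circlePt (c : ℤ →₀ ℂ) (t : CircleT) :
    (starRingEnd ℂ) (coanalyticPart c (circlePt t)) =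
      ∑ n ∈ c.support with ¬ 0 ≤ n, c n * fourier n t := by
  rw [coanalyticPart, map_sum]
  refine Finset.sum_congr rfl fun n hn => ?_
  have h := (Finset.mem_filter.1 hn).2
  rw [fourier_eq_circlePt_zpow, map_mul, map_pow, conj_circlePt, Complex.conj_conj]
  congr 1
  obtain ⟨m, rfl⟩ : ∃ m : ℕ, n = -(m : ℤ) := ⟨(-n).toNat, by omega⟩
  simp

lemma trigPoly_eq_add (c : ℤ →₀ ℂ) (t : CircleT) :
    trigPoly c t =
      analyticPart c (circlePt t) + (starRingEnd ℂ) (coanalyticPart c (circlePt t)) := by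
  rw [analyticPart_circlePt, conj_coanalyticPart_circlePt, Finset.sum_filter_add_sum_filter_not]
  rfl

/-- Trigonometric polynomials are uniformly dense in the continuous functions. -/
lemma exists_trigPoly_near {v : CircleT → ℂ} (hv : Continuous v) {ε : ℝ} (hε : 0 < ε) :
    ∃ c : ℤ →₀ ℂ, ∀ t, ‖v t - trigPoly c t‖ < ε := by
  have h : (⟨v, hv⟩ : C(CircleT, ℂ)) ∈
      (Submodule.span ℂ (Set.range (@fourier (2 * Real.pi)))).topologicalClosure := by
    rw [span_fourier_closure_eq_top]; trivial
  obtain ⟨P, hP, hd⟩ := Metric.mem_closure_iff.1 h ε hε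
  obtain ⟨c, rfl⟩ := Finsupp.mem_span_range_iff_exists_finsupp.1 hP
  refine ⟨c, fun t => ?_⟩
  have := (ContinuousMap.norm_coe_le_norm (⟨v, hv⟩ - c.sum fun i a => a • fourier i) t).trans_lt
    (by rwa [← dist_eq_norm])
  have e : (⟨v, hv⟩ - c.sum fun i a => a • fourier i : C(CircleT, ℂ)) t = v t - trigPoly c t := by
    simp [trigPoly, Finsupp.sum, ContinuousMap.coe_sum, Finset.sum_apply]
  rwa [e] at this

/-! ### A maximum principle and the sub-mean value inequality -/

/-- `u` is touched from below, at every point other than the origin, by the real part of an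
analytic function. Together with continuity this makes `u` subharmonic off the origin. -/
def HasAnalyticMinorants (u : ℂ → ℝ) : Prop :=
  ∀ z₀ : ℂ, z₀ ≠ 0 → ∃ L : ℂ → ℂ, AnalyticAt ℂ L z₀ ∧ (L z₀).re = u z₀ ∧
    ∀ᶠ z in nhds z₀, (L z).re ≤ u z

lemma eventually_re_eq_of_isLocalMax {H : ℂ → ℂ} {z₀ : ℂ} (hH : AnalyticAt ℂ H z₀)
    (hmax : ∀ᶠ z in nhds z₀, (H z).re ≤ (H z₀).re) : ∀ᶠ z in nhds z₀, (H z).re = (H z₀).re := by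
  have h1 : ∀ᶠ z in nhds z₀, DifferentiableAt ℂ (fun z => Complex.exp (H z)) z :=
    hH.eventually_analyticAt.mono fun z hz => hz.differentiableAt.cexp
  have h2 : IsLocalMax (norm ∘ fun z => Complex.exp (H z)) z₀ := by
    filter_upwards [hmax] with z hz
    simpa [Complex.norm_exp] using hz
  filter_upwards [Complex.norm_eventually_eq_of_isLocalMax h1 h2] with z hz
  simpa [Complex.norm_exp] using hz

/-- The maximum principle for `u ∘ F - Re Q`. Near the zeros of `F` nothing is known about `u ∘ F`
beyond continuity; these points are kept away from by adding `δ log |F|`. -/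
lemma comp_sub_re_le_of_forall_sphere {u : ℂ → ℝ} (hu : Continuous u)
    (hmin : HasAnalyticMinorants u) {F Q : ℂ → ℂ} (hF : Differentiable ℂ F)
    (hQ : Differentiable ℂ Q) {M : ℝ} (hM : ∀ z, ‖z‖ = 1 → u (F z) - (Q z).re ≤ M)
    {z₁ : ℂ} (hz₁ : ‖z₁‖ ≤ 1) (hFz₁ : F z₁ ≠ 0) : u (F z₁) - (Q z₁).re ≤ M := by
  have hcpt : IsCompact (Metric.closedBall (0 : ℂ) 1) := isCompact_closedBall 0 1
  have hcont : Continuous fun z => u (F z) - (Q z).re :=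
    (hu.comp hF.continuous).sub (Complex.continuous_re.comp hQ.continuous)
  obtain ⟨K, hK⟩ := hcpt.exists_bound_of_continuousOn hF.continuous.continuousOn
  obtain ⟨A, hA⟩ := hcpt.exists_bound_of_continuousOn hcont.continuousOn
  have hz₁' : z₁ ∈ Metric.closedBall (0 : ℂ) 1 := by simpa using hz₁
  have hFpos : 0 < ‖F z₁‖ := norm_pos_iff.2 hFz₁
  have hKpos : 0 < K := hFpos.trans_le (hK _ hz₁')
  -- the bound with the logarithmic term, for each `δ > 0`
  have key : ∀ δ : ℝ, 0 < δ →
      u (F z₁) - (Q z₁).re + δ * Real.log (‖F z₁‖ / K) ≤ M := by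
    intro δ hδ
    set v : ℂ → ℝ := fun z => u (F z) - (Q z).re + δ * Real.log (‖F z‖ / K) with hv
    obtain ⟨η, hη0, hη1, hη2⟩ : ∃ η : ℝ, 0 < η ∧ η ≤ ‖F z₁‖ ∧
        A + δ * Real.log (η / K) < v z₁ := by
      have ht : Filter.Tendsto (fun η : ℝ => A + δ * Real.log (η / K))
          (nhdsWithin 0 (Set.Ioi 0)) Filter.atBot := by
        refine Filter.tendsto_atBot_add_const_left _ _ (Filter.Tendsto.const_mul_atBot hδ ?_)
        refine Real.tendsto_log_nhdsGT_zero.comp ?_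
        refine tendsto_nhdsWithin_iff.2 ⟨?_, ?_⟩
        · have : Filter.Tendsto (fun η : ℝ => η / K) (nhds 0) (nhds (0 / K)) :=
            (continuous_id.div_const K).tendsto 0
          rw [zero_div] at this
          exact this.mono_left nhdsWithin_le_nhds
        · filter_upwards [self_mem_nhdsWithin] with η hη
          exact div_pos hη hKpos
      have h1 := ht.eventually (Filter.eventually_lt_atBot (v z₁))
      have h2 : ∀ᶠ η : ℝ in nhdsWithin 0 (Set.Ioi 0), η ≤ ‖F z₁‖ :=
        nhdsWithin_le_nhds (Iic_mem_nhds hFpos)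
      have h3 : ∀ᶠ η : ℝ in nhdsWithin 0 (Set.Ioi 0), 0 < η := self_mem_nhdsWithin
      obtain ⟨η, ⟨ha, hb⟩, hc⟩ := ((h1.and h2).and h3).exists
      exact ⟨η, hc, hb, ha⟩
    set S : Set ℂ := Metric.closedBall 0 1 ∩ {z | η ≤ ‖F z‖} with hS
    have hScpt : IsCompact S :=
      hcpt.inter_right (isClosed_le continuous_const hF.continuous.norm)
    have hvcont : ContinuousOn v S := by
      refine hcont.continuousOn.add (continuousOn_const.mul (ContinuousOn.log ?_ ?_))
      · exact (hF.continuous.norm.div_const K).continuousOn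
      · intro z hz
        exact (div_pos (hη0.trans_le hz.2) hKpos).ne'
    have hz₁S : z₁ ∈ S := ⟨hz₁', hη1⟩
    obtain ⟨z₂, hz₂S, hz₂⟩ := hScpt.exists_isMaxOn ⟨z₁, hz₁S⟩ hvcont
    -- among the maximizers, the one farthest from the origin lies on the circle
    have hS'cpt : IsCompact (S ∩ v ⁻¹' {v z₂}) :=
      hScpt.of_isClosed_subset
        (hvcont.preimage_isClosed_of_isClosed hScpt.isClosed isClosed_singleton)
        Set.inter_subset_left
    obtain ⟨z₃, ⟨hz₃S, hz₃v⟩, hz₃⟩ :=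
      hS'cpt.exists_isMaxOn ⟨z₂, hz₂S, rfl⟩ continuous_norm.continuousOn
    have hz₃v : v z₃ = v z₂ := hz₃v
    have hmax : ∀ z ∈ S, v z ≤ v z₃ := fun z hz => hz₃v ▸ hz₂ hz
    have hle : ‖z₃‖ ≤ 1 := by simpa using hz₃S.1
    have hlt : η < ‖F z₃‖ := by
      refine lt_of_le_of_ne hz₃S.2 fun h => ?_
      have h1 := hmax z₁ hz₁S
      have h2 : v z₃ ≤ A + δ * Real.log (η / K) := by
        simp only [hv, ← h]
        have := le_of_abs_le (hA z₃ hz₃S.1)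
        linarith
      linarith
    have hFz₃ : F z₃ ≠ 0 := norm_pos_iff.1 (hη0.trans hlt)
    have hone : ‖z₃‖ = 1 := by
      by_contra hne
      have hlt1 : ‖z₃‖ < 1 := lt_of_le_of_ne hle hne
      have hnear : ∀ᶠ z in nhds z₃, z ∈ S := by
        have h1 : ∀ᶠ z in nhds z₃, ‖z‖ < 1 :=
          (continuous_norm.tendsto z₃).eventually (gt_mem_nhds hlt1)
        have h2 : ∀ᶠ z in nhds z₃, η < ‖F z‖ :=
          (hF.continuous.norm.tendsto z₃).eventually (lt_mem_nhds hlt)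
        filter_upwards [h1, h2] with z hz1 hz2
        exact ⟨by simpa using hz1.le, hz2.le⟩
      obtain ⟨L, hL, hLeq, hLle⟩ := hmin (F z₃) hFz₃
      set H : ℂ → ℂ := fun z => L (F z) - Q z + δ * Complex.log (F z / F z₃) with hH
      have hHan : AnalyticAt ℂ H z₃ := by
        have hFa : AnalyticAt ℂ F z₃ := hF.analyticAt z₃
        refine ((hL.comp hFa).sub (hQ.analyticAt z₃)).add (analyticAt_const.mul ?_)
        refine AnalyticAt.clog (hFa.div analyticAt_const hFz₃) ?_
        rw [div_self hFz₃]; exact Complex.one_mem_slitPlane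
      have hre : ∀ z, F z ≠ 0 →
          (H z).re = (L (F z)).re - (Q z).re + δ * Real.log (‖F z‖ / K)
            - δ * Real.log (‖F z₃‖ / K) := by
        intro z hz
        have e1 : Real.log (‖F z‖ / ‖F z₃‖) =
            Real.log (‖F z‖ / K) - Real.log (‖F z₃‖ / K) := by
          have a1 := norm_pos_iff.2 hz
          have a2 := norm_pos_iff.2 hFz₃
          rw [Real.log_div a1.ne' a2.ne', Real.log_div a1.ne' hKpos.ne',
            Real.log_div a2.ne' hKpos.ne']
          ring
        simp only [hH, Complex.add_re, Complex.sub_re, Complex.re_ofReal_mul, Complex.log_re,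
          norm_div, e1]
        ring
      have hH3 : (H z₃).re = v z₃ - δ * Real.log (‖F z₃‖ / K) := by
        rw [hre z₃ hFz₃, hLeq]
      have hHle : ∀ᶠ z in nhds z₃, (H z).re ≤ v z - δ * Real.log (‖F z₃‖ / K) := by
        filter_upwards [hnear, hF.continuous.continuousAt.eventually hLle] with z hzS hz
        rw [hre z (norm_pos_iff.1 (hη0.trans_le hzS.2))]
        simp only [hv]; linarith
      have hloc : ∀ᶠ z in nhds z₃, (H z).re ≤ (H z₃).re := by
        filter_upwards [hnear, hHle] with z hzS hz
        rw [hH3]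
        linarith [hmax z hzS]
      have hconst := eventually_re_eq_of_isLocalMax hHan hloc
      have hfar : ∀ᶠ z in nhds z₃, ‖z‖ ≤ ‖z₃‖ := by
        filter_upwards [hnear, hHle, hconst] with z hzS hz hc
        refine hz₃ ⟨hzS, ?_⟩
        have h1 := hmax z hzS
        rw [hc, hH3] at hz
        show v z = v z₂
        linarith
      -- but there are points near `z₃` with larger modulus
      have hcurve : Filter.Tendsto (fun s : ℝ => z₃ + (s : ℂ) * (if z₃ = 0 then 1 else z₃))
          (nhdsWithin 0 (Set.Ioi 0)) (nhds z₃) := by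
        have : Continuous fun s : ℝ => z₃ + (s : ℂ) * (if z₃ = 0 then 1 else z₃) := by fun_prop
        have := this.tendsto 0
        simp only [Complex.ofReal_zero, zero_mul, add_zero] at this
        exact this.mono_left nhdsWithin_le_nhds
      have hpos : ∀ᶠ s : ℝ in nhdsWithin 0 (Set.Ioi 0), 0 < s := self_mem_nhdsWithin
      obtain ⟨s, hs, hs0⟩ := ((hcurve.eventually hfar).and hpos).exists
      by_cases h0 : z₃ = 0
      · simp [h0] at hs; linarith
      · have h3 : 0 < ‖z₃‖ := norm_pos_iff.2 h0
        have e : z₃ + (s : ℂ) * z₃ = ((1 + s : ℝ) : ℂ) * z₃ := by push_cast; ring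
        rw [if_neg h0, e, norm_mul, Complex.norm_real, Real.norm_eq_abs,
          abs_of_pos (by linarith)] at hs
        nlinarith
    have hfin : v z₃ ≤ M := by
      have h1 := hM z₃ hone
      have h2 : Real.log (‖F z₃‖ / K) ≤ 0 :=
        Real.log_nonpos (by positivity) ((div_le_one hKpos).2 (hK z₃ hz₃S.1))
      simp only [hv]
      nlinarith
    exact (hmax z₁ hz₁S).trans hfin
  have hlim : Filter.Tendsto (fun δ : ℝ => u (F z₁) - (Q z₁).re + δ * Real.log (‖F z₁‖ / K))
      (nhdsWithin 0 (Set.Ioi 0)) (nhds (u (F z₁) - (Q z₁).re)) := by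
    have : Continuous fun δ : ℝ => u (F z₁) - (Q z₁).re + δ * Real.log (‖F z₁‖ / K) := by
      fun_prop
    have := this.tendsto 0
    simp only [zero_mul, add_zero] at this
    exact this.mono_left nhdsWithin_le_nhds
  exact le_of_tendsto hlim (by filter_upwards [self_mem_nhdsWithin] with δ hδ using key δ hδ)

/-- The sub-mean value inequality for `u ∘ F` at the centre of the disc, where `F` vanishes. -/
lemma integral_comp_nonneg {u : ℂ → ℝ} (hu : Continuous u) (hu0 : u 0 = 0)
    (hmin : HasAnalyticMinorants u) {F : ℂ → ℂ} (hF : Differentiable ℂ F) (hF0 : F 0 = 0) :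
    0 ≤ ∫ t, u (F (circlePt t)) ∂arcLength := by
  rcases (hF.analyticAt 0).eventually_eq_zero_or_eventually_ne_zero with h | h
  · have hz : F = fun _ => 0 :=
      AnalyticOnNhd.eq_of_eventuallyEq (fun z _ => hF.analyticAt z)
        (fun z _ => analyticAt_const) h
    simp [hz, hu0]
  set v : CircleT → ℝ := fun t => u (F (circlePt t)) with hv
  have hvc : Continuous v := hu.comp (hF.continuous.comp continuous_circlePt)
  refine le_of_forall_pos_le_add fun ε hε => ?_
  obtain ⟨c, hc⟩ := exists_trigPoly_near (Complex.continuous_ofReal.comp hvc) (half_pos hε)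
  set Q : ℂ → ℂ := fun z => analyticPart c z + coanalyticPart c z with hQdef
  have hQ : Differentiable ℂ Q :=
    (differentiable_analyticPart c).add (differentiable_coanalyticPart c)
  have hre : ∀ t, (trigPoly c t).re = (Q (circlePt t)).re := by
    intro t; rw [trigPoly_eq_add]; simp [hQdef]
  have habs : ∀ t, |v t - (Q (circlePt t)).re| ≤ ε / 2 := by
    intro t
    have := (Complex.abs_re_le_norm _).trans (hc t).le
    simpa [hre] using this
  have hsph : ∀ z : ℂ, ‖z‖ = 1 → u (F z) - (Q z).re ≤ ε / 2 := by
    intro z hz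
    obtain ⟨x, hx⟩ : ∃ x : ℝ, circlePt x = z := by
      refine ⟨z.arg, ?_⟩
      rw [circlePt_coe, circleMap]
      simpa [hz] using Complex.norm_mul_exp_arg_mul_I z
    rw [← hx]; exact le_of_abs_le (habs x)
  have hlim : Filter.Tendsto (fun z => u (F z) - (Q z).re) (nhdsWithin 0 {0}ᶜ)
      (nhds (u (F 0) - (Q 0).re)) := by
    have : Continuous fun z => u (F z) - (Q z).re :=
      (hu.comp hF.continuous).sub (Complex.continuous_re.comp hQ.continuous)
    exact (this.tendsto 0).mono_left nhdsWithin_le_nhds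
  have hball : ∀ᶠ z : ℂ in nhdsWithin 0 {0}ᶜ, ‖z‖ ≤ 1 := by
    refine nhdsWithin_le_nhds ?_
    filter_upwards [Metric.closedBall_mem_nhds (0 : ℂ) one_pos] with z hz
    simpa using hz
  have h0 : u (F 0) - (Q 0).re ≤ ε / 2 := by
    refine le_of_tendsto hlim ?_
    filter_upwards [h, hball] with z hz hz1
    exact comp_sub_re_le_of_forall_sphere hu hmin hF hQ hsph hz1 hz
  rw [hF0, hu0] at h0
  have hQc : Continuous fun t => Q (circlePt t) := hQ.continuous.comp continuous_circlePt
  have hQre : Continuous fun t => (Q (circlePt t)).re := Complex.continuous_re.comp hQc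
  have hmean : ∫ t, (Q (circlePt t)).re ∂arcLength = (Q 0).re := by
    have := integral_re (𝕜 := ℂ) (integrable_of_continuous hQc)
    simp only [RCLike.re_eq_complex_re] at this
    rw [this, integral_comp_circlePt_of_diffContOnCl hQ.diffContOnCl]
  have hmono : ∫ t, (Q (circlePt t)).re - ε / 2 ∂arcLength ≤ ∫ t, v t ∂arcLength := by
    refine integral_mono (integrable_of_continuous (hQre.sub continuous_const)) (integrable_of_continuous hvc)
      fun t => ?_
    have := neg_le_of_abs_le (habs t)
    simp only; linarith
  rw [integral_sub (integrable_of_continuous hQre) (integrable_const _), hmean] at hmono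
  simp at hmono
  linarith

/-! ### Two homogeneous subharmonic functions -/

lemma continuous_homogeneous {ρ : ℝ} (hρ : 0 < ρ) {k : ℝ → ℝ} (hk : Continuous k)
    (hk1 : ∀ θ, |k θ| ≤ 1) : Continuous fun ζ : ℂ => ‖ζ‖ ^ ρ * k |ζ.arg| := by
  rw [continuous_iff_continuousAt]
  intro ζ
  by_cases h : ζ = 0
  · subst h
    have hn : Filter.Tendsto (fun ζ : ℂ => ‖ζ‖ ^ ρ) (nhds 0) (nhds 0) := by
      have : Continuous fun ζ : ℂ => ‖ζ‖ ^ ρ :=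
        continuous_norm.rpow_const fun _ => Or.inr hρ.le
      simpa [Real.zero_rpow hρ.ne'] using this.tendsto 0
    rw [ContinuousAt, norm_zero, Real.zero_rpow hρ.ne', zero_mul]
    refine squeeze_zero_norm (fun ζ => ?_) hn
    rw [norm_mul, Real.norm_eq_abs, Real.norm_eq_abs, abs_of_nonneg (by positivity)]
    exact mul_le_of_le_one_right (by positivity) (hk1 _)
  · have h1 : ContinuousAt (fun ζ : ℂ => |ζ.arg|) ζ := by
      have e : (fun ζ : ℂ => |ζ.arg|) =ᶠ[nhds ζ] fun ζ => Real.arccos (ζ.re / ‖ζ‖) := by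
        filter_upwards [isOpen_ne.mem_nhds h] with z hz
        rw [← Complex.cos_arg hz, ← Real.cos_abs,
          Real.arccos_cos (abs_nonneg _) (Complex.abs_arg_le_pi z)]
      refine ContinuousAt.congr ?_ e.symm
      exact Real.continuous_arccos.continuousAt.comp
        (Complex.continuous_re.continuousAt.div continuous_norm.continuousAt (norm_ne_zero_iff.2 h))
    exact (continuous_norm.continuousAt.rpow_const (Or.inl (norm_ne_zero_iff.2 h))).mul
      (hk.continuousAt.comp h1)

/-- A rotated branch `C (ζ / ζ₀) ^ ρ` of the power, analytic near `ζ₀`. -/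
lemma exists_branch (ρ χ : ℝ) {ζ₀ : ℂ} (h0 : ζ₀ ≠ 0) :
    ∃ L : ℂ → ℂ, AnalyticAt ℂ L ζ₀ ∧
      ∀ ζ, ζ ≠ 0 → (L ζ).re = ‖ζ‖ ^ ρ * Real.cos (ρ * (ζ / ζ₀).arg + χ) := by
  refine ⟨fun ζ => (‖ζ₀‖ ^ ρ : ℝ) * Complex.exp (χ * Complex.I) *
    Complex.exp (ρ * Complex.log (ζ / ζ₀)), ?_, fun ζ hζ => ?_⟩
  · refine analyticAt_const.mul (AnalyticAt.cexp (analyticAt_const.mul ?_))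
    refine AnalyticAt.clog (analyticAt_id.div analyticAt_const h0) ?_
    simp [div_self h0, Complex.one_mem_slitPlane]
  · beta_reduce
    rw [mul_assoc, ← Complex.exp_add, Complex.re_ofReal_mul, Complex.exp_re]
    have e1 : ((χ : ℂ) * Complex.I + ρ * Complex.log (ζ / ζ₀)).re
        = ρ * (Real.log ‖ζ‖ - Real.log ‖ζ₀‖) := by
      simp [Complex.log_re, Real.log_div (norm_ne_zero_iff.2 hζ) (norm_ne_zero_iff.2 h0)]
    have e2 : ((χ : ℂ) * Complex.I + ρ * Complex.log (ζ / ζ₀)).im = ρ * (ζ / ζ₀).arg + χ := by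
      simp [Complex.log_im]; ring
    rw [e1, e2, Real.rpow_def_of_pos (norm_pos_iff.2 hζ), Real.rpow_def_of_pos (norm_pos_iff.2 h0),
      ← mul_assoc, ← Real.exp_add]
    congr 2; ring

lemma exists_arg_eq {ζ ζ₀ : ℂ} (h : ζ ≠ 0) (h0 : ζ₀ ≠ 0) :
    ∃ n : ℤ, ζ.arg = ζ₀.arg + (ζ / ζ₀).arg + 2 * Real.pi * n ∧ |n| ≤ 1 := by
  have h1 : ((ζ₀ * (ζ / ζ₀)).arg : Real.Angle) = ζ₀.arg + (ζ / ζ₀).arg :=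
    Complex.arg_mul_coe_angle h0 (div_ne_zero h h0)
  rw [mul_div_cancel₀ _ h0, ← Real.Angle.coe_add, Real.Angle.angle_eq_iff_two_pi_dvd_sub] at h1
  obtain ⟨n, hn⟩ := h1
  refine ⟨n, by linarith, ?_⟩
  have a1 := Complex.neg_pi_lt_arg ζ
  have a2 := Complex.arg_le_pi ζ
  have b1 := Complex.neg_pi_lt_arg ζ₀
  have b2 := Complex.arg_le_pi ζ₀
  have c1 := Complex.neg_pi_lt_arg (ζ / ζ₀)
  have c2 := Complex.arg_le_pi (ζ / ζ₀)
  have hp := Real.pi_pos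
  have d1 : (n : ℝ) < 2 := by
    by_contra! hc; nlinarith
  have d2 : (-2 : ℝ) < n := by
    by_contra! hc; nlinarith
  rw [abs_le]
  constructor
  · have : (-2 : ℤ) < n := by exact_mod_cast d2
    omega
  · have : n < (2 : ℤ) := by exact_mod_cast d1
    omega

/-- `Re ζ ^ ρ`, with the principal branch. -/
noncomputable def rePow (ρ : ℝ) (ζ : ℂ) : ℝ := ‖ζ‖ ^ ρ * Real.cos (ρ * |ζ.arg|)

/-- `-Re ζ ^ ρ` on the sector `|arg ζ| ≤ π / ρ`, and `|ζ| ^ ρ` on the rest of the plane. -/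
noncomputable def negRePow (ρ : ℝ) (ζ : ℂ) : ℝ :=
  ‖ζ‖ ^ ρ * -Real.cos (min (ρ * |ζ.arg|) Real.pi)

lemma continuous_rePow {ρ : ℝ} (hρ : 0 < ρ) : Continuous (rePow ρ) :=
  continuous_homogeneous hρ (k := fun θ => Real.cos (ρ * θ)) (by fun_prop)
    fun _ => Real.abs_cos_le_one _

lemma continuous_negRePow {ρ : ℝ} (hρ : 0 < ρ) : Continuous (negRePow ρ) :=
  continuous_homogeneous hρ (k := fun θ => -Real.cos (min (ρ * θ) Real.pi)) (by fun_prop)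
    fun _ => by rw [abs_neg]; exact Real.abs_cos_le_one _

lemma rePow_zero {ρ : ℝ} (hρ : 0 < ρ) : rePow ρ 0 = 0 := by
  simp [rePow, Real.zero_rpow hρ.ne']

lemma negRePow_zero {ρ : ℝ} (hρ : 0 < ρ) : negRePow ρ 0 = 0 := by
  simp [negRePow, Real.zero_rpow hρ.ne']

lemma cos_le_cos_of_add_le {a b : ℝ} (hb : 0 ≤ b) (hab : b ≤ a) (h : a + b ≤ 2 * Real.pi) :
    Real.cos a ≤ Real.cos b := by
  have := Real.cos_sub_cos a b
  have h1 : 0 ≤ Real.sin ((a + b) / 2) :=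
    Real.sin_nonneg_of_nonneg_of_le_pi (by linarith) (by linarith)
  have h2 : 0 ≤ Real.sin ((a - b) / 2) :=
    Real.sin_nonneg_of_nonneg_of_le_pi (by linarith) (by linarith)
  nlinarith [mul_nonneg h1 h2]

/-- For `ρ ≤ 1` every branch of `Re ζ ^ ρ` lies below the principal one. -/
lemma hasAnalyticMinorants_rePow {ρ : ℝ} (hρ : 0 < ρ) (hρ1 : ρ ≤ 1) :
    HasAnalyticMinorants (rePow ρ) := by
  intro ζ₀ h0
  obtain ⟨L, hL, hre⟩ := exists_branch ρ (ρ * ζ₀.arg) h0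
  have hp := Real.pi_pos
  refine ⟨L, hL, ?_, ?_⟩
  · rw [hre ζ₀ h0, div_self h0, rePow, Complex.arg_one, mul_zero, zero_add,
      ← Real.cos_abs (ρ * ζ₀.arg), abs_mul, abs_of_pos hρ]
  · filter_upwards [isOpen_ne.mem_nhds h0] with ζ hζ
    rw [hre ζ hζ, rePow]
    refine mul_le_mul_of_nonneg_left ?_ (by positivity)
    obtain ⟨n, hn, hn1⟩ := exists_arg_eq hζ h0
    rw [← mul_add, ← Real.cos_abs, abs_mul, abs_of_pos hρ]
    set A := (ζ / ζ₀).arg + ζ₀.arg with hA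
    have hA' : A = ζ.arg - 2 * Real.pi * n := by rw [hn, hA]; ring
    have a2 := Complex.abs_arg_le_pi ζ
    have b := Complex.abs_arg_le_pi ζ₀
    have c := Complex.abs_arg_le_pi (ζ / ζ₀)
    have hA2 : |A| ≤ 2 * Real.pi := (abs_add_le _ _).trans (by linarith)
    rcases eq_or_ne n 0 with h | h
    · rw [hA', h]; simp
    · have e : |A| = 2 * Real.pi - |ζ.arg| := by
        have hn' : n = 1 ∨ n = -1 := by rw [abs_le] at hn1; omega
        rw [abs_le] at a2 hA2
        rcases hn' with rfl | rfl <;> push_cast at hA'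
        · rw [abs_of_nonpos (by linarith), abs_of_nonneg (by linarith)]; linarith
        · rw [abs_of_nonneg (by linarith), abs_of_nonpos (by linarith)]; linarith
      refine cos_le_cos_of_add_le (by positivity) ?_ ?_
      · refine mul_le_mul_of_nonneg_left ?_ hρ.le
        rw [e]; linarith
      · rw [e]; nlinarith

lemma abs_arg_sub_le {ζ ζ₀ : ℂ} (h : ζ ≠ 0) (h0 : ζ₀ ≠ 0) :
    |ζ₀.arg| - |(ζ / ζ₀).arg| ≤ |ζ.arg| := by
  obtain ⟨n, hn, hn1⟩ := exists_arg_eq h h0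
  have hp := Real.pi_pos
  have a := Complex.abs_arg_le_pi ζ
  have b := Complex.abs_arg_le_pi ζ₀
  have c := Complex.abs_arg_le_pi (ζ / ζ₀)
  have hn' : n = 0 ∨ n = 1 ∨ n = -1 := by rw [abs_le] at hn1; omega
  rcases hn' with h | h | h
  · rw [hn, h]
    have := abs_sub_abs_le_abs_sub ζ₀.arg (-(ζ / ζ₀).arg)
    simpa using this
  · rw [h] at hn; push_cast at hn
    rw [abs_le] at a b c
    have e : ζ₀.arg = ζ.arg - (ζ / ζ₀).arg - 2 * Real.pi := by linarith
    rw [abs_of_nonpos (by linarith : ζ₀.arg ≤ 0), abs_of_nonneg (by linarith : 0 ≤ ζ.arg)]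
    have := neg_abs_le (ζ / ζ₀).arg
    linarith
  · rw [h] at hn; push_cast at hn
    rw [abs_le] at a b c
    rw [abs_of_nonneg (by linarith : 0 ≤ ζ₀.arg), abs_of_nonpos (by linarith : ζ.arg ≤ 0)]
    have := le_abs_self (ζ / ζ₀).arg
    linarith

lemma hasAnalyticMinorants_negRePow {ρ : ℝ} (hρ1 : 1 ≤ ρ) :
    HasAnalyticMinorants (negRePow ρ) := by
  intro ζ₀ h0
  have hρ : 0 < ρ := by linarith
  have hp := Real.pi_pos
  have hψ : Filter.Tendsto (fun ζ : ℂ => |(ζ / ζ₀).arg|) (nhds ζ₀) (nhds 0) := by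
    have h1 : ContinuousAt (fun ζ : ℂ => |(ζ / ζ₀).arg|) ζ₀ := by
      refine ContinuousAt.abs (ContinuousAt.comp (g := Complex.arg) ?_
        (continuousAt_id.div_const ζ₀))
      refine Complex.continuousAt_arg ?_
      simp [div_self h0, Complex.one_mem_slitPlane]
    simpa [ContinuousAt, div_self h0] using h1
  rcases lt_or_ge (ρ * |ζ₀.arg|) Real.pi with hlt | hge
  · -- inside the sector
    obtain ⟨L, hL, hre⟩ := exists_branch ρ (ρ * ζ₀.arg + Real.pi) h0
    refine ⟨L, hL, ?_, ?_⟩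
    · rw [hre ζ₀ h0, div_self h0, negRePow, Complex.arg_one, mul_zero, zero_add, min_eq_left hlt.le,
        Real.cos_add_pi, ← Real.cos_abs (ρ * ζ₀.arg), abs_mul, abs_of_pos hρ]
    · have hsmall : ∀ᶠ ζ in nhds ζ₀, |(ζ / ζ₀).arg| < Real.pi / ρ - |ζ₀.arg| := by
        refine hψ.eventually (gt_mem_nhds ?_)
        rw [sub_pos, lt_div_iff₀ hρ]; linarith
      filter_upwards [isOpen_ne.mem_nhds h0, hsmall] with ζ hζ hs
      rw [hre ζ hζ, negRePow]
      refine mul_le_mul_of_nonneg_left ?_ (by positivity)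
      obtain ⟨n, hn, hn1⟩ := exists_arg_eq hζ h0
      have hdiv : Real.pi / ρ ≤ Real.pi := div_le_self hp.le hρ1
      have hA : |ζ₀.arg + (ζ / ζ₀).arg| < Real.pi / ρ := (abs_add_le _ _).trans_lt (by linarith)
      have hn0 : n = 0 := by
        have a := Complex.abs_arg_le_pi ζ
        have hn' : n = 0 ∨ n = 1 ∨ n = -1 := by rw [abs_le] at hn1; omega
        rw [abs_lt] at hA; rw [abs_le] at a
        rcases hn' with h | h | h
        · exact h
        · rw [h] at hn; push_cast at hn; linarith
        · rw [h] at hn; push_cast at hn; linarith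
      have e : ζ.arg = ζ₀.arg + (ζ / ζ₀).arg := by rw [hn, hn0]; simp
      have hlt' : ρ * |ζ.arg| ≤ Real.pi := by
        rw [e]; rw [lt_div_iff₀ hρ] at hA; linarith
      rw [min_eq_left hlt', ← add_assoc, ← mul_add, Real.cos_add_pi, add_comm (ζ / ζ₀).arg, ← e,
        ← Real.cos_abs (ρ * ζ.arg), abs_mul, abs_of_pos hρ]
  · -- outside the sector, or on its boundary
    obtain ⟨L, hL, hre⟩ := exists_branch ρ 0 h0
    refine ⟨L, hL, ?_, ?_⟩
    · rw [hre ζ₀ h0, div_self h0, negRePow, min_eq_right hge]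
      simp
    · have hsmall : ∀ᶠ ζ in nhds ζ₀, |(ζ / ζ₀).arg| < Real.pi / ρ :=
        hψ.eventually (gt_mem_nhds (by positivity))
      filter_upwards [isOpen_ne.mem_nhds h0, hsmall] with ζ hζ hs
      rw [hre ζ hζ, negRePow]
      refine mul_le_mul_of_nonneg_left ?_ (by positivity)
      have hs' : ρ * |(ζ / ζ₀).arg| ≤ Real.pi := by
        rw [lt_div_iff₀ hρ] at hs; linarith
      rw [add_zero, ← Real.cos_abs, abs_mul, abs_of_pos hρ, ← Real.cos_pi_sub]
      refine Real.cos_le_cos_of_nonneg_of_le_pi (sub_nonneg.2 (min_le_right _ _)) hs' ?_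
      have h1 := mul_le_mul_of_nonneg_left (abs_arg_sub_le hζ h0) hρ.le
      rcases min_cases (ρ * |ζ.arg|) Real.pi with ⟨h, _⟩ | ⟨h, _⟩ <;> rw [h]
      · linarith
      · simp; positivity

/-! ### Monotonicity of `sin (p τ) / (sin τ cos ^ (p - 1) τ)` -/

section SineQuotient
open Real Set

lemma hasDerivAt_sinQuotient {p τ : ℝ} (h0 : 0 < τ) (h1 : τ < π / 2) :
    HasDerivAt (fun τ => sin (p * τ) / (sin τ * cos τ ^ (p - 1)))
      (((p - 1) * sin τ * cos ((p - 1) * τ) - cos τ * sin ((p - 1) * τ)) /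
        (sin τ ^ 2 * cos τ ^ p)) τ := by
  have hs : 0 < sin τ := sin_pos_of_pos_of_lt_pi h0 (by linarith [pi_pos])
  have hc : 0 < cos τ := cos_pos_of_mem_Ioo ⟨by linarith [pi_pos], h1⟩
  have d1 : HasDerivAt (fun τ => sin (p * τ)) (cos (p * τ) * p) τ := by
    simpa using ((hasDerivAt_id τ).const_mul p).sin
  have d2 : HasDerivAt (fun τ => sin τ * cos τ ^ (p - 1))
      (cos τ * cos τ ^ (p - 1) + sin τ * (-sin τ * (p - 1) * cos τ ^ (p - 1 - 1))) τ :=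
    (hasDerivAt_sin τ).mul ((hasDerivAt_cos τ).rpow_const (Or.inl hc.ne'))
  refine (d1.div d2 (by positivity)).congr_deriv ?_
  have e1 : cos τ ^ (p - 1) = cos τ ^ (p - 1 - 1) * cos τ := by
    rw [← rpow_add_one hc.ne']; ring_nf
  have e2 : cos τ ^ p = cos τ ^ (p - 1 - 1) * cos τ ^ 2 := by
    rw [← rpow_natCast, ← rpow_add hc]; norm_num; ring_nf
  have e3 : sin (p * τ) = sin ((p - 1) * τ) * cos τ + cos ((p - 1) * τ) * sin τ := by
    rw [← sin_add]; ring_nf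
  have e4 : cos (p * τ) = cos ((p - 1) * τ) * cos τ - sin ((p - 1) * τ) * sin τ := by
    rw [← cos_add]; ring_nf
  have hP : 0 < cos τ ^ (p - 1 - 1) := rpow_pos_of_pos hc _
  rw [e1, e2, e3, e4]
  set P := cos τ ^ (p - 1 - 1)
  have hsc : cos τ ^ 2 = 1 - sin τ ^ 2 := cos_sq' τ
  field_simp
  linear_combination (p * sin τ * cos ((p - 1) * τ) - cos τ * sin ((p - 1) * τ) -
    sin τ * cos ((p - 1) * τ)) * hsc

lemma hasDerivAt_sinQuotient_numerator (p τ : ℝ) :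
    HasDerivAt (fun τ => (p - 1) * sin τ * cos ((p - 1) * τ) - cos τ * sin ((p - 1) * τ))
      ((1 - (p - 1) ^ 2) * (sin τ * sin ((p - 1) * τ))) τ := by
  have d1 : HasDerivAt (fun τ => sin ((p - 1) * τ)) (cos ((p - 1) * τ) * (p - 1)) τ := by
    simpa using ((hasDerivAt_id τ).const_mul (p - 1)).sin
  have d2 : HasDerivAt (fun τ => cos ((p - 1) * τ)) (-sin ((p - 1) * τ) * (p - 1)) τ := by
    simpa using ((hasDerivAt_id τ).const_mul (p - 1)).cos
  refine ((((hasDerivAt_sin τ).const_mul (p - 1)).mul d2).sub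
    ((hasDerivAt_cos τ).mul d1)).congr_deriv ?_
  ring

lemma sinQuotient_numerator_nonneg {p τ : ℝ} (hp1 : 1 ≤ p) (hp2 : p ≤ 2) (h0 : 0 ≤ τ)
    (h1 : τ ≤ π / 2) : 0 ≤ (p - 1) * sin τ * cos ((p - 1) * τ) - cos τ * sin ((p - 1) * τ) := by
  have hm : MonotoneOn (fun τ => (p - 1) * sin τ * cos ((p - 1) * τ) - cos τ * sin ((p - 1) * τ))
      (Icc 0 (π / 2)) := by
    refine monotoneOn_of_hasDerivWithinAt_nonneg (convex_Icc _ _)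
      (fun x _ => (hasDerivAt_sinQuotient_numerator p x).continuousAt.continuousWithinAt)
      (fun x _ => (hasDerivAt_sinQuotient_numerator p x).hasDerivWithinAt) fun x hx => ?_
    rw [interior_Icc] at hx
    have hπ := pi_pos
    refine mul_nonneg (by nlinarith) (mul_nonneg ?_ ?_)
    · exact sin_nonneg_of_nonneg_of_le_pi hx.1.le (by linarith [hx.2])
    · exact sin_nonneg_of_nonneg_of_le_pi (mul_nonneg (by linarith) hx.1.le)
        (by nlinarith [hx.1, hx.2])
  simpa using hm ⟨le_rfl, by positivity⟩ ⟨h0, h1⟩ h0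

lemma sinQuotient_numerator_nonpos {p τ : ℝ} (hp2 : 2 ≤ p) (h0 : 0 ≤ τ)
    (h1 : τ ≤ π / p) : (p - 1) * sin τ * cos ((p - 1) * τ) - cos τ * sin ((p - 1) * τ) ≤ 0 := by
  have hm : AntitoneOn (fun τ => (p - 1) * sin τ * cos ((p - 1) * τ) - cos τ * sin ((p - 1) * τ))
      (Icc 0 (π / p)) := by
    refine antitoneOn_of_hasDerivWithinAt_nonpos (convex_Icc _ _)
      (fun x _ => (hasDerivAt_sinQuotient_numerator p x).continuousAt.continuousWithinAt)
      (fun x _ => (hasDerivAt_sinQuotient_numerator p x).hasDerivWithinAt) fun x hx => ?_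
    rw [interior_Icc] at hx
    have hπ := pi_pos
    have hx2 : x * p < π := (lt_div_iff₀ (by linarith)).1 hx.2
    have hx1 := hx.1
    refine mul_nonpos_of_nonpos_of_nonneg (by nlinarith) (mul_nonneg ?_ ?_)
    · exact sin_nonneg_of_nonneg_of_le_pi hx.1.le (by nlinarith)
    · exact sin_nonneg_of_nonneg_of_le_pi (mul_nonneg (by linarith) hx.1.le)
        (by nlinarith)
  have h2 : 0 ≤ π / p := h0.trans h1
  simpa using hm ⟨le_rfl, h2⟩ ⟨h0, h1⟩ h0

lemma sinQuotient_monotoneOn {p : ℝ} (hp1 : 1 ≤ p) (hp2 : p ≤ 2) :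
    MonotoneOn (fun τ => sin (p * τ) / (sin τ * cos τ ^ (p - 1))) (Ioo 0 (π / 2)) := by
  refine monotoneOn_of_hasDerivWithinAt_nonneg (f' := fun τ => ((p - 1) * sin τ * cos ((p - 1) * τ) -
    cos τ * sin ((p - 1) * τ)) / (sin τ ^ 2 * cos τ ^ p)) (convex_Ioo _ _)
    (fun x hx => (hasDerivAt_sinQuotient hx.1 hx.2).continuousAt.continuousWithinAt)
    (fun x hx => ?_) fun x hx => ?_
  · rw [interior_Ioo] at hx
    exact (hasDerivAt_sinQuotient hx.1 hx.2).hasDerivWithinAt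
  · rw [interior_Ioo] at hx
    have hc : 0 ≤ cos x := cos_nonneg_of_mem_Icc ⟨by linarith [pi_pos, hx.1], hx.2.le⟩
    exact div_nonneg (sinQuotient_numerator_nonneg hp1 hp2 hx.1.le hx.2.le) (by positivity)

lemma sinQuotient_antitoneOn {p : ℝ} (hp2 : 2 < p) :
    AntitoneOn (fun τ => sin (p * τ) / (sin τ * cos τ ^ (p - 1))) (Ioc 0 (π / p)) := by
  have hlt : ∀ x ∈ Ioc 0 (π / p), x < π / 2 := fun x hx =>
    hx.2.trans_lt (div_lt_div_of_pos_left pi_pos two_pos hp2)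
  refine antitoneOn_of_hasDerivWithinAt_nonpos (f' := fun τ => ((p - 1) * sin τ * cos ((p - 1) * τ) -
    cos τ * sin ((p - 1) * τ)) / (sin τ ^ 2 * cos τ ^ p)) (convex_Ioc _ _)
    (fun x hx => (hasDerivAt_sinQuotient hx.1 (hlt x hx)).continuousAt.continuousWithinAt)
    (fun x hx => ?_) fun x hx => ?_
  · have hx := interior_subset hx
    exact (hasDerivAt_sinQuotient hx.1 (hlt x hx)).hasDerivWithinAt
  · have hx := interior_subset hx
    have hc : 0 ≤ cos x := cos_nonneg_of_mem_Icc ⟨by linarith [pi_pos, hx.1], (hlt x hx).le⟩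
    exact div_nonpos_of_nonpos_of_nonneg (sinQuotient_numerator_nonpos hp2.le hx.1.le hx.2)
      (by positivity)

/-- The angle `α = π / (2 p)` is where `sin (p α) = 1`, so that the quotient above equals
`1 / (sin α cos ^ (p - 1) α)` there. -/
lemma sin_mul_pi_div_eq_one {p : ℝ} (hp : 0 < p) : sin (p * (π / (2 * p))) = 1 := by
  rw [show p * (π / (2 * p)) = π / 2 by field_simp, sin_pi_div_two]

lemma cos_mul_pi_div_eq_zero {p : ℝ} (hp : 0 < p) : cos (p * (π / (2 * p))) = 0 := by
  rw [show p * (π / (2 * p)) = π / 2 by field_simp, cos_pi_div_two]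

lemma sinQuotient_cross_mul {p τ₁ τ₂ : ℝ} (h1 : 0 < τ₁) (h1' : τ₁ < π / 2) (h2 : 0 < τ₂)
    (h2' : τ₂ < π / 2) (h : sin (p * τ₁) / (sin τ₁ * cos τ₁ ^ (p - 1)) ≤
      sin (p * τ₂) / (sin τ₂ * cos τ₂ ^ (p - 1))) :
    sin (p * τ₁) * (sin τ₂ * cos τ₂ ^ (p - 1)) ≤ sin (p * τ₂) * (sin τ₁ * cos τ₁ ^ (p - 1)) := by
  have a1 : 0 < sin τ₁ := sin_pos_of_pos_of_lt_pi h1 (by linarith [pi_pos])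
  have a2 : 0 < sin τ₂ := sin_pos_of_pos_of_lt_pi h2 (by linarith [pi_pos])
  have b1 : 0 < cos τ₁ := cos_pos_of_mem_Ioo ⟨by linarith [pi_pos], h1'⟩
  have b2 : 0 < cos τ₂ := cos_pos_of_mem_Ioo ⟨by linarith [pi_pos], h2'⟩
  rwa [div_le_div_iff₀ (by positivity) (by positivity)] at h

end SineQuotient

/-! ### The two-variable inequality for `1 < p < 2` -/

section SmallExponent
open Real Set

lemma sinh_mul_rpow_le_sinh_mul {p t : ℝ} (hp1 : 1 ≤ p) (hp2 : p ≤ 2) (ht : 0 ≤ t) :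
    sinh t * (2 * cosh t) ^ (p - 1) ≤ sinh (p * t) := by
  set u := exp (-(2 * t)) with hu
  have hu0 : 0 < u := exp_pos _
  have hu1 : u ≤ 1 := exp_le_one_iff.2 (by linarith)
  have key : (1 - u) * (1 + u) ^ (p - 1) ≤ 1 - u ^ p := by
    have h1 := geom_mean_le_arith_mean2_weighted (w₁ := 2 - p) (w₂ := p - 1) (p₁ := 1 - u)
      (p₂ := 1 - u ^ 2) (by linarith) (by linarith) (by linarith) (by nlinarith) (by ring)
    have h2 := geom_mean_le_arith_mean2_weighted (w₁ := 2 - p) (w₂ := p - 1) (p₁ := u)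
      (p₂ := u ^ 2) (by linarith) (by linarith) (by linarith) (by positivity) (by ring)
    have e1 : (1 - u) ^ (2 - p) * (1 - u ^ 2) ^ (p - 1) = (1 - u) * (1 + u) ^ (p - 1) := by
      rw [show 1 - u ^ 2 = (1 - u) * (1 + u) by ring, mul_rpow (by linarith) (by linarith),
        ← mul_assoc, ← rpow_add' (by linarith) (by norm_num)]
      norm_num
    have e2 : u ^ (2 - p) * (u ^ 2) ^ (p - 1) = u ^ p := by
      rw [← rpow_natCast, ← rpow_mul hu0.le, ← rpow_add hu0]
      congr 1; push_cast; ring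
    rw [e1] at h1; rw [e2] at h2
    nlinarith
  have hs : sinh t = exp t * (1 - u) / 2 := by
    rw [sinh_eq, mul_sub, hu, ← exp_add]; ring_nf
  have hc : 2 * cosh t = exp t * (1 + u) := by
    rw [cosh_eq, mul_add, hu, ← exp_add]; ring_nf
  have hs' : sinh (p * t) = exp (p * t) * (1 - u ^ p) / 2 := by
    rw [sinh_eq, mul_sub, hu, ← exp_mul, ← exp_add]; ring_nf
  rw [hs, hc, hs', mul_rpow (exp_pos _).le (by linarith), ← exp_mul]
  have e : exp (p * t) = exp t * exp (t * (p - 1)) := by rw [← exp_add]; ring_nf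
  rw [e]
  nlinarith [mul_le_mul_of_nonneg_left key (mul_pos (exp_pos t) (exp_pos (t * (p - 1)))).le]

lemma two_rpow_lt_two_mul_sin_sq {p : ℝ} (hp1 : 1 < p) (hp2 : p < 2) :
    (2 : ℝ) ^ (2 - p) < 2 * sin (π / (2 * p)) ^ 2 := by
  set r := 2 - p with hr
  have hr0 : 0 < r := by linarith
  have hr1 : r < 1 := by linarith
  have hpr : p = 2 - r := by linarith
  set x := π * r / (2 * (2 - r)) with hx
  have h2r : 0 < 2 - r := by linarith
  have hx0 : 0 < x := by have := pi_pos; positivity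
  have e : 2 * sin (π / (2 * p)) ^ 2 = 1 + sin x := by
    have h1 := cos_two_mul (π / (2 * p))
    have h2 := sin_sq_add_cos_sq (π / (2 * p))
    have h3 : cos (2 * (π / (2 * p))) = - sin x := by
      rw [← cos_add_pi_div_two]; congr 1; rw [hx, hpr]; field_simp; ring
    linarith
  rw [e]
  have hπ := pi_gt_d2
  have hπ' := pi_lt_d2
  rcases le_or_gt r (1 / 2) with hle | hgt
  · -- Taylor expansions at `r = 0`
    have h1 : (2 : ℝ) ^ r ≤ 1 + 0.7 * r + 0.28 * r ^ 2 := by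
      have hl := log_two_lt_d9
      have hl0 := log_two_gt_d9
      rw [rpow_def_of_pos two_pos]
      have hy0 : 0 ≤ log 2 * r := by positivity
      have hy1 : log 2 * r ≤ 0.6932 * r := by nlinarith
      have := exp_bound' hy0 (by nlinarith) (n := 3) (by norm_num)
      norm_num [Finset.sum_range_succ, Nat.factorial] at this
      have a2 : (log 2 * r) ^ 2 ≤ (0.6932 * r) ^ 2 := pow_le_pow_left₀ hy0 hy1 2
      have a3 : (log 2 * r) ^ 3 ≤ (0.6932 * r) ^ 3 := pow_le_pow_left₀ hy0 hy1 3
      have a4 : r ^ 3 ≤ r ^ 2 / 2 := by nlinarith [sq_nonneg r]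
      nlinarith
    have hxr : x * (2 * (2 - r)) = π * r := by rw [hx]; field_simp
    have hx1 : x ≤ 0.53 := by nlinarith
    have h2 := sin_gt_sub_cube hx0
    have h3 : 0.7 * r + 0.28 * r ^ 2 < x - x ^ 3 / 4 := by
      have b1 : 0.78 * r * (1 + r / 2) ≤ x := by
        have : 0.78 * r * (1 + r / 2) * (2 * (2 - r)) ≤ x * (2 * (2 - r)) := by
          rw [hxr]; nlinarith [pow_pos hr0 3]
        exact le_of_mul_le_mul_right this (by linarith)
      have b2 : x - x ^ 3 / 4 ≥ 0.929 * x := by nlinarith [mul_pos hx0 hx0]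
      nlinarith
    have h4 := pow_pos hx0 3
    linarith
  · -- the chord of `2 ^ r` over `[1/2, 1]`
    have h1 : (2 : ℝ) ^ r ≤ 2 - 1.17 * (1 - r) := by
      have hs : √2 ≤ 1.415 := by
        rw [sqrt_le_left (by norm_num)]; norm_num
      have := geom_mean_le_arith_mean2_weighted (w₁ := 2 - 2 * r) (w₂ := 2 * r - 1) (p₁ := √2)
        (p₂ := 2) (by linarith) (by linarith) (by positivity) (by norm_num) (by ring)
      rw [sqrt_eq_rpow, ← rpow_mul two_pos.le, ← rpow_add two_pos, ← sqrt_eq_rpow,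
        show 1 / 2 * (2 - 2 * r) + (2 * r - 1) = r by ring] at this
      nlinarith
    have h2 : 1 - (π / 2 - x) ^ 2 / 2 ≤ sin x := by
      rw [← cos_pi_div_two_sub]; exact one_sub_sq_div_two_le_cos
    have e2 : π / 2 - x = π * ((1 - r) / (2 - r)) := by rw [hx]; field_simp; ring
    have h3 : ((1 - r) / (2 - r)) ^ 2 ≤ 2 / 9 * (1 - r) := by
      rw [div_pow, div_le_iff₀ (by positivity)]
      nlinarith [mul_nonneg (sub_nonneg.2 hr1.le) (sub_nonneg.2 hgt.le),
        mul_pos (sub_pos.2 hr1) (sub_pos.2 hgt)]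
    rw [e2, mul_pow] at h2
    have hπ2 : π ^ 2 ≤ 10 := by nlinarith
    have h4 : π ^ 2 * ((1 - r) / (2 - r)) ^ 2 ≤ 10 * (2 / 9 * (1 - r)) :=
      mul_le_mul hπ2 h3 (by positivity) (by norm_num)
    nlinarith

end SmallExponent

section SmallExponent
open Real Set

lemma HasDerivAt.nonpos_of_forall_le_left {f : ℝ → ℝ} {d a x : ℝ} (hf : HasDerivAt f d x)
    (hax : a < x) (h : ∀ y, a < y → y < x → f x ≤ f y) : d ≤ 0 := by
  have h1 := (hasDerivAt_iff_tendsto_slope.1 hf).mono_left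
    (nhdsWithin_mono x (fun y (hy : y < x) => ne_of_lt hy) : nhdsWithin x (Iio x) ≤ _)
  refine le_of_tendsto h1 ?_
  filter_upwards [Ioo_mem_nhdsLT hax] with y hy
  rw [slope_def_field]
  exact div_nonpos_of_nonneg_of_nonpos (sub_nonneg.2 (h y hy.1 hy.2)) (by linarith [hy.2])

lemma HasDerivAt.nonneg_of_forall_le_right {f : ℝ → ℝ} {d b x : ℝ} (hf : HasDerivAt f d x)
    (hxb : x < b) (h : ∀ y, x < y → y < b → f x ≤ f y) : 0 ≤ d := by
  have h1 := (hasDerivAt_iff_tendsto_slope.1 hf).mono_left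
    (nhdsWithin_mono x (fun y (hy : x < y) => ne_of_gt hy) : nhdsWithin x (Ioi x) ≤ _)
  refine ge_of_tendsto h1 ?_
  filter_upwards [Ioo_mem_nhdsGT hxb] with y hy
  rw [slope_def_field]
  exact div_nonneg (sub_nonneg.2 (h y hy.1 hy.2)) (by linarith [hy.1])

variable {p : ℝ}

/-- The difference of the two sides of the inequality for exponents `1 < p < 2`, in logarithmic
coordinates: `|z| = e ^ t`, `|w| = e ^ (-t)`, and `2 τ` is the argument of `z w` up to sign. -/
noncomputable def smallGap (p t τ : ℝ) : ℝ :=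
  sin (π / (2 * p)) ^ p * cosh (p * t)
    - sin (π / (2 * p)) ^ (p - 1) * cos (π / (2 * p)) * cos (p * τ)
    - (sinh t ^ 2 + sin τ ^ 2) ^ (p / 2)

lemma hasDerivAt_smallGap_left {t : ℝ} (τ : ℝ) (ht : 0 < t) :
    HasDerivAt (fun t => smallGap p t τ)
      (p * (sin (π / (2 * p)) ^ p * sinh (p * t)
        - (sinh t ^ 2 + sin τ ^ 2) ^ (p / 2 - 1) * (sinh t * cosh t))) t := by
  have hZ : 0 < sinh t ^ 2 + sin τ ^ 2 := by have := sinh_pos_iff.2 ht; positivity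
  have d1 : HasDerivAt (fun t => cosh (p * t)) (sinh (p * t) * p) t := by
    simpa using ((hasDerivAt_id t).const_mul p).cosh
  have d2 : HasDerivAt (fun t => sinh t ^ 2 + sin τ ^ 2) (2 * sinh t * cosh t) t := by
    simpa using ((hasDerivAt_sinh t).pow 2).add_const (sin τ ^ 2)
  refine (((d1.const_mul _).sub_const _).sub
    (d2.rpow_const (p := p / 2) (Or.inl hZ.ne'))).congr_deriv ?_
  ring

lemma hasDerivAt_smallGap_right {t τ : ℝ} (hZ : 0 < sinh t ^ 2 + sin τ ^ 2) :
    HasDerivAt (fun τ => smallGap p t τ)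
      (p * (sin (π / (2 * p)) ^ (p - 1) * cos (π / (2 * p)) * sin (p * τ)
        - (sinh t ^ 2 + sin τ ^ 2) ^ (p / 2 - 1) * (sin τ * cos τ))) τ := by
  have d1 : HasDerivAt (fun τ => cos (p * τ)) (-sin (p * τ) * p) τ := by
    simpa using ((hasDerivAt_id τ).const_mul p).cos
  have d2 : HasDerivAt (fun τ => sinh t ^ 2 + sin τ ^ 2) (2 * sin τ * cos τ) τ := by
    simpa using ((hasDerivAt_sin τ).pow 2).const_add (sinh t ^ 2)
  refine (((d1.const_mul _).const_sub _).sub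
    (d2.rpow_const (p := p / 2) (Or.inl hZ.ne'))).congr_deriv ?_
  ring

lemma pi_div_two_mul_mem (hp1 : 1 < p) : 0 < π / (2 * p) ∧ π / (2 * p) < π / 2 := by
  have := pi_pos
  exact ⟨by positivity, div_lt_div_of_pos_left this two_pos (by linarith)⟩

lemma sin_cos_pi_div_pos (hp1 : 1 < p) : 0 < sin (π / (2 * p)) ∧ 0 < cos (π / (2 * p)) := by
  obtain ⟨h1, h2⟩ := pi_div_two_mul_mem hp1
  exact ⟨sin_pos_of_pos_of_lt_pi h1 (by linarith [pi_pos]),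
    cos_pos_of_mem_Ioo ⟨by linarith, h2⟩⟩

lemma sin_quotient_le_of_le {τ : ℝ} (hp1 : 1 < p) (hp2 : p ≤ 2) (h0 : 0 < τ)
    (h1 : τ ≤ π / (2 * p)) :
    sin (π / (2 * p)) ^ (p - 1) * cos (π / (2 * p)) * sin (p * τ) ≤
      (sin (π / (2 * p)) * cos τ / cos (π / (2 * p))) ^ (p - 2) * (sin τ * cos τ) := by
  obtain ⟨ha, hb⟩ := pi_div_two_mul_mem hp1
  obtain ⟨hs, hc⟩ := sin_cos_pi_div_pos hp1
  have hcτ : 0 < cos τ := cos_pos_of_mem_Ioo ⟨by linarith, by linarith⟩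
  have h := sinQuotient_cross_mul h0 (h1.trans_lt hb) ha hb
    (sinQuotient_monotoneOn hp1.le hp2 ⟨h0, h1.trans_lt hb⟩ ⟨ha, hb⟩ h1)
  rw [sin_mul_pi_div_eq_one (by linarith), one_mul] at h
  set S := sin (π / (2 * p))
  set c := cos (π / (2 * p))
  have e1 : S ^ (p - 1) * c * sin (p * τ)
      = (S / c) ^ (p - 2) * (sin (p * τ) * (S * c ^ (p - 1))) := by
    rw [div_rpow hs.le hc.le, show p - 1 = (p - 2) + 1 by ring, rpow_add_one hs.ne',
      rpow_add_one hc.ne']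
    have := (rpow_pos_of_pos hc (p - 2)).ne'
    field_simp
  have e2 : (S * cos τ / c) ^ (p - 2) * (sin τ * cos τ)
      = (S / c) ^ (p - 2) * (sin τ * cos τ ^ (p - 1)) := by
    rw [show S * cos τ / c = S / c * cos τ by ring, mul_rpow (by positivity) hcτ.le,
      show p - 1 = (p - 2) + 1 by ring, rpow_add_one hcτ.ne']
    ring
  rw [e1, e2]
  gcongr

lemma le_sin_quotient_of_le {τ : ℝ} (hp1 : 1 < p) (hp2 : p ≤ 2) (h0 : π / (2 * p) ≤ τ)
    (h1 : τ < π / 2) :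
    (sin (π / (2 * p)) * cos τ / cos (π / (2 * p))) ^ (p - 2) * (sin τ * cos τ) ≤
    sin (π / (2 * p)) ^ (p - 1) * cos (π / (2 * p)) * sin (p * τ) := by
  obtain ⟨ha, hb⟩ := pi_div_two_mul_mem hp1
  obtain ⟨hs, hc⟩ := sin_cos_pi_div_pos hp1
  have hcτ : 0 < cos τ := cos_pos_of_mem_Ioo ⟨by linarith, by linarith⟩
  have h := sinQuotient_cross_mul ha hb (ha.trans_le h0) h1
    (sinQuotient_monotoneOn hp1.le hp2 ⟨ha, hb⟩ ⟨ha.trans_le h0, h1⟩ h0)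
  rw [sin_mul_pi_div_eq_one (by linarith), one_mul] at h
  set S := sin (π / (2 * p))
  set c := cos (π / (2 * p))
  have e1 : S ^ (p - 1) * c * sin (p * τ)
      = (S / c) ^ (p - 2) * (sin (p * τ) * (S * c ^ (p - 1))) := by
    rw [div_rpow hs.le hc.le, show p - 1 = (p - 2) + 1 by ring, rpow_add_one hs.ne',
      rpow_add_one hc.ne']
    have := (rpow_pos_of_pos hc (p - 2)).ne'
    field_simp
  have e2 : (S * cos τ / c) ^ (p - 2) * (sin τ * cos τ)
      = (S / c) ^ (p - 2) * (sin τ * cos τ ^ (p - 1)) := by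
    rw [show S * cos τ / c = S / c * cos τ by ring, mul_rpow (by positivity) hcτ.le,
      show p - 1 = (p - 2) + 1 by ring, rpow_add_one hcτ.ne']
    ring
  rw [e1, e2]
  gcongr

/-- `tan τ` and `tan α` compare like `τ` and `α`. -/
lemma sin_mul_cos_le_of_le {a b : ℝ} (h : a ≤ b) (h' : b - a ≤ π) :
    sin a * cos b ≤ sin b * cos a := by
  have := sin_nonneg_of_nonneg_of_le_pi (sub_nonneg.2 h) h'
  rw [sin_sub] at this; linarith

lemma smallGap_zero_left_nonneg {τ : ℝ} (hp1 : 1 < p) (hp2 : p < 2) (h0 : 0 ≤ τ)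
    (h1 : τ ≤ π / 2) : 0 ≤ smallGap p 0 τ := by
  obtain ⟨ha, hb⟩ := pi_div_two_mul_mem hp1
  obtain ⟨hs, hc⟩ := sin_cos_pi_div_pos hp1
  have hpi := pi_pos
  set α := π / (2 * p) with hα
  set G : ℝ → ℝ := fun τ => sin α ^ p - sin α ^ (p - 1) * cos α * cos (p * τ) - sin τ ^ p with hG
  have hGd : ∀ τ, HasDerivAt G
      (p * (sin α ^ (p - 1) * cos α * sin (p * τ) - sin τ ^ (p - 1) * cos τ)) τ := by
    intro τ
    have d1 : HasDerivAt (fun τ => cos (p * τ)) (-sin (p * τ) * p) τ := by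
      simpa using ((hasDerivAt_id τ).const_mul p).cos
    refine (((d1.const_mul _).const_sub _).sub
      ((hasDerivAt_sin τ).rpow_const (p := p) (Or.inr hp1.le))).congr_deriv ?_
    ring
  have hGα : G α = 0 := by
    simp [hG, hα, cos_mul_pi_div_eq_zero (by linarith : 0 < p)]
  have hpow : ∀ τ, 0 < τ → τ < π / 2 →
      sin τ ^ (p - 1) * cos τ = sin τ ^ (p - 2) * (sin τ * cos τ) := by
    intro τ a b
    have : 0 < sin τ := sin_pos_of_pos_of_lt_pi a (by linarith)
    rw [show p - 1 = (p - 2) + 1 by ring, rpow_add_one this.ne']; ring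
  have hGτ : 0 ≤ G τ := by
    rw [← hGα]
    rcases le_total τ α with hle | hge
    · have hm : AntitoneOn G (Icc 0 α) := by
        refine antitoneOn_of_hasDerivWithinAt_nonpos (convex_Icc _ _)
          (fun x _ => (hGd x).continuousAt.continuousWithinAt)
          (fun x _ => (hGd x).hasDerivWithinAt) fun x hx => ?_
        rw [interior_Icc] at hx
        refine mul_nonpos_of_nonneg_of_nonpos (by linarith) (sub_nonpos.2 ?_)
        have hx2 : x < π / 2 := hx.2.trans hb
        have hsx : 0 < sin x := sin_pos_of_pos_of_lt_pi hx.1 (by linarith)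
        have hcx : 0 < cos x := cos_pos_of_mem_Ioo ⟨by linarith [hx.1], hx2⟩
        refine (sin_quotient_le_of_le hp1 hp2.le hx.1 hx.2.le).trans ?_
        rw [hpow x hx.1 hx2]
        refine mul_le_mul_of_nonneg_right ?_ (by positivity)
        refine rpow_le_rpow_of_nonpos hsx ?_ (by linarith)
        rw [le_div_iff₀ hc]
        exact sin_mul_cos_le_of_le hx.2.le (by linarith [hx.1])
      exact hm ⟨h0, hle⟩ ⟨ha.le, le_rfl⟩ hle
    · have hm : MonotoneOn G (Icc α (π / 2)) := by
        refine monotoneOn_of_hasDerivWithinAt_nonneg (convex_Icc _ _)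
          (fun x _ => (hGd x).continuousAt.continuousWithinAt)
          (fun x _ => (hGd x).hasDerivWithinAt) fun x hx => ?_
        rw [interior_Icc] at hx
        refine mul_nonneg (by linarith) (sub_nonneg.2 ?_)
        have hx1 : 0 < x := ha.trans hx.1
        have hsx : 0 < sin x := sin_pos_of_pos_of_lt_pi hx1 (by linarith [hx.2])
        have hcx : 0 < cos x := cos_pos_of_mem_Ioo ⟨by linarith, hx.2⟩
        refine le_trans ?_ (le_sin_quotient_of_le hp1 hp2.le hx.1.le hx.2)
        rw [hpow x hx1 hx.2]
        refine mul_le_mul_of_nonneg_right ?_ (by positivity)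
        refine rpow_le_rpow_of_nonpos (by positivity) ?_ (by linarith)
        rw [div_le_iff₀ hc]
        exact sin_mul_cos_le_of_le hx.1.le (by linarith [hx.2])
      exact hm ⟨le_rfl, hb.le⟩ ⟨hge, h1⟩ hge
  have hsτ : 0 ≤ sin τ := sin_nonneg_of_nonneg_of_le_pi h0 (by linarith)
  have e : (sin τ ^ 2) ^ (p / 2) = sin τ ^ p := by
    rw [← rpow_natCast, ← rpow_mul hsτ]; congr 1; push_cast; ring
  simpa [smallGap, e, hG] using hGτ

/-- A minimum of `τ ↦ smallGap p t τ` can only lie where `Z = sinh ² t + sin ² τ` is at least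
`tan ² α cos ² τ`; the stationarity equation and the monotonicity of the sine quotient show this. -/
lemma sq_le_of_isMin_smallGap {t τ : ℝ} (hp1 : 1 < p) (hp2 : p < 2) (ht : 0 < t) (h0 : 0 ≤ τ)
    (h1 : τ ≤ π / 2) (hmin : ∀ τ', 0 ≤ τ' → τ' ≤ π / 2 → smallGap p t τ ≤ smallGap p t τ') :
    (sin (π / (2 * p)) * cos τ / cos (π / (2 * p))) ^ 2 ≤ sinh t ^ 2 + sin τ ^ 2 := by
  obtain ⟨ha, hb⟩ := pi_div_two_mul_mem hp1
  obtain ⟨hs, hc⟩ := sin_cos_pi_div_pos hp1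
  have hpi := pi_pos
  have hsh : 0 < sinh t := sinh_pos_iff.2 ht
  have hZ : ∀ τ, 0 < sinh t ^ 2 + sin τ ^ 2 := fun τ => by positivity
  have hd := fun τ => hasDerivAt_smallGap_right (p := p) (hZ τ)
  set α := π / (2 * p) with hα
  -- a nonnegative derivative bounds `Z` from below
  have key : ∀ x, 0 < x → x ≤ α →
      0 ≤ p * (sin α ^ (p - 1) * cos α * sin (p * x)
        - (sinh t ^ 2 + sin x ^ 2) ^ (p / 2 - 1) * (sin x * cos x)) →
      (sin α * cos x / cos α) ^ 2 ≤ sinh t ^ 2 + sin x ^ 2 := by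
    intro x hx0 hxα hx
    have hsx : 0 < sin x := sin_pos_of_pos_of_lt_pi hx0 (by linarith)
    have hcx : 0 < cos x := cos_pos_of_mem_Ioo ⟨by linarith, by linarith⟩
    have h2 := nonneg_of_mul_nonneg_right hx (by linarith)
    have h3 := sin_quotient_le_of_le hp1 hp2.le hx0 hxα
    have h4 : (sinh t ^ 2 + sin x ^ 2) ^ (p / 2 - 1) ≤ (sin α * cos x / cos α) ^ (p - 2) := by
      refine le_of_mul_le_mul_right ?_ (mul_pos hsx hcx)
      linarith
    have e : (sin α * cos x / cos α) ^ (p - 2) = ((sin α * cos x / cos α) ^ 2) ^ (p / 2 - 1) := by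
      rw [← rpow_natCast, ← rpow_mul (by positivity)]; congr 1; push_cast; ring
    rw [e] at h4
    by_contra! hlt
    exact absurd h4 (not_le.2 (rpow_lt_rpow_of_neg (hZ x) hlt (by linarith)))
  rcases eq_or_lt_of_le h0 with h00 | h00
  · -- at the endpoint `τ = 0` the derivative vanishes, and nearby points are used
    subst h00
    by_contra! hlt
    have hnear : ∀ᶠ x in nhds (0 : ℝ), sinh t ^ 2 + sin x ^ 2 < (sin α * cos x / cos α) ^ 2 := by
      have c1 : Continuous fun x => sinh t ^ 2 + sin x ^ 2 := by fun_prop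
      have c2 : Continuous fun x => (sin α * cos x / cos α) ^ 2 := by fun_prop
      exact (c1.tendsto 0).eventually_lt (c2.tendsto 0) hlt
    obtain ⟨ε, hε, hball⟩ := Metric.eventually_nhds_iff.1 hnear
    set x₁ := min (ε / 2) α
    have hx₁ : 0 < x₁ := lt_min (by linarith) ha
    obtain ⟨x, hx, hslope⟩ := exists_hasDerivAt_eq_slope (fun τ => smallGap p t τ) _ hx₁
      (fun x _ => (hd x).continuousAt.continuousWithinAt) (fun x _ => hd x)
    have hxα : x ≤ α := hx.2.le.trans (min_le_right _ _)
    have := key x hx.1 hxα (by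
      rw [hslope]
      exact div_nonneg (sub_nonneg.2 (hmin x₁ hx₁.le (by linarith [min_le_right (ε / 2) α])))
        (by linarith))
    have hxε : dist x 0 < ε := by
      rw [Real.dist_eq, sub_zero, abs_of_pos hx.1]
      linarith [hx.2, min_le_left (ε / 2) α]
    linarith [hball hxε]
  rcases le_or_gt τ α with hle | hgt
  · refine key τ h00 hle ((hd τ).nonneg_of_forall_le_right (b := π / 2) (by linarith) ?_)
    intro y hy1 hy2
    exact hmin y (by linarith) hy2.le
  · -- beyond `α` the derivative is positive
    exfalso
    have hd0 := (hd τ).nonpos_of_forall_le_left h00 fun y hy1 hy2 => hmin y hy1.le (by linarith)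
    have h2 : sin α ^ (p - 1) * cos α * sin (p * τ) ≤
        (sinh t ^ 2 + sin τ ^ 2) ^ (p / 2 - 1) * (sin τ * cos τ) := by
      by_contra! hcon
      have := mul_pos (by linarith : 0 < p) (sub_pos.2 hcon)
      linarith
    rcases eq_or_lt_of_le h1 with heq | hlt
    · rw [heq, cos_pi_div_two, mul_zero, mul_zero] at h2
      have : 0 < sin (p * (π / 2)) := sin_pos_of_pos_of_lt_pi (by positivity) (by nlinarith)
      have : 0 < sin α ^ (p - 1) * cos α * sin (p * (π / 2)) := by positivity
      linarith
    · have hsτ : 0 < sin τ := sin_pos_of_pos_of_lt_pi h00 (by linarith)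
      have hcτ : 0 < cos τ := cos_pos_of_mem_Ioo ⟨by linarith, hlt⟩
      have h3 := (le_sin_quotient_of_le hp1 hp2.le hgt.le hlt).trans h2
      have h4 := le_of_mul_le_mul_right h3 (mul_pos hsτ hcτ)
      have h5 : sin τ ^ (p - 2) ≤ (sin α * cos τ / cos α) ^ (p - 2) := by
        refine rpow_le_rpow_of_nonpos (by positivity) ?_ (by linarith)
        rw [div_le_iff₀ hc]
        exact sin_mul_cos_le_of_le hgt.le (by linarith)
      have e : sin τ ^ (p - 2) = (sin τ ^ 2) ^ (p / 2 - 1) := by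
        rw [← rpow_natCast, ← rpow_mul hsτ.le]; congr 1; push_cast; ring
      have h6 : (sinh t ^ 2 + sin τ ^ 2) ^ (p / 2 - 1) < (sin τ ^ 2) ^ (p / 2 - 1) :=
        rpow_lt_rpow_of_neg (by positivity) (by nlinarith) (by linarith)
      linarith

/-- At a minimum with `t > 0`, the condition in `τ` gives `Z ≥ sin ² α cosh ² t`, and the condition
in `t` then contradicts `2 sin ² α > 2 ^ (2 - p)`. So the minimum is attained at `t = 0`. -/
lemma smallGap_nonneg {t τ : ℝ} (hp1 : 1 < p) (hp2 : p < 2) (ht : 0 ≤ t) (h0 : 0 ≤ τ)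
    (h1 : τ ≤ π / 2) : 0 ≤ smallGap p t τ := by
  obtain ⟨hs, hc⟩ := sin_cos_pi_div_pos hp1
  have hcont : Continuous fun x : ℝ × ℝ => smallGap p x.1 x.2 := by
    unfold smallGap
    refine Continuous.sub (by fun_prop) (Continuous.rpow_const (by fun_prop) fun _ => ?_)
    exact Or.inr (by linarith)
  obtain ⟨⟨t₀, τ₀⟩, ⟨ht₀, hτ₀⟩, hmin⟩ := (isCompact_Icc.prod isCompact_Icc :
    IsCompact (Icc 0 t ×ˢ Icc 0 (π / 2))).exists_isMinOn ⟨(t, τ), ⟨ht, le_rfl⟩, ⟨h0, h1⟩⟩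
    hcont.continuousOn
  have hmin' : ∀ a b, a ∈ Icc 0 t → b ∈ Icc 0 (π / 2) → smallGap p t₀ τ₀ ≤ smallGap p a b :=
    fun a b ha hb => isMinOn_iff.1 hmin (a, b) ⟨ha, hb⟩
  clear hmin hcont
  change t₀ ∈ Icc 0 t at ht₀
  change τ₀ ∈ Icc 0 (π / 2) at hτ₀
  refine le_trans ?_ (hmin' t τ ⟨ht, le_rfl⟩ ⟨h0, h1⟩)
  rcases eq_or_lt_of_le ht₀.1 with h00 | hpos
  · rw [← h00]; exact smallGap_zero_left_nonneg hp1 hp2 hτ₀.1 hτ₀.2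
  exfalso
  have hZ := sq_le_of_isMin_smallGap hp1 hp2 hpos hτ₀.1 hτ₀.2 fun τ' a b =>
    hmin' t₀ τ' ht₀ ⟨a, b⟩
  have hd := (hasDerivAt_smallGap_left (p := p) τ₀ hpos).nonpos_of_forall_le_left hpos
    fun y hy1 hy2 => hmin' y τ₀ ⟨hy1.le, hy2.le.trans ht₀.2⟩ hτ₀
  have hsh : 0 < sinh t₀ := sinh_pos_iff.2 hpos
  have hch : 0 < cosh t₀ := cosh_pos _
  have h2 := two_rpow_lt_two_mul_sin_sq hp1 hp2
  have hSc := sin_sq_add_cos_sq (π / (2 * p))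
  set S := sin (π / (2 * p))
  set c := cos (π / (2 * p))
  have hZ' : (S * cosh t₀) ^ 2 ≤ sinh t₀ ^ 2 + sin τ₀ ^ 2 := by
    rw [div_pow, div_le_iff₀ (by positivity)] at hZ
    have e1 := cosh_sq t₀
    have e2 := sin_sq_add_cos_sq τ₀
    nlinarith
  have h3 : S ^ p * sinh (p * t₀) ≤
      (sinh t₀ ^ 2 + sin τ₀ ^ 2) ^ (p / 2 - 1) * (sinh t₀ * cosh t₀) := by
    by_contra! hcon
    have := mul_pos (by linarith : 0 < p) (sub_pos.2 hcon)
    linarith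
  have h4 : (sinh t₀ ^ 2 + sin τ₀ ^ 2) ^ (p / 2 - 1) ≤ (S * cosh t₀) ^ (p - 2) := by
    have e : (S * cosh t₀) ^ (p - 2) = ((S * cosh t₀) ^ 2) ^ (p / 2 - 1) := by
      rw [← rpow_natCast, ← rpow_mul (by positivity)]; congr 1; push_cast; ring
    rw [e]
    exact rpow_le_rpow_of_nonpos (by positivity) hZ' (by linarith)
  have h5 := mul_le_mul_of_nonneg_left (sinh_mul_rpow_le_sinh_mul hp1.le hp2.le hpos.le)
    (rpow_nonneg hs.le p)
  have h6 : S ^ p * (sinh t₀ * (2 * cosh t₀) ^ (p - 1)) ≤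
      (S * cosh t₀) ^ (p - 2) * (sinh t₀ * cosh t₀) :=
    h5.trans (h3.trans (mul_le_mul_of_nonneg_right h4 (by positivity)))
  have e1 : S ^ p * (sinh t₀ * (2 * cosh t₀) ^ (p - 1)) =
      S ^ 2 * 2 ^ (p - 1) * ((S * cosh t₀) ^ (p - 2) * (sinh t₀ * cosh t₀)) := by
    rw [mul_rpow two_pos.le hch.le, mul_rpow hs.le hch.le]
    have e2 : S ^ p = S ^ (p - 2) * S ^ 2 := by
      rw [← rpow_natCast, ← rpow_add hs]; norm_num
    have e3 : cosh t₀ ^ (p - 1) = cosh t₀ ^ (p - 2) * cosh t₀ := by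
      rw [← rpow_add_one hch.ne']; ring_nf
    rw [e2, e3]; ring
  rw [e1] at h6
  have h7 : S ^ 2 * 2 ^ (p - 1) ≤ 1 := by
    have hpos : 0 < (S * cosh t₀) ^ (p - 2) * (sinh t₀ * cosh t₀) := by positivity
    exact le_of_mul_le_mul_right (by linarith) hpos
  have h8 : (2 : ℝ) ^ (2 - p) * 2 ^ (p - 1) = 2 := by
    rw [← rpow_add two_pos]; norm_num
  have h9 : (0 : ℝ) < 2 ^ (p - 1) := by positivity
  nlinarith

end SmallExponent

/-! ### The pointwise inequality for `1 < p ≤ 2` -/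

section SmallExponentPointwise
open Real Set

/-- Logarithmic coordinates for a pair of positive numbers: `a = √(a b) e ^ t`,
`b = √(a b) e ^ (-t)`, up to exchanging `a` and `b`. -/
lemma exists_log_coordinate {a b : ℝ} (ha : 0 < a) (hb : 0 < b) :
    ∃ t : ℝ, 0 ≤ t ∧ ∀ q : ℝ, a ^ q + b ^ q = 2 * (a * b) ^ (q / 2) * cosh (q * t) := by
  refine ⟨|(log a - log b) / 2|, abs_nonneg _, fun q => ?_⟩
  have e : cosh (q * |(log a - log b) / 2|) = cosh (q * ((log a - log b) / 2)) := by
    rcases abs_choice ((log a - log b) / 2) with h | h <;> rw [h]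
    rw [mul_neg, cosh_neg]
  rw [e, cosh_eq, rpow_def_of_pos ha, rpow_def_of_pos hb, rpow_def_of_pos (mul_pos ha hb),
    log_mul ha.ne' hb.ne']
  have e1 : exp (log a * q) = exp ((log a + log b) * (q / 2)) *
      exp (q * ((log a - log b) / 2)) := by rw [← exp_add]; ring_nf
  have e2 : exp (log b * q) = exp ((log a + log b) * (q / 2)) *
      exp (-(q * ((log a - log b) / 2))) := by rw [← exp_add]; ring_nf
  rw [e1, e2]; ring

lemma norm_add_conj_sq (z w : ℂ) :
    ‖z + (starRingEnd ℂ) w‖ ^ 2 = ‖z‖ ^ 2 + ‖w‖ ^ 2 + 2 * (z * w).re := by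
  simp only [← Complex.normSq_eq_norm_sq, Complex.normSq_apply, Complex.add_re, Complex.add_im,
    Complex.conj_re, Complex.conj_im, Complex.mul_re]
  ring

lemma re_eq_norm_mul_cos_abs_arg (ζ : ℂ) : ζ.re = ‖ζ‖ * cos |ζ.arg| := by
  rw [cos_abs, Complex.norm_mul_cos_arg]

lemma abs_arg_div_two_mem (ζ : ℂ) : 0 ≤ |ζ.arg| / 2 ∧ |ζ.arg| / 2 ≤ π / 2 :=
  ⟨by positivity, by linarith [Complex.abs_arg_le_pi ζ]⟩

lemma rpow_eq_sq_rpow_half {x : ℝ} (hx : 0 ≤ x) (p : ℝ) : x ^ p = (x ^ 2) ^ (p / 2) := by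
  rw [← rpow_natCast, ← rpow_mul hx]; congr 1; push_cast; ring

variable {p : ℝ}

lemma one_le_two_rpow_mul_sin_rpow (hp1 : 1 < p) (hp2 : p ≤ 2) :
    1 ≤ 2 ^ (p - 1) * sin (π / (2 * p)) ^ p := by
  have hs := (sin_cos_pi_div_pos hp1).1
  have h : (2 : ℝ) ^ (2 - p) ≤ 2 * sin (π / (2 * p)) ^ 2 := by
    rcases eq_or_lt_of_le hp2 with rfl | hlt
    · rw [show π / (2 * 2) = π / 4 by norm_num, sin_pi_div_four, div_pow, sq_sqrt (by norm_num)]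
      norm_num
    · exact (two_rpow_lt_two_mul_sin_sq hp1 hlt).le
  have h2 : (2 : ℝ) ^ (1 - p) ≤ sin (π / (2 * p)) ^ 2 := by
    have : (2 : ℝ) ^ (2 - p) = 2 * 2 ^ (1 - p) := by
      rw [show 2 - p = 1 - p + 1 by ring, rpow_add_one two_ne_zero]; ring
    linarith
  have h3 : (2 : ℝ) ^ ((1 - p) * (p / 2)) ≤ sin (π / (2 * p)) ^ p := by
    rw [rpow_mul two_pos.le, rpow_eq_sq_rpow_half hs.le]
    exact rpow_le_rpow (by positivity) h2 (by linarith)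
  calc (1 : ℝ) ≤ 2 ^ ((p - 1) + (1 - p) * (p / 2)) := by
        refine one_le_rpow (by norm_num) ?_
        nlinarith
    _ = 2 ^ (p - 1) * 2 ^ ((1 - p) * (p / 2)) := rpow_add two_pos _ _
    _ ≤ _ := by gcongr

/-- The pointwise inequality behind the bound for `1 < p ≤ 2`. -/
lemma norm_add_conj_rpow_le_of_le_two (hp1 : 1 < p) (hp2 : p ≤ 2) (z w : ℂ) :
    ‖z + (starRingEnd ℂ) w‖ ^ p ≤
      2 ^ (p - 1) * sin (π / (2 * p)) ^ p * (‖z‖ ^ p + ‖w‖ ^ p)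
        - 2 ^ p * (sin (π / (2 * p)) ^ (p - 1) * cos (π / (2 * p))) *
          rePow (p / 2) (-(z * w)) := by
  have hp0 : 0 < p := by linarith
  rcases eq_or_ne z 0 with rfl | hz
  · have := mul_le_mul_of_nonneg_right (one_le_two_rpow_mul_sin_rpow hp1 hp2)
      (rpow_nonneg (norm_nonneg w) p)
    simpa [rePow_zero (half_pos hp0), zero_rpow hp0.ne'] using this
  rcases eq_or_ne w 0 with rfl | hw
  · have := mul_le_mul_of_nonneg_right (one_le_two_rpow_mul_sin_rpow hp1 hp2)
      (rpow_nonneg (norm_nonneg z) p)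
    simpa [rePow_zero (half_pos hp0), zero_rpow hp0.ne'] using this
  have hsq := norm_add_conj_sq z w
  have hre := re_eq_norm_mul_cos_abs_arg (-(z * w))
  rw [norm_neg, norm_mul, Complex.neg_re] at hre
  rcases eq_or_lt_of_le hp2 with rfl | hlt
  · rw [rePow, norm_neg, norm_mul, show π / (2 * 2) = π / 4 by norm_num, sin_pi_div_four,
      cos_pi_div_four]
    norm_num
    rw [div_pow, sq_sqrt (by norm_num)]
    have h2 : √2 / 2 * (√2 / 2) = 1 / 2 := by
      rw [div_mul_div_comm, mul_self_sqrt (by norm_num)]; norm_num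
    rw [h2]
    rw [cos_abs] at hre
    linarith
  obtain ⟨t, ht, hab⟩ := exists_log_coordinate (norm_pos_iff.2 hz) (norm_pos_iff.2 hw)
  obtain ⟨hτ0, hτ1⟩ := abs_arg_div_two_mem (-(z * w))
  set θ := |(-(z * w)).arg| with hθ
  set a := ‖z‖
  set b := ‖w‖
  have hab0 : 0 < a * b := mul_pos (norm_pos_iff.2 hz) (norm_pos_iff.2 hw)
  have h2 := hab 2
  rw [rpow_two, rpow_two, div_self two_ne_zero, rpow_one] at h2
  have hsq' : ‖z + (starRingEnd ℂ) w‖ ^ 2 = 2 ^ 2 * (a * b) * (sinh t ^ 2 + sin (θ / 2) ^ 2) := by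
    have e1 := cosh_two_mul t
    have e2 := cosh_sq t
    have e3 := cos_two_mul (θ / 2)
    rw [mul_div_cancel₀ _ (two_ne_zero' ℝ)] at e3
    have e4 := sin_sq_add_cos_sq (θ / 2)
    have e5 : sin (θ / 2) ^ 2 = 1 / 2 - cos θ / 2 := by linarith
    rw [hsq, h2, mul_comm 2 t, mul_comm t 2, e1, e2, e5]
    linarith
  have hgap := smallGap_nonneg hp1 hlt ht hτ0 hτ1
  rw [smallGap, show p * (θ / 2) = p / 2 * θ by ring] at hgap
  have hnn : 0 ≤ sinh t ^ 2 + sin (θ / 2) ^ 2 := by positivity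
  rw [rpow_eq_sq_rpow_half (norm_nonneg _), hsq', mul_rpow (by positivity) hnn,
    mul_rpow (by positivity) hab0.le, ← rpow_eq_sq_rpow_half two_pos.le, hab p, rePow, norm_neg,
    norm_mul, ← hθ]
  have e : (2 : ℝ) ^ p = 2 ^ (p - 1) * 2 := by
    rw [← rpow_add_one two_ne_zero]; norm_num
  have hk : 0 ≤ (2 : ℝ) ^ p * (a * b) ^ (p / 2) := by positivity
  have := mul_nonneg hk hgap
  rw [e] at this ⊢
  linarith

end SmallExponentPointwise

/-! ### One-variable estimates for `p ≥ 9` -/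

section LargeExponentConstants
open Real Set

/-- `cos ^ p (π / 2p)`. -/
noncomputable def cosPow (p : ℝ) : ℝ := cos (π / (2 * p)) ^ p

/-- `cos ^ (p - 1) (π / 2p) sin (π / 2p)`. -/
noncomputable def sinWeight (p : ℝ) : ℝ := cos (π / (2 * p)) ^ (p - 1) * sin (π / (2 * p))

variable {p : ℝ}

lemma cosPow_pos (hp : 1 < p) : 0 < cosPow p := rpow_pos_of_pos (sin_cos_pi_div_pos hp).2 p

lemma sinWeight_pos (hp : 1 < p) : 0 < sinWeight p :=
  mul_pos (rpow_pos_of_pos (sin_cos_pi_div_pos hp).2 _) (sin_cos_pi_div_pos hp).1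

lemma inv_mem (hp : 9 ≤ p) : 0 < p⁻¹ ∧ p⁻¹ ≤ 1 / 9 := by
  refine ⟨by positivity, ?_⟩
  rw [one_div]; exact inv_anti₀ (by norm_num) hp

lemma pi_div_two_mul_eq (p : ℝ) : π / (2 * p) = π / 2 * p⁻¹ := by
  rw [← div_eq_mul_inv, div_div]

lemma sinWeight_eq (hp : 1 < p) : sinWeight p = cosPow p * tan (π / (2 * p)) := by
  have hc := (sin_cos_pi_div_pos hp).2
  have e : cos (π / (2 * p)) ^ p = cos (π / (2 * p)) ^ (p - 1) * cos (π / (2 * p)) := by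
    rw [← rpow_add_one hc.ne']; ring_nf
  rw [sinWeight, cosPow, tan_eq_sin_div_cos, e]
  field_simp

lemma neg_le_log_one_sub {u : ℝ} (h0 : 0 < u) (h1 : u ≤ 0.0153) :
    -(u + 0.5 * u ^ 2 + 1.02 * u ^ 3) ≤ log (1 - u) := by
  have := abs_log_sub_add_sum_range_le (x := u) (by rw [abs_of_pos h0]; linarith) 2
  norm_num [Finset.sum_range_succ, abs_of_pos h0] at this
  have h3 : u ^ 3 / (1 - u) ≤ 1.02 * u ^ 3 := by
    rw [div_le_iff₀ (by linarith)]
    nlinarith [pow_pos h0 3]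
  have := neg_le_of_abs_le this
  linarith

lemma cubic_le_exp_neg {v : ℝ} (h0 : 0 < v) (h1 : v ≤ 1) :
    1 - v + v ^ 2 / 2 - 2 / 9 * v ^ 3 ≤ exp (-v) := by
  have := exp_bound (x := -v) (by rw [abs_neg, abs_of_pos h0]; exact h1) (n := 3) (by norm_num)
  norm_num [Finset.sum_range_succ, Nat.factorial, abs_of_pos h0] at this
  have := neg_le_of_abs_le this
  linarith

lemma log_series_bound {h u : ℝ} (hh0 : 0 < h) (hh1 : h ≤ 1 / 9) (hu0 : 0 < u)
    (hu1 : u ≤ 1.23372 * h ^ 2) :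
    u ≤ 0.0153 ∧ u + 0.5 * u ^ 2 + 1.02 * u ^ 3 ≤ 1.23372 * h ^ 2 + 0.79 * h ^ 4 := by
  have hh2 : h ^ 2 ≤ 1 / 81 := by
    have := pow_le_pow_left₀ hh0.le hh1 2
    norm_num at this ⊢; exact this
  have hu2 : u ≤ 0.0153 := by linarith
  have b1 : u ^ 2 ≤ 1.5221 * h ^ 4 := by
    have := pow_le_pow_left₀ hu0.le hu1 2
    have e : (1.23372 * h ^ 2) ^ 2 = 1.23372 ^ 2 * h ^ 4 := by ring
    rw [e] at this
    have : (0 : ℝ) < h ^ 4 := by positivity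
    linarith
  have b2 : u ^ 3 ≤ 0.0153 * u ^ 2 := by
    rw [pow_succ, mul_comm]
    exact mul_le_mul_of_nonneg_right hu2 (sq_nonneg u)
  have : (0 : ℝ) < h ^ 4 := by positivity
  exact ⟨hu2, by linarith⟩

lemma quadratic_le_cubic {h v : ℝ} (hh0 : 0 < h) (hh1 : h ≤ 1 / 9)
    (hv : v = 1.23372 * h + 0.79 * h ^ 3) :
    0 < v ∧ v ≤ 1 ∧ 1 - 1.24 * h + 0.65 * h ^ 2 ≤ 1 - v + v ^ 2 / 2 - 2 / 9 * v ^ 3 := by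
  have h2 : 0 < h ^ 2 := by positivity
  have h3 : 0 < h ^ 3 := by positivity
  have hh2 : h ^ 2 ≤ 1 / 81 := by
    have := pow_le_pow_left₀ hh0.le hh1 2
    norm_num at this ⊢; exact this
  have h32 : h ^ 3 ≤ h / 81 := by
    have := mul_le_mul_of_nonneg_right hh2 hh0.le
    rw [pow_succ]; linarith
  have hv0 : 0 < v := by rw [hv]; positivity
  have hv1 : v ≤ 1.2436 * h := by rw [hv]; linarith
  have hv3 : v ^ 3 ≤ 1.9234 * h ^ 3 := by
    refine (pow_le_pow_left₀ hv0.le hv1 3).trans ?_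
    rw [mul_pow]; linarith
  have hv2 : 1.522 * h ^ 2 ≤ v ^ 2 := by
    refine le_trans ?_ (pow_le_pow_left₀ (by positivity) (by rw [hv]; linarith : 1.23372 * h ≤ v) 2)
    rw [mul_pow]; linarith
  refine ⟨hv0, by linarith, ?_⟩
  have hpoly : 0 ≤ h * (0.00628 + 0.111 * h - 1.218 * h ^ 2) := by
    refine mul_nonneg hh0.le ?_
    nlinarith
  have e : h * (0.00628 + 0.111 * h - 1.218 * h ^ 2) =
    0.00628 * h + 0.111 * h ^ 2 - 1.218 * h ^ 3 := by ring
  rw [e] at hpoly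
  linarith

lemma le_cosPow (hp : 9 ≤ p) : 1 - 1.24 * p⁻¹ + 0.65 * p⁻¹ ^ 2 ≤ cosPow p := by
  obtain ⟨hh0, hh1⟩ := inv_mem hp
  have hc := (sin_cos_pi_div_pos (by linarith : 1 < p)).2
  have hph : p * p⁻¹ = 1 := mul_inv_cancel₀ (by linarith)
  have hcos : 1 - (π / (2 * p)) ^ 2 / 2 ≤ cos (π / (2 * p)) := one_sub_sq_div_two_le_cos
  have hu0 : 0 < (π / (2 * p)) ^ 2 / 2 := by
    have := (pi_div_two_mul_mem (by linarith : 1 < p)).1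
    positivity
  have hu1 : (π / (2 * p)) ^ 2 / 2 ≤ 1.23372 * p⁻¹ ^ 2 := by
    rw [pi_div_two_mul_eq, mul_pow, div_pow]
    have : π ^ 2 ≤ 9.8697 := by nlinarith [pi_lt_d4, pi_gt_three]
    nlinarith [sq_nonneg p⁻¹]
  obtain ⟨hu2, hus⟩ := log_series_bound hh0 hh1 hu0 hu1
  obtain ⟨hv0, hv1, hv2⟩ := quadratic_le_cubic hh0 hh1 rfl
  refine hv2.trans ((cubic_le_exp_neg hv0 hv1).trans ?_)
  rw [cosPow, rpow_def_of_pos hc]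
  refine exp_le_exp.2 ?_
  have a1 : log (1 - (π / (2 * p)) ^ 2 / 2) ≤ log (cos (π / (2 * p))) :=
    log_le_log (by linarith) hcos
  have a2 := mul_le_mul_of_nonneg_left ((neg_le_log_one_sub hu0 hu2).trans a1)
    (by linarith : (0 : ℝ) ≤ p)
  have a3 := mul_le_mul_of_nonneg_left hus (by linarith : (0 : ℝ) ≤ p)
  have a4 : p * (1.23372 * p⁻¹ ^ 2 + 0.79 * p⁻¹ ^ 4) = 1.23372 * p⁻¹ + 0.79 * p⁻¹ ^ 3 := by
    linear_combination (1.23372 * p⁻¹ + 0.79 * p⁻¹ ^ 3) * hph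
  linarith

lemma cosPow_ge (hp : 9 ≤ p) : 0.868 ≤ cosPow p := by
  obtain ⟨hh0, hh1⟩ := inv_mem hp
  have := le_cosPow hp
  nlinarith

lemma tan_le (hp : 9 ≤ p) : p * tan (π / (2 * p)) ≤ 1.59 := by
  obtain ⟨hh0, hh1⟩ := inv_mem hp
  have hph : p * p⁻¹ = 1 := mul_inv_cancel₀ (by linarith)
  have hc := (sin_cos_pi_div_pos (by linarith : 1 < p)).2
  rw [tan_eq_sin_div_cos, ← mul_div_assoc, div_le_iff₀ hc]
  have hcos : 1 - (π / (2 * p)) ^ 2 / 2 ≤ cos (π / (2 * p)) := one_sub_sq_div_two_le_cos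
  rw [pi_div_two_mul_eq] at *
  set α := π / 2 * p⁻¹ with hα
  have hπ := pi_lt_d4
  have hα0 : 0 < α := by have := pi_pos; positivity
  have hα1 : α ≤ 0.1746 := by rw [hα]; nlinarith
  have hpα : p * α = π / 2 := by rw [hα]; linear_combination π / 2 * hph
  have hs : sin α ≤ α * (1 - 0.16 * α ^ 2) := by
    have := sin_bound (x := α) (by rw [abs_of_pos hα0]; linarith)
    rw [abs_of_pos hα0] at this
    have := le_of_abs_le this
    have h5 : α ^ 5 ≤ 0.04 * α ^ 3 := by
      have : α ^ 2 ≤ 0.04 := by nlinarith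
      nlinarith [pow_pos hα0 3]
    nlinarith [pow_pos hα0 3]
  have h2 : p * sin α ≤ π / 2 * (1 - 0.16 * α ^ 2) := by
    have := mul_le_mul_of_nonneg_left hs (by linarith : 0 ≤ p)
    rw [← mul_assoc, hpα] at this
    exact this
  have h3 : α ^ 2 ≤ 0.0305 := by nlinarith
  nlinarith [sq_nonneg α]

lemma sinWeight_le (hp : 9 ≤ p) : p * sinWeight p ≤ 1.59 * cosPow p := by
  rw [sinWeight_eq (by linarith)]
  nlinarith [tan_le hp, cosPow_pos (by linarith : 1 < p)]

lemma le_sinWeight (hp : 9 ≤ p) : 1.5707 * p⁻¹ * cosPow p ≤ sinWeight p := by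
  have hp1 : 1 < p := by linarith
  rw [sinWeight_eq hp1, mul_comm]
  have h1 := le_tan (pi_div_two_mul_mem hp1).1.le (pi_div_two_mul_mem hp1).2
  rw [pi_div_two_mul_eq] at h1
  refine mul_le_mul_of_nonneg_left (le_trans ?_ (h1.trans_eq (by rw [pi_div_two_mul_eq])))
    (cosPow_pos hp1).le
  exact mul_le_mul_of_nonneg_right (by linarith [pi_gt_d4]) (inv_mem hp).1.le

/-- The slope condition that makes the gap monotone, for angles `k ∈ [1, π/2]`. -/
lemma slope_le_cosPow {k : ℝ} (hp : 9 ≤ p) (hk1 : 1 ≤ k) (hk2 : k ≤ π / 2) :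
    p * sinWeight p * cos k + k ^ 2 * p⁻¹ ≤ cosPow p := by
  obtain ⟨hh0, hh1⟩ := inv_mem hp
  have hN := cosPow_ge hp
  have hph : p * p⁻¹ = 1 := mul_inv_cancel₀ (by linarith)
  set W := p * sinWeight p with hW
  have hW1 : W ≤ 1.59 * cosPow p := sinWeight_le hp
  have hW2 : 1.36 ≤ W := by
    have := mul_le_mul_of_nonneg_left (le_sinWeight hp) (by linarith : 0 ≤ p)
    have e : p * (1.5707 * p⁻¹ * cosPow p) = 1.5707 * cosPow p := by
      linear_combination 1.5707 * cosPow p * hph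
    rw [e] at this
    linarith
  have hm : AntitoneOn (fun k => W * cos k + k ^ 2 * p⁻¹) (Icc 1 (π / 2)) := by
    refine antitoneOn_of_hasDerivWithinAt_nonpos (f' := fun k => W * (-sin k) + 2 * k * p⁻¹)
      (convex_Icc _ _) (by fun_prop) (fun x _ => ?_) fun x hx => ?_
    · refine ((((hasDerivAt_cos x).const_mul W).add
        ((hasDerivAt_pow 2 x).mul_const p⁻¹)).congr_deriv ?_).hasDerivWithinAt
      norm_num
    · rw [interior_Icc] at hx
      have h1 := mul_le_sin (by linarith [hx.1]) hx.2.le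
      have hx0 : 0 < x := by linarith [hx.1]
      have h2 : 0.6 * x ≤ sin x := by
        refine le_trans (mul_le_mul_of_nonneg_right ?_ hx0.le) h1
        rw [le_div_iff₀ pi_pos]; linarith [pi_lt_d2]
      have h3 : 0.6 * x ≤ W * sin x := by nlinarith
      nlinarith
  have hk := hm ⟨le_rfl, by linarith⟩ ⟨hk1, hk2⟩ hk1
  simp only [one_pow, one_mul] at hk
  have hcos1 : cos 1 ≤ 0.5408 := by
    have h1 := cos_two_mul (1 / 2 : ℝ)
    have h2 := sin_sq_add_cos_sq (1 / 2 : ℝ)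
    have h3 := sin_gt_sub_cube (x := (1 / 2 : ℝ)) (by norm_num)
    norm_num at h1 h3
    nlinarith
  have hcos0 : 0 ≤ cos 1 := (cos_pos_of_le_one (by norm_num)).le
  have h4 : W * cos 1 ≤ 1.59 * cosPow p * 0.5408 :=
    mul_le_mul hW1 hcos1 hcos0 (by linarith)
  nlinarith

lemma le_cos_of_le_one (k : ℝ) (hk : |k| ≤ 1) : 0.99 - 0.47 * k ^ 2 ≤ cos k := by
  have h1 := cos_two_mul (k / 2)
  rw [mul_div_cancel₀ _ (two_ne_zero' ℝ)] at h1
  have h2 : 1 - (k / 2) ^ 2 / 2 ≤ cos (k / 2) := one_sub_sq_div_two_le_cos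
  have h3 : k ^ 2 ≤ 1 := (sq_le_one_iff_abs_le_one k).2 hk
  nlinarith [sq_nonneg (k ^ 2 - 0.48), sq_nonneg (cos (k / 2) - (1 - (k / 2) ^ 2 / 2))]

lemma rpow_le_at_tangent_point (hp : 9 ≤ p) : (1 - p⁻¹ / 2) ^ p ≤ 0.6066 := by
  obtain ⟨hh0, hh1⟩ := inv_mem hp
  have h1 : 1 - p⁻¹ / 2 ≤ exp (-(p⁻¹ / 2)) := by
    have := add_one_le_exp (-(p⁻¹ / 2)); linarith
  have h2 := rpow_le_rpow (by linarith) h1 (by linarith : 0 ≤ p)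
  have hph : p * p⁻¹ = 1 := mul_inv_cancel₀ (by linarith)
  rw [← exp_mul, show -(p⁻¹ / 2) * p = -(1 / 2) by linear_combination (-1 / 2) * hph] at h2
  have h3 : exp (1 / 2) ^ 2 = exp 1 := by rw [← exp_nat_mul]; norm_num
  have h4 := exp_one_gt_d9
  have h5 : 1.6486 ≤ exp (1 / 2) := by
    by_contra! hc; have := exp_pos (1 / 2 : ℝ); nlinarith
  rw [exp_neg] at h2
  refine h2.trans ?_
  rw [inv_le_comm₀ (exp_pos _) (by norm_num)]
  exact le_trans (by norm_num) h5

lemma le_rpow_sub_one_at_tangent_point (hp : 9 ≤ p) : 0.6064 ≤ (1 - p⁻¹ / 2) ^ (p - 1) := by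
  obtain ⟨hh0, hh1⟩ := inv_mem hp
  have hph : p * p⁻¹ = 1 := mul_inv_cancel₀ (by linarith)
  have hy0 : 0 < 1 - p⁻¹ / 2 := by linarith
  have h1 : -(1 / 2) ≤ log (1 - p⁻¹ / 2) * (p - 1) := by
    refine le_trans ?_ (mul_le_mul_of_nonneg_right (one_sub_inv_le_log_of_pos hy0)
      (by linarith : 0 ≤ p - 1))
    have a3 : 1 - (1 - p⁻¹ / 2)⁻¹ = -(p⁻¹ / 2) / (1 - p⁻¹ / 2) := by
      rw [eq_div_iff hy0.ne', sub_mul, inv_mul_cancel₀ hy0.ne']; ring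
    rw [a3, div_mul_eq_mul_div, le_div_iff₀ hy0]
    linarith
  rw [rpow_def_of_pos hy0]
  refine le_trans ?_ (exp_le_exp.2 h1)
  have h3 : exp (1 / 2) ^ 2 = exp 1 := by rw [← exp_nat_mul]; norm_num
  have h4 := exp_one_lt_d9
  have h5 : exp (1 / 2) ≤ 1.6488 := by
    by_contra! hc; nlinarith
  rw [exp_neg, le_inv_comm₀ (by norm_num) (exp_pos _)]
  refine h5.trans (by norm_num)

lemma rpow_tangent_le {x y : ℝ} (hp : 1 ≤ p) (hx : 0 ≤ x) (hy : 0 < y) :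
    y ^ (p - 1) * y + p * y ^ (p - 1) * (x - y) ≤ x ^ p := by
  have h1 := one_add_mul_self_le_rpow_one_add (s := x / y - 1) (p := p)
    (by have : 0 ≤ x / y := by positivity
        linarith) hp
  rw [add_sub_cancel, div_rpow hx hy.le, le_div_iff₀ (by positivity)] at h1
  refine le_trans (le_of_eq ?_) h1
  have : y ^ p = y ^ (p - 1) * y := by rw [← rpow_add_one hy.ne']; ring_nf
  rw [this]; field_simp

lemma gap_at_zero_left {N h : ℝ} (hh0 : 0 < h) (hh1 : h ≤ 1 / 9)
    (hN : 1 - 1.24 * h + 0.65 * h ^ 2 ≤ N) :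
    1 ≤ N * (2 - 0.99 * 1.59 * 0.6066 * (1 - h)) := by
  refine le_trans ?_ (mul_le_mul_of_nonneg_right hN (by linarith))
  nlinarith [pow_pos hh0 3]

lemma gap_at_zero_right {N h : ℝ} (hh0 : 0 < h) (hh1 : h ≤ 1 / 9)
    (hN : 1 - 1.24 * h + 0.65 * h ^ 2 ≤ N) :
    1 ≤ N * (1 + 0.99 * 1.5707 * 0.6064 * h * (1.5 - h / 2)) := by
  have h1 : 1 + 0.94294 * h * (1.5 - h / 2) ≤
      1 + 0.99 * 1.5707 * 0.6064 * h * (1.5 - h / 2) := by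
    have : 0 ≤ h * (1.5 - h / 2) := mul_nonneg hh0.le (by linarith)
    linarith
  have h2 : 0 ≤ h * (1.5 - h / 2) := mul_nonneg hh0.le (by linarith)
  refine le_trans ?_ (mul_le_mul hN h1 (by linarith) (by linarith [sq_nonneg h]))
  have h3 : 0 ≤ 0.17441 - 1.57534 * h + 1.504 * h ^ 2 - 0.30646 * h ^ 3 := by
    have : h ^ 3 ≤ h ^ 2 / 9 := by
      rw [pow_succ]; nlinarith [sq_nonneg h]
    nlinarith
  nlinarith [mul_nonneg hh0.le h3]

/-- The case of angle `0`: the convex function `x ^ p` is replaced by its tangent at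
`1 - 1 / (2 p)`. -/
lemma gap_at_zero_nonneg {x : ℝ} (hp : 9 ≤ p) (hx0 : 0 ≤ x) (hx1 : x ≤ 1) :
    0 ≤ 2 * cosPow p - 1 - cosPow p * x + 0.99 * sinWeight p * x ^ p := by
  obtain ⟨hh0, hh1⟩ := inv_mem hp
  have hph : p * p⁻¹ = 1 := mul_inv_cancel₀ (by linarith)
  have hy0 : 0 < 1 - p⁻¹ / 2 := by linarith
  have e : (1 - p⁻¹ / 2) ^ p = (1 - p⁻¹ / 2) ^ (p - 1) * (1 - p⁻¹ / 2) := by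
    rw [← rpow_add_one hy0.ne']; ring_nf
  have hyp := rpow_le_at_tangent_point hp
  have hyp1 := le_rpow_sub_one_at_tangent_point hp
  have htan := rpow_tangent_le (by linarith : 1 ≤ p) hx0 hy0
  have hl := gap_at_zero_left hh0 hh1 (le_cosPow hp)
  have hr := gap_at_zero_right hh0 hh1 (le_cosPow hp)
  have hN := cosPow_ge hp
  have hκ1 := sinWeight_le hp
  have hκ2 := le_sinWeight hp
  have hκ0 := sinWeight_pos (by linarith : 1 < p)
  rw [e] at hyp
  generalize cosPow p = N at *
  generalize sinWeight p = κ at *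
  generalize (1 - p⁻¹ / 2) ^ (p - 1) = Y at *
  generalize x ^ p = X at *
  clear e
  -- the values of the tangent at the endpoints
  have v0 : 0 ≤ 2 * N - 1 + 0.99 * κ * (Y * (1 - p⁻¹ / 2) + p * Y * (0 - (1 - p⁻¹ / 2))) := by
    have h2 : κ * (p - 1) ≤ 1.59 * N * (1 - p⁻¹) := by
      have : κ * (p - 1) = p * κ * (1 - p⁻¹) := by linear_combination κ * hph
      rw [this]; exact mul_le_mul_of_nonneg_right hκ1 (by linarith)
    have h3 : κ * (p - 1) * (Y * (1 - p⁻¹ / 2)) ≤ 1.59 * N * (1 - p⁻¹) * 0.6066 :=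
      mul_le_mul h2 hyp (mul_nonneg (by linarith) hy0.le)
        (mul_nonneg (by linarith) (by linarith))
    linarith
  have v1 : 0 ≤ N - 1 + 0.99 * κ * (Y * (1 - p⁻¹ / 2) + p * Y * (1 - (1 - p⁻¹ / 2))) := by
    have h1 : Y * (1 - p⁻¹ / 2) + p * Y * (1 - (1 - p⁻¹ / 2)) = Y * (1.5 - p⁻¹ / 2) := by
      linear_combination Y / 2 * hph
    have h2 : 1.5707 * p⁻¹ * N * (0.6064 * (1.5 - p⁻¹ / 2)) ≤ κ * (Y * (1.5 - p⁻¹ / 2)) :=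
      mul_le_mul hκ2 (mul_le_mul_of_nonneg_right hyp1 (by linarith))
        (mul_nonneg (by norm_num) (by linarith)) hκ0.le
    rw [h1]
    linarith
  have hlin := mul_le_mul_of_nonneg_left htan (by linarith : 0 ≤ 0.99 * κ)
  have e0 := mul_nonneg (sub_nonneg.2 hx1) v0
  have e1 := mul_nonneg hx0 v1
  linarith

/-- The case of angle `1`: the tangents at `x = 1` give a lower bound that decreases in `x`. -/
lemma gap_at_one_nonneg {x : ℝ} (hp : 9 ≤ p) (hx0 : 0 ≤ x) (hx1 : x ≤ 1) :
    0 ≤ 2 * cosPow p - 1 - cosPow p * x + 0.52 * sinWeight p * x ^ p +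
      x ^ 2 * (p⁻¹ / 2 * (1 - p⁻¹ / 2)) := by
  obtain ⟨hh0, hh1⟩ := inv_mem hp
  have hN1 := le_cosPow hp
  have hN := cosPow_ge hp
  have hκ1 := sinWeight_le hp
  have hκ2 := le_sinWeight hp
  have hκ0 := sinWeight_pos (by linarith : 1 < p)
  set N := cosPow p
  set κ := sinWeight p
  set h := p⁻¹
  set d := h / 2 * (1 - h / 2) with hd
  have hd0 : 0 ≤ d := by rw [hd]; nlinarith
  have hd1 : d ≤ 1 / 18 := by rw [hd]; nlinarith
  have htan : 1 + p * (x - 1) ≤ x ^ p := by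
    have := one_add_mul_self_le_rpow_one_add (s := x - 1) (p := p) (by linarith) (by linarith)
    simpa using this
  have hmain := mul_le_mul_of_nonneg_left htan (by linarith : 0 ≤ 0.52 * κ)
  have hsq : 1 + 2 * (x - 1) ≤ x ^ 2 := by nlinarith [sq_nonneg (x - 1)]
  have hmain2 := mul_le_mul_of_nonneg_right hsq hd0
  have v1 : 0 ≤ N - 1 + 0.52 * κ + d := by
    have : (1 - 1.24 * h + 0.65 * h ^ 2) * (1 + 0.52 * 1.5707 * h) ≤
        N * (1 + 0.52 * 1.5707 * h) := mul_le_mul_of_nonneg_right hN1 (by linarith)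
    have h2 : 0 ≤ h * (0.0767 - 0.613 * h + 0.5 * h ^ 2) := by
      refine mul_nonneg hh0.le ?_
      nlinarith
    rw [hd]
    nlinarith [pow_pos hh0 3]
  have hslope : 0.52 * (p * κ) + 2 * d ≤ N := by linarith
  nlinarith [mul_nonneg (sub_nonneg.2 hx1) (sub_nonneg.2 hslope)]

end LargeExponentConstants

/-! ### The inequality in polar coordinates for `p ≥ 9` -/

section LargeExponentGap
open Real Set

variable {p : ℝ}

lemma sinh_le_mul_cosh {t : ℝ} (ht : 0 ≤ t) : sinh t ≤ t * cosh t := by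
  have hm : MonotoneOn (fun t => t * cosh t - sinh t) (Ici 0) := by
    refine monotoneOn_of_hasDerivWithinAt_nonneg (f' := fun t => t * sinh t) (convex_Ici _)
      (by fun_prop) (fun x _ => ?_) fun x hx => ?_
    · refine ((((hasDerivAt_id x).mul (hasDerivAt_cosh x)).sub
        (hasDerivAt_sinh x)).congr_deriv ?_).hasDerivWithinAt
      simp
    · rw [interior_Ici] at hx
      exact mul_nonneg hx.le (sinh_nonneg_iff.2 hx.le)
  have := hm self_mem_Ici ht ht
  simp at this
  linarith

lemma two_mul_cosh_sub_one_le {t : ℝ} (ht : 0 ≤ t) : 2 * (cosh t - 1) ≤ t * sinh t := by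
  have h1 := cosh_two_mul (t / 2)
  have h2 := sinh_two_mul (t / 2)
  have h3 := cosh_sq (t / 2)
  rw [mul_div_cancel₀ _ (two_ne_zero' ℝ)] at h1 h2
  have h4 := sinh_le_mul_cosh (by linarith : 0 ≤ t / 2)
  have h5 : 0 ≤ sinh (t / 2) := sinh_nonneg_iff.2 (by linarith)
  rw [h1, h2, h3]
  nlinarith [mul_le_mul_of_nonneg_left h4 h5]

lemma sinh_mul_cosh_le {t : ℝ} (ht : 0 ≤ t) (h2 : cosh t ≤ 2) :
    sinh t * cosh t ≤ t * (2 * cosh t - 1) := by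
  have hm : MonotoneOn (fun t => t * (2 * cosh t - 1) - sinh t * cosh t) (Icc 0 t) := by
    refine monotoneOn_of_hasDerivWithinAt_nonneg
      (f' := fun t => 2 * (t * sinh t - cosh t * (cosh t - 1))) (convex_Icc _ _)
      (by fun_prop) (fun x _ => ?_) fun x hx => ?_
    · refine ((((hasDerivAt_id x).mul (((hasDerivAt_cosh x).const_mul 2).sub_const 1)).sub
        ((hasDerivAt_sinh x).mul (hasDerivAt_cosh x))).congr_deriv ?_).hasDerivWithinAt
      simp only [id_eq]
      linear_combination cosh_sq x
    · rw [interior_Icc] at hx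
      have h3 := two_mul_cosh_sub_one_le hx.1.le
      have h4 : cosh x ≤ 2 := le_trans (cosh_le_cosh.2 (by
        rw [abs_of_pos hx.1, abs_of_nonneg ht]; exact hx.2.le)) h2
      have h5 := one_le_cosh x
      nlinarith
  have := hm ⟨le_rfl, ht⟩ ⟨ht, le_rfl⟩ ht
  simp at this
  linarith

lemma hasDerivAt_mul_tanh (t : ℝ) :
    HasDerivAt (fun t => t * (sinh t / cosh t)) (sinh t / cosh t + t / cosh t ^ 2) t := by
  have hc := (cosh_pos t).ne'
  refine ((hasDerivAt_id t).mul ((hasDerivAt_sinh t).div (hasDerivAt_cosh t) hc)).congr_deriv ?_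
  have := cosh_sq t
  simp only [id_eq, Pi.div_apply]
  field_simp
  linear_combination t * this

lemma two_mul_cosh_sub_one_le_exp {t : ℝ} (ht : 0 ≤ t) (h2 : cosh t ≤ 2) :
    2 * cosh t - 1 ≤ exp (t * (sinh t / cosh t)) := by
  have hpos : ∀ x, 0 < 2 * cosh x - 1 := fun x => by linarith [one_le_cosh x]
  have hd : ∀ x, HasDerivAt (fun t => t * (sinh t / cosh t) - log (2 * cosh t - 1))
      (sinh x / cosh x + x / cosh x ^ 2 - 2 * sinh x / (2 * cosh x - 1)) x := fun x =>
    (hasDerivAt_mul_tanh x).sub ((((hasDerivAt_cosh x).const_mul 2).sub_const 1).log (hpos x).ne')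
  have hm : MonotoneOn (fun t => t * (sinh t / cosh t) - log (2 * cosh t - 1)) (Icc 0 t) := by
    refine monotoneOn_of_hasDerivWithinAt_nonneg (convex_Icc _ _)
      (fun x _ => (hd x).continuousAt.continuousWithinAt)
      (fun x _ => (hd x).hasDerivWithinAt) fun x hx => ?_
    rw [interior_Icc] at hx
    have h4 : cosh x ≤ 2 := le_trans (cosh_le_cosh.2 (by
      rw [abs_of_pos hx.1, abs_of_nonneg ht]; exact hx.2.le)) h2
    have h3 := sinh_mul_cosh_le hx.1.le h4
    have hc := cosh_pos x
    have hq := hpos x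
    have e : sinh x / cosh x + x / cosh x ^ 2 - 2 * sinh x / (2 * cosh x - 1) =
        (x * (2 * cosh x - 1) - sinh x * cosh x) / (cosh x ^ 2 * (2 * cosh x - 1)) := by
      have hc' := hc.ne'
      have hq' := hq.ne'
      rw [div_add_div _ _ hc' (pow_ne_zero 2 hc'),
        div_sub_div _ _ (mul_ne_zero hc' (pow_ne_zero 2 hc')) hq',
        div_eq_div_iff (mul_ne_zero (mul_ne_zero hc' (pow_ne_zero 2 hc')) hq')
          (mul_ne_zero (pow_ne_zero 2 hc') hq')]
      ring
    rw [e]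
    exact div_nonneg (by linarith) (by positivity)
  have := hm ⟨le_rfl, ht⟩ ⟨ht, le_rfl⟩ ht
  norm_num at this
  exact (log_le_iff_le_exp (hpos t)).1 this

lemma mul_cosh_le_exp {t : ℝ} (ht : 0 ≤ t) (h2 : 2 ≤ cosh t) :
    1.5 * cosh t ≤ exp (t * (sinh t / cosh t)) := by
  have hd : ∀ x, HasDerivAt (fun t => t * (sinh t / cosh t) - log (cosh t))
      (x / cosh x ^ 2) x := fun x => by
    refine ((hasDerivAt_mul_tanh x).sub ((hasDerivAt_cosh x).log (cosh_pos x).ne')).congr_deriv ?_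
    ring
  have hm : MonotoneOn (fun t => t * (sinh t / cosh t) - log (cosh t)) (Ici 0) := by
    refine monotoneOn_of_hasDerivWithinAt_nonneg (convex_Ici _)
      (fun x _ => (hd x).continuousAt.continuousWithinAt)
      (fun x _ => (hd x).hasDerivWithinAt) fun x hx => ?_
    rw [interior_Ici] at hx
    have : 0 < x := hx
    positivity
  have ha : cosh (arcosh 2) = 2 := cosh_arcosh (by norm_num)
  have ha0 : 0 ≤ arcosh 2 := arcosh_nonneg (by norm_num)
  have hat : arcosh 2 ≤ t := by
    have : cosh (arcosh 2) ≤ cosh t := by rw [ha]; exact h2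
    rwa [cosh_le_cosh, abs_of_nonneg ha0, abs_of_nonneg ht] at this
  have h3 := two_mul_cosh_sub_one_le_exp ha0 ha.le
  have h4 := hm ha0 ht hat
  simp only [ha] at h3 h4
  have h5 : log 3 ≤ arcosh 2 * (sinh (arcosh 2) / 2) := by
    rw [log_le_iff_le_exp (by norm_num)]; norm_num at h3 ⊢; exact h3
  rw [← log_le_iff_le_exp (by positivity), log_mul (by norm_num) (cosh_pos t).ne',
    show (1.5 : ℝ) = 3 / 2 by norm_num, log_div (by norm_num) (by norm_num)]
  linarith

lemma cosh_mul_exp_le_cosh_add (t s : ℝ) :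
    cosh t * exp (s * (sinh t / cosh t)) ≤ cosh (t + s) := by
  have hc := cosh_pos t
  set T := sinh t / cosh t with hT
  have hT1 : |T| ≤ 1 := by
    rw [hT, abs_div, abs_of_pos hc, div_le_one hc]
    exact abs_le_of_sq_le_sq (by linarith [cosh_sq t]) hc.le
  obtain ⟨hl, hr⟩ := abs_le.1 hT1
  have h1 := convexOn_exp.2 (mem_univ s) (mem_univ (-s)) (by linarith : 0 ≤ (1 + T) / 2)
    (by linarith : 0 ≤ (1 - T) / 2) (by ring)
  simp only [smul_eq_mul] at h1
  rw [show (1 + T) / 2 * s + (1 - T) / 2 * -s = s * T by ring] at h1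
  have h2 : cosh (t + s) = cosh t * (cosh s + T * sinh s) := by
    rw [cosh_add, hT]; field_simp
  rw [h2]
  refine mul_le_mul_of_nonneg_left (h1.trans_eq ?_) hc.le
  rw [cosh_eq, sinh_eq]; ring

lemma cosh_rpow_mul_exp_le {t : ℝ} (hp : 1 < p) :
    cosh t ^ (p - 1) * exp (t * (sinh t / cosh t)) ≤ cosh (p / (p - 1) * t) ^ (p - 1) := by
  have hp' : 0 < p - 1 := by linarith
  have h := cosh_mul_exp_le_cosh_add t (t / (p - 1))
  rw [show t + t / (p - 1) = p / (p - 1) * t by field_simp; ring] at h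
  have h2 := rpow_le_rpow (by have := cosh_pos t; positivity) h hp'.le
  rw [mul_rpow (cosh_pos t).le (exp_pos _).le, ← exp_mul] at h2
  convert h2 using 3
  field_simp

/-- The gap at equal moduli, where it has its zero at `τ = π / 2p`. -/
lemma cos_rpow_le {τ : ℝ} (hp : 2 < p) (h0 : 0 ≤ τ) (h1 : τ ≤ π / p) :
    cos τ ^ p ≤ cosPow p + sinWeight p * cos (p * τ) := by
  have hp1 : 1 < p := by linarith
  obtain ⟨hα0, hα1⟩ := pi_div_two_mul_mem hp1
  have hαp : π / (2 * p) ≤ π / p := by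
    rw [div_le_div_iff_of_pos_left pi_pos (by linarith) (by linarith)]; linarith
  have hlt : π / p < π / 2 := div_lt_div_of_pos_left pi_pos two_pos hp
  have hd : ∀ x, HasDerivAt (fun τ => sinWeight p * cos (p * τ) - cos τ ^ p)
      (p * (cos x ^ (p - 1) * sin x - sinWeight p * sin (p * x))) x := fun x => by
    have d1 := (((hasDerivAt_id x).const_mul p).cos).const_mul (sinWeight p)
    have d2 := (hasDerivAt_cos x).rpow_const (p := p) (Or.inr hp1.le)
    refine (d1.sub d2).congr_deriv ?_
    simp only [id_eq]
    ring
  have hval : 0 - cosPow p =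
      sinWeight p * cos (p * (π / (2 * p))) - cos (π / (2 * p)) ^ p := by
    rw [cos_mul_pi_div_eq_zero (by linarith), cosPow]; ring
  rcases le_total τ (π / (2 * p)) with h | h
  · have hm : AntitoneOn (fun τ => sinWeight p * cos (p * τ) - cos τ ^ p)
        (Icc 0 (π / (2 * p))) := by
      refine antitoneOn_of_hasDerivWithinAt_nonpos (convex_Icc _ _)
        (fun x _ => (hd x).continuousAt.continuousWithinAt)
        (fun x _ => (hd x).hasDerivWithinAt) fun x hx => ?_
      rw [interior_Icc] at hx
      have hx2 : x < π / 2 := by linarith [hx.2]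
      have := sinQuotient_cross_mul (p := p) hα0 hα1 hx.1 hx2
        (sinQuotient_antitoneOn hp ⟨hx.1, by linarith [hx.2]⟩ ⟨hα0, hαp⟩ hx.2.le)
      rw [sin_mul_pi_div_eq_one (by linarith)] at this
      refine mul_nonpos_of_nonneg_of_nonpos (by linarith) ?_
      rw [sinWeight]; linarith
    have := hm ⟨h0, h⟩ ⟨hα0.le, le_rfl⟩ h
    simp only [← hval] at this
    linarith
  · have hm : MonotoneOn (fun τ => sinWeight p * cos (p * τ) - cos τ ^ p)
        (Icc (π / (2 * p)) (π / p)) := by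
      refine monotoneOn_of_hasDerivWithinAt_nonneg (convex_Icc _ _)
        (fun x _ => (hd x).continuousAt.continuousWithinAt)
        (fun x _ => (hd x).hasDerivWithinAt) fun x hx => ?_
      rw [interior_Icc] at hx
      have hx0 : 0 < x := by linarith [hx.1]
      have hx2 : x < π / 2 := by linarith [hx.2]
      have := sinQuotient_cross_mul (p := p) hx0 hx2 hα0 hα1
        (sinQuotient_antitoneOn hp ⟨hα0, hαp⟩ ⟨hx0, hx.2.le⟩ hx.1.le)
      rw [sin_mul_pi_div_eq_one (by linarith)] at this
      refine mul_nonneg (by linarith) ?_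
      rw [sinWeight]; linarith
    have := hm ⟨le_rfl, hαp⟩ ⟨h, h1⟩ h
    simp only [← hval] at this
    linarith

lemma one_sub_mul_rpow_le_inv {q m : ℝ} (hq0 : 0 ≤ q) (hq1 : q ≤ 1) (hm : 1 ≤ m) :
    (1 - q) ^ m ≤ (1 + m * q)⁻¹ := by
  have h1 : 1 + m * q ≤ (1 + q) ^ m := one_add_mul_self_le_rpow_one_add (by linarith) hm
  have h2 : 0 < 1 + m * q := by nlinarith
  rw [← one_div, le_div_iff₀ h2]
  calc (1 - q) ^ m * (1 + m * q) ≤ (1 - q) ^ m * (1 + q) ^ m := by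
        gcongr
    _ = (1 - q ^ 2) ^ m := by
        rw [← mul_rpow (by linarith) (by linarith)]; ring_nf
    _ ≤ 1 := rpow_le_one (by nlinarith) (by nlinarith) (by linarith)

lemma hasDerivAt_angularGap {σ c x : ℝ} (hp : 2 ≤ p) :
    HasDerivAt (fun x => cosPow p * (2 - x) - (1 - σ ^ 2 * x ^ 2) ^ (p / 2) + c * x ^ p)
      (-cosPow p + p * σ ^ 2 * x * (1 - σ ^ 2 * x ^ 2) ^ (p / 2 - 1) + c * (p * x ^ (p - 1))) x := by
  have d1 := ((hasDerivAt_id x).const_sub 2).const_mul (cosPow p)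
  have d2 := ((((hasDerivAt_pow 2 x).const_mul (σ ^ 2)).const_sub 1)).rpow_const (p := p / 2)
    (Or.inr (by linarith))
  have d3 := (hasDerivAt_rpow_const (x := x) (p := p) (Or.inr (by linarith))).const_mul c
  refine ((d1.sub d2).add d3).congr_deriv ?_
  rw [show x ^ (2 - 1) = x from pow_one x]
  push_cast
  ring

/-- For angles in `[π / 2p, π / p]` the power `(1 - σ² x²) ^ (p / 2 - 1)` decays fast enough. -/
lemma mul_rpow_le_cosPow {σ x : ℝ} (hp : 9 ≤ p) (hσ0 : 0 ≤ σ) (hσ1 : σ ≤ 1) (hσ : p * σ ≤ π)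
    (hx0 : 0 ≤ x) (hx1 : x ≤ 1) :
    p * σ ^ 2 * x * (1 - σ ^ 2 * x ^ 2) ^ (p / 2 - 1) ≤ cosPow p := by
  have hN := cosPow_ge hp
  have hq : (σ * x) ^ 2 ≤ 1 := pow_le_one₀ (by positivity) (mul_le_one₀ hσ1 hx0 hx1)
  rw [← mul_pow]
  have h1 := one_sub_mul_rpow_le_inv (sq_nonneg (σ * x)) hq (by linarith : 1 ≤ p / 2 - 1)
  have h2 : 0 < 1 + (p / 2 - 1) * (σ * x) ^ 2 := by nlinarith [sq_nonneg (σ * x)]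
  refine (mul_le_mul_of_nonneg_left h1 (by positivity)).trans ?_
  rw [← div_eq_mul_inv, div_le_iff₀ h2]
  have hw : 0 ≤ σ * x := by positivity
  have h3 : p * σ ^ 2 * x ≤ 3.1416 * (σ * x) := by
    have : p * σ * (σ * x) ≤ π * (σ * x) := mul_le_mul_of_nonneg_right hσ hw
    nlinarith [pi_lt_d4]
  have h4 : 0.868 * (1 + 3.5 * (σ * x) ^ 2) ≤ cosPow p * (1 + (p / 2 - 1) * (σ * x) ^ 2) := by
    refine mul_le_mul hN ?_ (by positivity) (by linarith)
    nlinarith [sq_nonneg (σ * x)]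
  nlinarith [sq_nonneg (σ * x - 0.517)]

lemma angularGap_nonneg_of_slope {τ x : ℝ} (hp : 9 ≤ p) (h0 : 0 ≤ τ) (h1 : τ ≤ π / p)
    (hx0 : 0 ≤ x) (hx1 : x ≤ 1)
    (hs : ∀ y ∈ Ioo 0 (1 : ℝ), p * sin τ ^ 2 * y * (1 - sin τ ^ 2 * y ^ 2) ^ (p / 2 - 1) +
      sinWeight p * cos (p * τ) * (p * y ^ (p - 1)) ≤ cosPow p) :
    (1 - sin τ ^ 2 * x ^ 2) ^ (p / 2) ≤
      cosPow p * (2 - x) + sinWeight p * cos (p * τ) * x ^ p := by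
  have hm : AntitoneOn (fun x => cosPow p * (2 - x) - (1 - sin τ ^ 2 * x ^ 2) ^ (p / 2) +
      sinWeight p * cos (p * τ) * x ^ p) (Icc 0 1) := by
    refine antitoneOn_of_hasDerivWithinAt_nonpos (convex_Icc _ _)
      (fun x _ => (hasDerivAt_angularGap (by linarith)).continuousAt.continuousWithinAt)
      (fun x _ => (hasDerivAt_angularGap (by linarith)).hasDerivWithinAt) fun x hx => ?_
    rw [interior_Icc] at hx
    linarith [hs x hx]
  have h2 := hm ⟨hx0, hx1⟩ ⟨zero_le_one, le_rfl⟩ hx1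
  have hc : 0 ≤ cos τ := cos_nonneg_of_mem_Icc ⟨by linarith [pi_pos], h1.trans
    (div_le_div_of_nonneg_left pi_pos.le two_pos (by linarith))⟩
  have h3 := cos_rpow_le (by linarith) h0 h1
  have h4 : (1 - sin τ ^ 2) ^ (p / 2) = cos τ ^ p := by
    rw [← cos_sq', ← rpow_eq_sq_rpow_half hc]
  simp only [one_pow, mul_one, one_rpow, h4] at h2
  linarith

/-- The small angles: the gap dominates a convex combination of its bounds at angles `0` and `1`. -/
lemma angularGap_nonneg_of_le_one {τ x : ℝ} (hp : 9 ≤ p) (h0 : 0 ≤ τ) (h1 : p * τ ≤ 1)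
    (hx0 : 0 ≤ x) (hx1 : x ≤ 1) :
    (1 - sin τ ^ 2 * x ^ 2) ^ (p / 2) ≤
      cosPow p * (2 - x) + sinWeight p * cos (p * τ) * x ^ p := by
  obtain ⟨hh0, hh1⟩ := inv_mem hp
  have hph : p * p⁻¹ = 1 := mul_inv_cancel₀ (by linarith)
  have hτ1 : τ ≤ 1 := by nlinarith
  have hc : 0 < cos τ := cos_pos_of_le_one (by rw [abs_of_nonneg h0]; exact hτ1)
  have hK1 : (p * τ) ^ 2 ≤ 1 := pow_le_one₀ (by positivity) h1
  have hK0 : 0 ≤ (p * τ) ^ 2 := sq_nonneg _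
  have A0 := gap_at_zero_nonneg hp hx0 hx1
  have A1 := gap_at_one_nonneg hp hx0 hx1
  have hcos := le_cos_of_le_one (p * τ) (by rw [abs_of_nonneg (by positivity)]; exact h1)
  have hcp : cos τ ^ p ≤ 1 - (p * τ) ^ 2 * (p⁻¹ / 2 * (1 - p⁻¹ / 2)) := by
    have b1 : cos τ ^ 2 ≤ (1 + τ ^ 2)⁻¹ := by
      have := cos_le_one_div_sqrt_sq_add_one (x := τ) (by linarith [pi_pos])
        (by linarith [pi_gt_three])
      have := pow_le_pow_left₀ hc.le this 2
      rwa [div_pow, sq_sqrt (by positivity), one_pow, one_div, add_comm] at this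
    have b2 : 1 + (p * τ) ^ 2 * (p⁻¹ / 2) ≤ (1 + τ ^ 2) ^ (p / 2) := by
      have := one_add_mul_self_le_rpow_one_add (s := τ ^ 2) (p := p / 2)
        (by linarith [sq_nonneg τ]) (by linarith)
      refine le_trans (le_of_eq ?_) this
      linear_combination p * τ ^ 2 / 2 * hph
    have b3 : cos τ ^ p ≤ (1 + (p * τ) ^ 2 * (p⁻¹ / 2))⁻¹ := by
      rw [rpow_eq_sq_rpow_half hc.le]
      refine (rpow_le_rpow (sq_nonneg _) b1 (by linarith)).trans ?_
      rw [inv_rpow (by positivity)]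
      exact inv_anti₀ (by positivity) b2
    refine b3.trans ?_
    generalize (p * τ) ^ 2 = K at *
    have b4 : 0 ≤ K * (p⁻¹ / 2) := by positivity
    rw [← one_div, div_le_iff₀ (by linarith)]
    have b5 : 0 ≤ K * (p⁻¹ / 2) * (p⁻¹ / 2) * (1 - K) :=
      mul_nonneg (mul_nonneg b4 (by linarith)) (by linarith)
    have b6 : 0 ≤ K * (p⁻¹ / 2) * (p⁻¹ / 2) * (K * (p⁻¹ / 2)) :=
      mul_nonneg (mul_nonneg b4 (by linarith)) b4
    nlinarith
  have hconv : (1 - sin τ ^ 2 * x ^ 2) ^ (p / 2) ≤ 1 - x ^ 2 * (1 - cos τ ^ p) := by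
    have := (convexOn_rpow (by linarith : 1 ≤ p / 2)).2 (x := 1) (by simp) (y := cos τ ^ 2)
      (mem_Ici.2 (sq_nonneg _)) (sub_nonneg.2 (pow_le_one₀ hx0 hx1 : x ^ 2 ≤ 1)) (sq_nonneg x) (by ring)
    simp only [smul_eq_mul, one_rpow, ← rpow_eq_sq_rpow_half hc.le] at this
    rw [show 1 - sin τ ^ 2 * x ^ 2 = (1 - x ^ 2) * 1 + x ^ 2 * cos τ ^ 2 by
      rw [cos_sq']; ring]
    linarith
  have e1 := mul_le_mul_of_nonneg_left hcp (sq_nonneg x)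
  have e2 : sinWeight p * x ^ p * (0.99 - 0.47 * (p * τ) ^ 2) ≤
      sinWeight p * x ^ p * cos (p * τ) :=
    mul_le_mul_of_nonneg_left hcos
      (mul_nonneg (sinWeight_pos (by linarith)).le (rpow_nonneg hx0 p))
  have e3 := mul_nonneg (sub_nonneg.2 hK1) A0
  have e4 := mul_nonneg hK0 A1
  linarith

/-- The gap along the rays `τ = const` with `x = 1 / cosh t`. -/
lemma angularGap_nonneg {τ x : ℝ} (hp : 9 ≤ p) (h0 : 0 ≤ τ) (h1 : τ ≤ π / p)
    (hx0 : 0 ≤ x) (hx1 : x ≤ 1) :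
    (1 - sin τ ^ 2 * x ^ 2) ^ (p / 2) ≤
      cosPow p * (2 - x) + sinWeight p * cos (p * τ) * x ^ p := by
  have hp0 : 0 < p := by linarith
  have hkπ : p * τ ≤ π := by rw [le_div_iff₀ hp0] at h1; linarith
  have hτ2 : τ ≤ π := h1.trans (div_le_self pi_pos.le (by linarith))
  have hs0 : 0 ≤ sin τ := sin_nonneg_of_nonneg_of_le_pi h0 hτ2
  have hps : p * sin τ ≤ p * τ := mul_le_mul_of_nonneg_left (sin_le h0) hp0.le
  have hκ := sinWeight_pos (by linarith : 1 < p)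
  rcases le_total (p * τ) 1 with hk1 | hk1
  · exact angularGap_nonneg_of_le_one hp h0 hk1 hx0 hx1
  refine angularGap_nonneg_of_slope hp h0 h1 hx0 hx1 fun y hy => ?_
  rcases le_total (p * τ) (π / 2) with hk2 | hk2
  · have hs := slope_le_cosPow hp hk1 hk2
    have hcos : 0 ≤ cos (p * τ) := cos_nonneg_of_mem_Icc ⟨by linarith [pi_pos], hk2⟩
    have hy2 : sin τ ^ 2 * y ^ 2 ≤ 1 :=
      mul_le_one₀ (sin_sq_le_one τ) (sq_nonneg y) (pow_le_one₀ hy.1.le hy.2.le)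
    have a1 : p * sin τ ^ 2 * y * (1 - sin τ ^ 2 * y ^ 2) ^ (p / 2 - 1) ≤ (p * τ) ^ 2 * p⁻¹ := by
      have b1 : (1 - sin τ ^ 2 * y ^ 2) ^ (p / 2 - 1) ≤ 1 :=
        rpow_le_one (by linarith) (by linarith [mul_nonneg (sq_nonneg (sin τ)) (sq_nonneg y)])
          (by linarith)
      have b2 : p * sin τ ^ 2 ≤ (p * τ) ^ 2 * p⁻¹ := by
        have := mul_le_mul_of_nonneg_right (pow_le_pow_left₀ (by positivity) hps 2)
          (inv_nonneg.2 hp0.le)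
        refine le_trans (le_of_eq ?_) this
        field_simp
      calc p * sin τ ^ 2 * y * (1 - sin τ ^ 2 * y ^ 2) ^ (p / 2 - 1)
          ≤ p * sin τ ^ 2 * y * 1 :=
            mul_le_mul_of_nonneg_left b1 (mul_nonneg (by positivity) hy.1.le)
        _ ≤ p * sin τ ^ 2 := by
            rw [mul_one]; exact mul_le_of_le_one_right (by positivity) hy.2.le
        _ ≤ _ := b2
    have a2 : sinWeight p * cos (p * τ) * (p * y ^ (p - 1)) ≤ p * sinWeight p * cos (p * τ) := by
      have : y ^ (p - 1) ≤ 1 := rpow_le_one hy.1.le hy.2.le (by linarith)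
      have := mul_le_mul_of_nonneg_left this
        (by positivity : 0 ≤ p * sinWeight p * cos (p * τ))
      linarith
    linarith
  · have hcos : cos (p * τ) ≤ 0 := cos_nonpos_of_pi_div_two_le_of_le hk2 (by linarith [pi_pos])
    have a1 := mul_rpow_le_cosPow hp hs0 (sin_le_one τ) (hps.trans hkπ) hy.1.le hy.2.le
    have a2 : sinWeight p * cos (p * τ) * (p * y ^ (p - 1)) ≤ 0 :=
      mul_nonpos_of_nonpos_of_nonneg (mul_nonpos_of_nonneg_of_nonpos hκ.le hcos)
        (mul_nonneg hp0.le (rpow_nonneg hy.1.le _))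
    linarith

/-- The inequality for `p ≥ 9` in the coordinates `‖z‖ = √(a b) e ^ t`, `‖w‖ = √(a b) e ^ (-t)`,
`τ = |arg (z w)| / 2`. -/
lemma largeGap_nonneg {t τ : ℝ} (hp : 9 ≤ p) (ht : 0 ≤ t) (h0 : 0 ≤ τ) (h1 : τ ≤ π / 2) :
    (cosh t ^ 2 - sin τ ^ 2) ^ (p / 2) ≤
      cosPow p * cosh (p / (p - 1) * t) ^ (p - 1) + sinWeight p * cos (min (p * τ) π) := by
  have hp0 : 0 < p := by linarith
  have hc1 := one_le_cosh t
  have hc := cosh_pos t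
  have hN := cosPow_ge hp
  have hκ := sinWeight_pos (by linarith : 1 < p)
  have hκ1 : sinWeight p ≤ 0.18 * cosPow p := by nlinarith [sinWeight_le hp]
  -- reduction to `τ ≤ π / p`
  wlog hτ : τ ≤ π / p generalizing τ
  · push Not at hτ
    have hlt : π / p ≤ π / 2 := div_le_div_of_nonneg_left pi_pos.le two_pos (by linarith)
    have h2 := this (by positivity : 0 ≤ π / p) hlt le_rfl
    have e : p * (π / p) = π := by field_simp
    have h3 : π ≤ p * τ := by rw [div_lt_iff₀ hp0] at hτ; linarith
    rw [e, min_self] at h2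
    rw [min_eq_right h3]
    refine le_trans (rpow_le_rpow ?_ ?_ (by linarith)) h2
    · nlinarith [sin_sq_le_one τ]
    · have := sin_le_sin_of_le_of_le_pi_div_two (by linarith [div_nonneg pi_pos.le hp0.le]) h1 hτ.le
      have h5 : 0 ≤ sin (π / p) := sin_nonneg_of_nonneg_of_le_pi (by positivity) (by linarith)
      linarith [pow_le_pow_left₀ h5 this 2]
  have hkπ : p * τ ≤ π := by rw [le_div_iff₀ hp0] at hτ; linarith
  rw [min_eq_left hkπ]
  set c := cosh t with hcdef
  have hexp := cosh_rpow_mul_exp_le (t := t) (by linarith : 1 < p)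
  rw [← hcdef] at hexp
  have hx0 : 0 ≤ c⁻¹ := by positivity
  have hx1 : c⁻¹ ≤ 1 := inv_le_one_of_one_le₀ hc1
  have hcp : 0 < c ^ p := rpow_pos_of_pos hc p
  have hcp1 : c ^ p = c ^ (p - 1) * c := by rw [← rpow_add_one hc.ne']; ring_nf
  have hlhs : (c ^ 2 - sin τ ^ 2) ^ (p / 2) = c ^ p * (1 - sin τ ^ 2 * c⁻¹ ^ 2) ^ (p / 2) := by
    rw [rpow_eq_sq_rpow_half hc.le, ← mul_rpow (sq_nonneg c)]
    · congr 1; field_simp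
    · have : sin τ ^ 2 * c⁻¹ ^ 2 ≤ 1 :=
        mul_le_one₀ (sin_sq_le_one τ) (sq_nonneg _) (pow_le_one₀ hx0 hx1)
      linarith
  have hxp : c ^ p * c⁻¹ ^ p = 1 := by
    rw [← mul_rpow hc.le hx0, mul_inv_cancel₀ hc.ne', one_rpow]
  rw [hlhs]
  rcases le_total c 2 with h2 | h2
  · have g := mul_le_mul_of_nonneg_left (angularGap_nonneg hp h0 hτ hx0 hx1) hcp.le
    refine g.trans ?_
    have e1 := two_mul_cosh_sub_one_le_exp ht h2
    rw [← hcdef] at e1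
    have e2 := (mul_le_mul_of_nonneg_left e1 (rpow_nonneg hc.le (p - 1))).trans hexp
    have e3 : c ^ p * (2 - c⁻¹) = c ^ (p - 1) * (2 * c - 1) := by
      rw [hcp1]; field_simp
    have e4 := mul_le_mul_of_nonneg_left e2 (by linarith : 0 ≤ cosPow p)
    have e5 : c ^ p * (cosPow p * (2 - c⁻¹) + sinWeight p * cos (p * τ) * c⁻¹ ^ p) =
        cosPow p * (c ^ (p - 1) * (2 * c - 1)) + sinWeight p * cos (p * τ) := by
      rw [← e3]; linear_combination sinWeight p * cos (p * τ) * hxp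
    linarith
  · have e1 := mul_cosh_le_exp ht h2
    rw [← hcdef] at e1
    have e2 := (mul_le_mul_of_nonneg_left e1 (rpow_nonneg hc.le (p - 1))).trans hexp
    have e3 : c ^ (p - 1) * (1.5 * c) = 1.5 * c ^ p := by rw [hcp1]; ring
    have e4 := mul_le_mul_of_nonneg_left e2 (by linarith : 0 ≤ cosPow p)
    rw [e3] at e4
    have e5 : c ^ p * (1 - sin τ ^ 2 * c⁻¹ ^ 2) ^ (p / 2) ≤ c ^ p * 1 := by
      refine mul_le_mul_of_nonneg_left (rpow_le_one ?_ ?_ (by linarith)) hcp.le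
      · have : sin τ ^ 2 * c⁻¹ ^ 2 ≤ 1 :=
          mul_le_one₀ (sin_sq_le_one τ) (sq_nonneg _) (pow_le_one₀ hx0 hx1)
        linarith
      · linarith [mul_nonneg (sq_nonneg (sin τ)) (sq_nonneg c⁻¹)]
    have e6 : 1 ≤ c ^ p := one_le_rpow hc1 hp0.le
    have e7 : -(sinWeight p) ≤ sinWeight p * cos (p * τ) := by
      nlinarith [neg_one_le_cos (p * τ)]
    nlinarith

end LargeExponentGap

/-! ### The pointwise inequality for `p ≥ 9` -/

section LargeExponentPointwise
open Real Set

variable {p : ℝ}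

/-- The pointwise inequality behind the bound for `p ≥ 9`. -/
lemma norm_add_conj_rpow_le_of_nine_le (hp : 9 ≤ p) (z w : ℂ) :
    ‖z + (starRingEnd ℂ) w‖ ^ p ≤
      2 * cosPow p * (‖z‖ ^ (p / (p - 1)) + ‖w‖ ^ (p / (p - 1))) ^ (p - 1)
        - 2 ^ p * sinWeight p * negRePow (p / 2) (z * w) := by
  have hp0 : 0 < p := by linarith
  have hp1 : 0 < p - 1 := by linarith
  have hq : p / (p - 1) ≠ 0 := (div_pos hp0 hp1).ne'
  have hN := cosPow_ge hp
  have hone : ∀ v : ℂ, ‖v‖ ^ p ≤ 2 * cosPow p * (‖v‖ ^ (p / (p - 1))) ^ (p - 1) := fun v => by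
    rw [← rpow_mul (norm_nonneg v), div_mul_cancel₀ _ hp1.ne']
    exact le_mul_of_one_le_left (rpow_nonneg (norm_nonneg v) p) (by linarith)
  rcases eq_or_ne z 0 with rfl | hz
  · simpa [negRePow_zero (half_pos hp0), zero_rpow hq] using hone w
  rcases eq_or_ne w 0 with rfl | hw
  · simpa [negRePow_zero (half_pos hp0), zero_rpow hq] using hone z
  have hsq := norm_add_conj_sq z w
  have hre := re_eq_norm_mul_cos_abs_arg (z * w)
  rw [norm_mul] at hre
  obtain ⟨t, ht, hab⟩ := exists_log_coordinate (norm_pos_iff.2 hz) (norm_pos_iff.2 hw)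
  obtain ⟨hτ0, hτ1⟩ := abs_arg_div_two_mem (z * w)
  set θ := |(z * w).arg| with hθ
  set a := ‖z‖
  set b := ‖w‖
  have hab0 : 0 < a * b := mul_pos (norm_pos_iff.2 hz) (norm_pos_iff.2 hw)
  have h2 := hab 2
  rw [rpow_two, rpow_two, div_self two_ne_zero, rpow_one] at h2
  have hsq' : ‖z + (starRingEnd ℂ) w‖ ^ 2 = 2 ^ 2 * (a * b) * (cosh t ^ 2 - sin (θ / 2) ^ 2) := by
    have e1 := cosh_two_mul t
    have e2 := cosh_sq t
    have e3 := cos_two_mul (θ / 2)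
    rw [mul_div_cancel₀ _ (two_ne_zero' ℝ)] at e3
    have e4 := sin_sq_add_cos_sq (θ / 2)
    have e5 : sin (θ / 2) ^ 2 = 1 / 2 - cos θ / 2 := by linarith
    rw [hsq, h2, mul_comm 2 t, mul_comm t 2, e1, e2, e5, hre]
    linarith
  have hgap := largeGap_nonneg hp ht hτ0 hτ1
  rw [show p * (θ / 2) = p / 2 * θ by ring] at hgap
  have hnn : 0 ≤ cosh t ^ 2 - sin (θ / 2) ^ 2 := by
    have := one_le_cosh t
    nlinarith [sin_sq_le_one (θ / 2)]
  have hsum : (a ^ (p / (p - 1)) + b ^ (p / (p - 1))) ^ (p - 1) =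
      2 ^ (p - 1) * (a * b) ^ (p / 2) * cosh (p / (p - 1) * t) ^ (p - 1) := by
    rw [hab, mul_rpow (by positivity) (cosh_pos _).le, mul_rpow two_pos.le (by positivity),
      ← rpow_mul hab0.le]
    rw [show p / (p - 1) / 2 * (p - 1) = p / 2 by field_simp]
  have hk : 0 ≤ (2 : ℝ) ^ p * (a * b) ^ (p / 2) := by positivity
  have hfin := mul_le_mul_of_nonneg_left hgap hk
  rw [rpow_eq_sq_rpow_half (norm_nonneg _), hsq', mul_rpow (by positivity) hnn,
    mul_rpow (by positivity) hab0.le, ← rpow_eq_sq_rpow_half two_pos.le, hsum, negRePow,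
    norm_mul, ← hθ]
  refine hfin.trans (le_of_eq ?_)
  have e : (2 : ℝ) ^ p = 2 ^ (p - 1) * 2 := by
    rw [← rpow_add_one two_ne_zero]; norm_num
  rw [e]
  ring

end LargeExponentPointwise

/-! ### A pointwise inequality behind the theorem of M. Riesz -/

section RieszPointwise
open Set

/-- On a compact set, a nonnegative function times a large constant absorbs the negative part of a
function that is positive on its zero set. -/
lemma IsCompact.exists_forall_le_mul {X : Type*} [TopologicalSpace X] {K : Set X}
    (hK : IsCompact K) {f g : X → ℝ} (hf : Continuous f) (hg : Continuous g)
    (hf0 : ∀ x ∈ K, 0 ≤ f x) (hfg : ∀ x ∈ K, f x = 0 → g x < 0) :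
    ∃ A : ℝ, 0 ≤ A ∧ ∀ x ∈ K, g x ≤ A * f x := by
  have hK' : IsCompact (K ∩ {x | 0 ≤ g x}) := hK.inter_right (isClosed_le continuous_const hg)
  rcases (K ∩ {x | 0 ≤ g x}).eq_empty_or_nonempty with he | hne
  · refine ⟨0, le_rfl, fun x hx => ?_⟩
    by_contra! h
    have : x ∈ K ∩ {x | 0 ≤ g x} := ⟨hx, by simpa using h.le⟩
    simp [he] at this
  obtain ⟨x₀, hx₀, hmin⟩ := hK'.exists_isMinOn hne hf.continuousOn
  obtain ⟨x₁, hx₁, hmax⟩ := hK'.exists_isMaxOn hne hg.continuousOn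
  have hpos : 0 < f x₀ := lt_of_le_of_ne (hf0 _ hx₀.1) fun h =>
    absurd (hfg _ hx₀.1 h.symm) (not_lt.2 hx₀.2)
  have hA : 0 ≤ g x₁ / f x₀ := div_nonneg hx₁.2 hpos.le
  refine ⟨g x₁ / f x₀, hA, fun x hx => ?_⟩
  rcases le_total 0 (g x) with h | h
  · have h1 : g x ≤ g x₁ := hmax ⟨hx, h⟩
    have h2 : f x₀ ≤ f x := hmin ⟨hx, h⟩
    calc g x ≤ g x₁ := h1
      _ = g x₁ / f x₀ * f x₀ := by field_simp
      _ ≤ _ := mul_le_mul_of_nonneg_left h2 hA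
  · exact h.trans (mul_nonneg hA (hf0 x hx))

/-- If `u` is homogeneous and negative at `-1`, then `‖z‖ ^ p + ‖w‖ ^ p` is controlled by
`‖z + conj w‖ ^ p`, up to a multiple of `u (z w)`. -/
lemma exists_norm_rpow_add_le {p : ℝ} (hp : 0 < p) {u : ℂ → ℝ} (hu : Continuous u)
    (hhom : ∀ r : ℝ, 0 < r → ∀ ζ : ℂ, u ((r : ℂ) ^ 2 * ζ) = r ^ p * u ζ) (hneg : u (-1) < 0) :
    ∃ A M : ℝ, 0 ≤ A ∧ 0 ≤ M ∧ ∀ z w : ℂ,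
      ‖z‖ ^ p + ‖w‖ ^ p ≤ A * ‖z + (starRingEnd ℂ) w‖ ^ p - M * u (z * w) := by
  set M := 3 / -u (-1) with hM
  have hM0 : 0 < M := div_pos (by norm_num) (by linarith)
  have hMu : M * u (-1) = -3 := by rw [hM]; field_simp [hneg.ne]
  obtain ⟨A, hA0, hA⟩ := (isCompact_sphere (0 : ℂ × ℂ) 1).exists_forall_le_mul
    (f := fun x => ‖x.1 + (starRingEnd ℂ) x.2‖ ^ p)
    (g := fun x => ‖x.1‖ ^ p + ‖x.2‖ ^ p + M * u (x.1 * x.2))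
    ((continuous_norm.comp (continuous_fst.add
      (Complex.continuous_conj.comp continuous_snd))).rpow_const fun _ => Or.inr hp.le)
    (((continuous_fst.norm.rpow_const fun _ => Or.inr hp.le).add
      (continuous_snd.norm.rpow_const fun _ => Or.inr hp.le)).add
      (continuous_const.mul (hu.comp (continuous_fst.mul continuous_snd))))
    (fun x _ => Real.rpow_nonneg (norm_nonneg _) p)
    (fun x hx h0 => by
      rw [Real.rpow_eq_zero (norm_nonneg _) hp.ne', norm_eq_zero] at h0
      have h1 : x.1 = -(starRingEnd ℂ) x.2 := eq_neg_of_add_eq_zero_left h0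
      have hn : ‖x.1‖ = ‖x.2‖ := by rw [h1, norm_neg, RCLike.norm_conj]
      have hx1 : ‖x.2‖ = 1 := by
        have : ‖x‖ = 1 := by simpa using hx
        rwa [Prod.norm_def, hn, max_self] at this
      have h2 : x.1 * x.2 = -1 := by
        rw [h1, neg_mul, mul_comm, Complex.mul_conj, Complex.normSq_eq_norm_sq, hx1]
        norm_num
      simp only [hn, hx1, h2, Real.one_rpow, hMu]
      norm_num)
  refine ⟨A, M, hA0, hM0.le, fun z w => ?_⟩
  rcases eq_or_ne (z, w) 0 with h | h
  · obtain ⟨rfl, rfl⟩ : z = 0 ∧ w = 0 := by simpa using h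
    have hu0 : u 0 = 0 := by
      have := hhom 2 two_pos 0
      rw [mul_zero] at this
      have h1 : (1 : ℝ) < 2 ^ p := Real.one_lt_rpow (by norm_num) hp
      nlinarith
    simp [Real.zero_rpow hp.ne', hu0]
  set r := ‖(z, w)‖ with hr
  have hr0 : 0 < r := norm_pos_iff.2 h
  have hrc : (r : ℂ) ≠ 0 := Complex.ofReal_ne_zero.2 hr0.ne'
  have hs := hA ((r : ℂ)⁻¹ * z, (r : ℂ)⁻¹ * w) (by
    rw [mem_sphere_zero_iff_norm]
    have : ((r : ℂ)⁻¹ * z, (r : ℂ)⁻¹ * w) = ((r : ℂ)⁻¹) • (z, w) := by simp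
    rw [this, norm_smul, norm_inv, Complex.norm_real, Real.norm_eq_abs, abs_of_pos hr0, ← hr,
      inv_mul_cancel₀ hr0.ne'])
  have hu1 := hhom r hr0 ((r : ℂ)⁻¹ * z * ((r : ℂ)⁻¹ * w))
  rw [show (r : ℂ) ^ 2 * ((r : ℂ)⁻¹ * z * ((r : ℂ)⁻¹ * w)) = z * w by field_simp] at hu1
  have hn : ∀ v : ℂ, r ^ p * ‖(r : ℂ)⁻¹ * v‖ ^ p = ‖v‖ ^ p := fun v => by
    rw [← Real.mul_rpow hr0.le (norm_nonneg _), norm_mul, norm_inv, Complex.norm_real,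
      Real.norm_eq_abs, abs_of_pos hr0, mul_inv_cancel_left₀ hr0.ne']
  have hconj : (r : ℂ)⁻¹ * z + (starRingEnd ℂ) ((r : ℂ)⁻¹ * w) =
      (r : ℂ)⁻¹ * (z + (starRingEnd ℂ) w) := by
    rw [map_mul, map_inv₀, Complex.conj_ofReal, mul_add]
  have hfin := mul_le_mul_of_nonneg_left hs (Real.rpow_nonneg hr0.le p)
  simp only [hconj] at hfin
  rw [hu1, ← hn z, ← hn w, ← hn (z + (starRingEnd ℂ) w)]
  linarith

lemma rePow_sq_mul {p r : ℝ} (hr : 0 < r) (ζ : ℂ) :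
    rePow (p / 2) ((r : ℂ) ^ 2 * ζ) = r ^ p * rePow (p / 2) ζ := by
  have e : ((r : ℂ) ^ 2) = ((r ^ 2 : ℝ) : ℂ) := by push_cast; rfl
  rw [rePow, rePow, e, norm_mul, Complex.norm_real, Complex.arg_real_mul _ (by positivity),
    Real.norm_eq_abs, abs_of_pos (by positivity), Real.mul_rpow (by positivity) (norm_nonneg _),
    ← rpow_eq_sq_rpow_half hr.le]
  ring

lemma negRePow_sq_mul {p r : ℝ} (hr : 0 < r) (ζ : ℂ) :
    negRePow (p / 2) ((r : ℂ) ^ 2 * ζ) = r ^ p * negRePow (p / 2) ζ := by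
  have e : ((r : ℂ) ^ 2) = ((r ^ 2 : ℝ) : ℂ) := by push_cast; rfl
  rw [negRePow, negRePow, e, norm_mul, Complex.norm_real, Complex.arg_real_mul _ (by positivity),
    Real.norm_eq_abs, abs_of_pos (by positivity), Real.mul_rpow (by positivity) (norm_nonneg _),
    ← rpow_eq_sq_rpow_half hr.le]
  ring

/-- The product of the analytic part and the conjugate of the co-analytic part extends to an
entire function vanishing at the origin. -/
lemma integral_comp_mul_nonneg {u : ℂ → ℝ} (hu : Continuous u) (hu0 : u 0 = 0)
    (hmin : HasAnalyticMinorants u) (c : ℤ →₀ ℂ) (ε : ℂ) :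
    0 ≤ ∫ t, u (ε * (analyticPart c (circlePt t) * coanalyticPart c (circlePt t))) ∂arcLength :=
  integral_comp_nonneg hu hu0 hmin (F := fun z => ε * (analyticPart c z * coanalyticPart c z))
    (((differentiable_analyticPart c).mul (differentiable_coanalyticPart c)).const_mul ε)
    (by simp [coanalyticPart_zero])

/-- A pointwise inequality integrates to an inequality for trigonometric polynomials, since the
subharmonic correction has a nonnegative mean. -/
lemma integral_le_of_pointwise {u : ℂ → ℝ} (hu : Continuous u) (hu0 : u 0 = 0)
    (hmin : HasAnalyticMinorants u) {ε : ℂ} {M : ℝ} (hM : 0 ≤ M) {L R : ℂ → ℂ → ℝ}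
    (hL : Continuous fun x : ℂ × ℂ => L x.1 x.2) (hR : Continuous fun x : ℂ × ℂ => R x.1 x.2)
    (h : ∀ z w : ℂ, L z w ≤ R z w - M * u (ε * (z * w))) (c : ℤ →₀ ℂ) :
    ∫ t, L (analyticPart c (circlePt t)) (coanalyticPart c (circlePt t)) ∂arcLength ≤
      ∫ t, R (analyticPart c (circlePt t)) (coanalyticPart c (circlePt t)) ∂arcLength := by
  have hG : Continuous fun t => analyticPart c (circlePt t) :=
    (differentiable_analyticPart c).continuous.comp continuous_circlePt
  have hH : Continuous fun t => coanalyticPart c (circlePt t) :=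
    (differentiable_coanalyticPart c).continuous.comp continuous_circlePt
  have i1 := integrable_of_continuous (hL.comp (hG.prodMk hH))
  have i2 := integrable_of_continuous (hR.comp (hG.prodMk hH))
  have i3 := integrable_of_continuous (hu.comp (continuous_const.mul (hG.mul hH)) :
    Continuous fun t => u (ε * (analyticPart c (circlePt t) * coanalyticPart c (circlePt t))))
  have h1 := integral_mono i1 (i2.sub (i3.const_mul M)) fun t => h _ _
  simp only [Function.comp_def, Pi.sub_apply] at h1 i2 i3
  rw [integral_sub i2 (i3.const_mul M), integral_const_mul] at h1
  have h2 := mul_nonneg hM (integral_comp_mul_nonneg hu hu0 hmin c ε)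
  linarith

end RieszPointwise

/-! ### Fourier coefficients of functions in `L^p` -/

section FourierCoefficients
open Filter Topology

/-- An integrable function on the circle with vanishing Fourier coefficients vanishes. -/
lemma ae_eq_zero_of_fourierCoeff_eq_zero {f : CircleT → ℂ} (hf : Integrable f arcLength)
    (h : ∀ n, fourierCoeff f n = 0) : f =ᵐ[arcLength] 0 := by
  have hpoly : ∀ c : ℤ →₀ ℂ, ∫ t, trigPoly c t * f t ∂arcLength = 0 := by
    intro c
    have e : ∀ t, trigPoly c t * f t = ∑ n ∈ c.support, c n * (fourier n t • f t) := by
      intro t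
      simp only [trigPoly, Finsupp.sum, Finset.sum_mul, smul_eq_mul, mul_assoc]
    simp only [e]
    rw [integral_finsetSum _ fun n _ => (hf.fourier_smul n).const_mul _]
    refine Finset.sum_eq_zero fun n _ => ?_
    have := h (-n)
    rw [fourierCoeff, neg_neg] at this
    rw [integral_const_mul, this, mul_zero]
  have hcont : ∀ v : CircleT → ℂ, Continuous v → ∫ t, v t * f t ∂arcLength = 0 := by
    intro v hv
    have hvi : Integrable (fun t => v t * f t) arcLength := by
      obtain ⟨C, hC⟩ := isCompact_univ.exists_bound_of_continuousOn hv.continuousOn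
      exact hf.bdd_mul hv.aestronglyMeasurable (ae_of_all _ fun t => hC t trivial)
    rw [← norm_le_zero_iff]
    refine le_of_forall_pos_le_add fun ε hε => ?_
    set I := ∫ t, ‖f t‖ ∂arcLength with hI
    have hI0 : 0 ≤ I := integral_nonneg fun t => norm_nonneg _
    obtain ⟨c, hc⟩ := exists_trigPoly_near hv (div_pos hε (by linarith : 0 < I + 1))
    have hti : Integrable (fun t => trigPoly c t * f t) arcLength := by
      have e : (fun t => trigPoly c t * f t) =
          fun t => ∑ n ∈ c.support, c n * (fourier n t • f t) := by
        funext t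
        simp only [trigPoly, Finsupp.sum, Finset.sum_mul, smul_eq_mul, mul_assoc]
      rw [e]
      exact integrable_finsetSum _ fun n _ => (hf.fourier_smul n).const_mul _
    have e : ∫ t, v t * f t ∂arcLength = ∫ t, (v t - trigPoly c t) * f t ∂arcLength := by
      simp only [sub_mul]
      rw [integral_sub hvi hti, hpoly, sub_zero]
    rw [e, zero_add]
    calc ‖∫ t, (v t - trigPoly c t) * f t ∂arcLength‖
        ≤ ∫ t, ε / (I + 1) * ‖f t‖ ∂arcLength := by
          refine norm_integral_le_of_norm_le (hf.norm.const_mul _) (ae_of_all _ fun t => ?_)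
          rw [norm_mul]
          exact mul_le_mul_of_nonneg_right (hc t).le (norm_nonneg _)
      _ = ε * (I / (I + 1)) := by rw [integral_const_mul, ← hI]; ring
      _ ≤ ε := mul_le_of_le_one_right hε.le ((div_le_one (by linarith)).2 (by linarith))
  refine ae_eq_zero_of_forall_setIntegral_isClosed_eq_zero hf fun s hs => ?_
  have hlim : Tendsto (fun n => ∫ t, ((hs.apprSeq n t : ℝ) : ℂ) * f t ∂arcLength) atTop
      (𝓝 (∫ t, s.indicator f t ∂arcLength)) := by
    refine tendsto_integral_of_dominated_convergence (fun t => ‖f t‖) (fun n => ?_) hf.norm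
      (fun n => ae_of_all _ fun t => ?_) (ae_of_all _ fun t => ?_)
    · refine Continuous.aestronglyMeasurable ?_ |>.mul hf.aestronglyMeasurable
      exact Complex.continuous_ofReal.comp
        (NNReal.continuous_coe.comp (hs.apprSeq n).continuous)
    · rw [norm_mul, Complex.norm_real, Real.norm_eq_abs, NNReal.abs_eq]
      exact mul_le_of_le_one_left (norm_nonneg _)
        (by exact_mod_cast HasOuterApproxClosed.apprSeq_apply_le_one hs n t)
    · have h1 := tendsto_pi_nhds.1 (HasOuterApproxClosed.tendsto_apprSeq hs) t
      have h2 := ((Complex.continuous_ofReal.comp NNReal.continuous_coe).tendsto _).comp h1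
      have h3 := h2.mul_const (f t)
      have e : s.indicator f t =
          (Complex.ofReal ∘ NNReal.toReal) (s.indicator (fun _ => 1) t) * f t := by
        by_cases ht : t ∈ s
        · rw [Set.indicator_of_mem ht, Set.indicator_of_mem ht]; simp
        · rw [Set.indicator_of_notMem ht, Set.indicator_of_notMem ht]; simp
      rw [e]
      exact h3
  rw [integral_indicator hs.measurableSet] at hlim
  have h0 : ∀ n, ∫ t, ((hs.apprSeq n t : ℝ) : ℂ) * f t ∂arcLength = 0 := fun n =>
    hcont _ (Complex.continuous_ofReal.comp (NNReal.continuous_coe.comp (hs.apprSeq n).continuous))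
  simp only [h0] at hlim
  exact (tendsto_nhds_unique hlim tendsto_const_nhds)

variable {p : ℝ} [Fact (1 ≤ ENNReal.ofReal p)]

lemma integrable_LpT (f : LpT p) : Integrable f arcLength :=
  (Lp.memLp f).integrable Fact.out

/-- The `n`-th Fourier coefficient as a continuous linear functional on `L^p(𝕋)`. -/
noncomputable def coeffCLM (p : ℝ) [Fact (1 ≤ ENNReal.ofReal p)] (n : ℤ) : LpT p →L[ℂ] ℂ :=
  LinearMap.mkContinuous
    { toFun := fun f => fourierCoeff (f : CircleT → ℂ) n
      map_add' := fun f g => by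
        rw [fourierCoeff_congr_ae (Lp.coeFn_add f g),
          fourierCoeff.add (integrable_LpT f) (integrable_LpT g), Pi.add_apply]
      map_smul' := fun a f => by
        rw [fourierCoeff_congr_ae (Lp.coeFn_smul a f), fourierCoeff.const_smul, RingHom.id_apply] }
    1 fun f => by
      rw [one_mul]
      show ‖fourierCoeff (f : CircleT → ℂ) n‖ ≤ ‖f‖
      have h1 : ‖fourierCoeff (f : CircleT → ℂ) n‖ ≤ ∫ t, ‖f t‖ ∂arcLength := by
        refine (norm_integral_le_integral_norm _).trans (le_of_eq ?_)
        refine integral_congr_ae (ae_of_all _ fun t => ?_)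
        simp only [norm_smul]
        rw [fourier_eq_circlePt_zpow, norm_zpow, norm_circlePt, one_zpow, one_mul]
      refine h1.trans ?_
      rw [integral_norm_eq_lintegral_enorm (Lp.aestronglyMeasurable f), Lp.norm_def,
        ← eLpNorm_one_eq_lintegral_enorm]
      exact ENNReal.toReal_mono (Lp.eLpNorm_ne_top f)
        (eLpNorm_le_eLpNorm_of_exponent_le Fact.out (Lp.aestronglyMeasurable f))

lemma coeffCLM_apply (n : ℤ) (f : LpT p) : coeffCLM p n f = fourierCoeff (f : CircleT → ℂ) n := rfl

lemma LpT.eq_of_fourierCoeff_eq {f g : LpT p}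
    (h : ∀ n, fourierCoeff (f : CircleT → ℂ) n = fourierCoeff (g : CircleT → ℂ) n) : f = g := by
  rw [← sub_eq_zero]
  refine Lp.eq_zero_iff_ae_eq_zero.2
    (ae_eq_zero_of_fourierCoeff_eq_zero (integrable_LpT _) fun n => ?_)
  rw [← coeffCLM_apply, map_sub, coeffCLM_apply, coeffCLM_apply, h, sub_self]

lemma rieszPlus_eq {f g : LpT p} (h : IsRieszProjection f g) : rieszPlus f = g := by
  have hex : ∃ g : LpT p, IsRieszProjection f g := ⟨g, h⟩
  rw [rieszPlus, dif_pos hex]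
  exact LpT.eq_of_fourierCoeff_eq fun n => by rw [hex.choose_spec n, h n]

end FourierCoefficients

/-! ### Trigonometric polynomials in `L^p` and the theorem of M. Riesz -/

section RieszTheorem
open Filter Topology

lemma memLp_of_continuous {E : Type*} [NormedAddCommGroup E] {f : CircleT → E}
    (hf : Continuous f) (q : ENNReal) : MemLp f q arcLength := by
  obtain ⟨C, hC⟩ := isCompact_univ.exists_bound_of_continuousOn hf.continuousOn
  exact MemLp.of_bound hf.aestronglyMeasurable C (ae_of_all _ fun t => hC t trivial)

/-- An inequality between `p`-th moments of continuous functions, as an inequality of norms. -/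
lemma eLpNorm_le_of_integral_le {E F : Type*} [NormedAddCommGroup E] [NormedAddCommGroup F]
    {f : CircleT → E} {g : CircleT → F} (hf : Continuous f) (hg : Continuous g) {p A : ℝ}
    (hp : 0 < p) (hA : 0 ≤ A)
    (h : ∫ t, ‖f t‖ ^ p ∂arcLength ≤ A * ∫ t, ‖g t‖ ^ p ∂arcLength) :
    eLpNorm f (ENNReal.ofReal p) arcLength ≤
      ENNReal.ofReal (A ^ p⁻¹) * eLpNorm g (ENNReal.ofReal p) arcLength := by
  have hp0 : ENNReal.ofReal p ≠ 0 := by simpa using hp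
  rw [(memLp_of_continuous hf _).eLpNorm_eq_integral_rpow_norm hp0 ENNReal.ofReal_ne_top,
    (memLp_of_continuous hg _).eLpNorm_eq_integral_rpow_norm hp0 ENNReal.ofReal_ne_top,
    ENNReal.toReal_ofReal hp.le, ← ENNReal.ofReal_mul (Real.rpow_nonneg hA _),
    ← Real.mul_rpow hA (integral_nonneg fun t => Real.rpow_nonneg (norm_nonneg _) p)]
  exact ENNReal.ofReal_le_ofReal (Real.rpow_le_rpow
    (integral_nonneg fun t => Real.rpow_nonneg (norm_nonneg _) p) h (inv_nonneg.2 hp.le))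

lemma coeFn_linearCombination {p : ℝ} (e : ℤ → LpT p) (φ : ℤ → CircleT → ℂ)
    (h : ∀ n, (e n : CircleT → ℂ) =ᵐ[arcLength] φ n) (c : ℤ →₀ ℂ) :
    (Finsupp.linearCombination ℂ e c : LpT p) =ᵐ[arcLength]
      fun t => c.sum fun n a => a * φ n t := by
  induction c using Finsupp.induction_linear with
  | zero =>
    rw [map_zero]
    exact (Lp.coeFn_zero ℂ (ENNReal.ofReal p) arcLength).trans (ae_of_all _ fun t => by simp)
  | add c d hc hd =>
    rw [map_add]
    filter_upwards [Lp.coeFn_add (Finsupp.linearCombination ℂ e c)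
      (Finsupp.linearCombination ℂ e d), hc, hd] with t h1 h2 h3
    rw [h1, Pi.add_apply, h2, h3, Finsupp.sum_add_index' (by simp) (by intros; ring)]
  | single n a =>
    rw [Finsupp.linearCombination_single]
    filter_upwards [Lp.coeFn_smul a (e n), h n] with t h1 h2
    rw [h1, Pi.smul_apply, h2, Finsupp.sum_single_index (by simp), smul_eq_mul]

variable (p : ℝ) [Fact (1 ≤ ENNReal.ofReal p)]

/-- The trigonometric polynomial with coefficients `c`, as an element of `L^p(𝕋)`. -/
noncomputable def trigLp : (ℤ →₀ ℂ) →ₗ[ℂ] LpT p :=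
  Finsupp.linearCombination ℂ (fourierLp (ENNReal.ofReal p))

/-- The Riesz projection of `trigLp p c`. -/
noncomputable def analyticLp : (ℤ →₀ ℂ) →ₗ[ℂ] LpT p :=
  Finsupp.linearCombination ℂ fun n => if 0 ≤ n then fourierLp (ENNReal.ofReal p) n else 0

variable {p}

lemma coeFn_trigLp (c : ℤ →₀ ℂ) : (trigLp p c : CircleT → ℂ) =ᵐ[arcLength] trigPoly c :=
  coeFn_linearCombination _ _ (fun n => coeFn_fourierLp _ n) c

lemma coeFn_analyticLp (c : ℤ →₀ ℂ) :
    (analyticLp p c : CircleT → ℂ) =ᵐ[arcLength] fun t => analyticPart c (circlePt t) := by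
  refine (coeFn_linearCombination _ (fun n t => if 0 ≤ n then fourier n t else 0)
    (fun n => ?_) c).trans (ae_of_all _ fun t => ?_)
  · by_cases hn : 0 ≤ n
    · simpa only [hn, if_true] using coeFn_fourierLp _ n
    · simp only [hn, if_false]; exact Lp.coeFn_zero ℂ (ENNReal.ofReal p) arcLength
  · simp only [analyticPart_circlePt, Finsupp.sum, Finset.sum_filter, mul_ite, mul_zero]

lemma isRieszProjection_trigLp (c : ℤ →₀ ℂ) : IsRieszProjection (trigLp p c) (analyticLp p c) := by
  intro n
  have h : (coeffCLM p n).toLinearMap ∘ₗ analyticLp p =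
      (if 0 ≤ n then (1 : ℂ) else 0) • ((coeffCLM p n).toLinearMap ∘ₗ trigLp p) := by
    refine Finsupp.lhom_ext fun m a => ?_
    have h1 : coeffCLM p n (fourierLp (ENNReal.ofReal p) m) = if n = m then 1 else 0 := by
      rw [coeffCLM_apply, fourierCoeff_congr_ae (coeFn_fourierLp _ m), fourierCoeff_fourier,
        Pi.single_apply]
    simp only [LinearMap.comp_apply, LinearMap.smul_apply, trigLp, analyticLp,
      Finsupp.linearCombination_single, ContinuousLinearMap.coe_coe, map_smul, h1]
    by_cases hm : 0 ≤ m <;> by_cases hn : 0 ≤ n <;> simp only [hm, hn, if_true, if_false, h1, map_zero]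
      <;> simp <;> intro h <;> omega
  have := LinearMap.congr_fun h c
  simp only [LinearMap.comp_apply, LinearMap.smul_apply, ContinuousLinearMap.coe_coe,
    coeffCLM_apply] at this
  rw [this]
  by_cases hn : 0 ≤ n <;> simp [hn]

lemma exists_trigLp_near (f : LpT p) {ε : ℝ} (hε : 0 < ε) :
    ∃ c, dist f (trigLp p c) < ε := by
  have h : f ∈ (Submodule.span ℂ (Set.range
      (@fourierLp (2 * Real.pi) _ (ENNReal.ofReal p) _))).topologicalClosure := by
    rw [span_fourierLp_closure_eq_top ENNReal.ofReal_ne_top]; trivial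
  obtain ⟨P, hP, hd⟩ := Metric.mem_closure_iff.1 h ε hε
  obtain ⟨c, rfl⟩ := Finsupp.mem_span_range_iff_exists_finsupp.1 hP
  exact ⟨c, hd⟩

lemma exists_tendsto_trigLp (f : LpT p) :
    ∃ c : ℕ → ℤ →₀ ℂ, Tendsto (fun k => trigLp p (c k)) atTop (𝓝 f) := by
  choose c hc using fun k : ℕ => exists_trigLp_near f (Nat.one_div_pos_of_nat (n := k) (α := ℝ))
  refine ⟨c, ?_⟩
  rw [tendsto_iff_dist_tendsto_zero]
  refine squeeze_zero (fun k => dist_nonneg) (fun k => ?_) tendsto_one_div_add_atTop_nhds_zero_nat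
  rw [dist_comm]; exact (hc k).le

/-- The Riesz projection is bounded on trigonometric polynomials. -/
lemma exists_norm_analyticLp_le (hp : 1 < p) :
    ∃ C : ℝ, 0 ≤ C ∧ ∀ c, ‖analyticLp p c‖ ≤ C * ‖trigLp p c‖ := by
  have hp0 : 0 < p := by linarith
  have key : ∃ A : ℝ, 0 ≤ A ∧ ∀ c : ℤ →₀ ℂ,
      ∫ t, ‖analyticPart c (circlePt t)‖ ^ p ∂arcLength ≤
        A * ∫ t, ‖trigPoly c t‖ ^ p ∂arcLength := by
    have main : ∀ (u : ℂ → ℝ) (ε : ℂ), Continuous u → HasAnalyticMinorants u → u 0 = 0 →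
        (∀ r : ℝ, 0 < r → ∀ ζ : ℂ, u ((r : ℂ) ^ 2 * ζ) = r ^ p * u ζ) → u (-ε) < 0 →
        ∃ A : ℝ, 0 ≤ A ∧ ∀ c : ℤ →₀ ℂ,
          ∫ t, ‖analyticPart c (circlePt t)‖ ^ p ∂arcLength ≤
            A * ∫ t, ‖trigPoly c t‖ ^ p ∂arcLength := by
      intro u ε hu hmin hu0 hhom hneg
      obtain ⟨A, M, hA, hM, h⟩ := exists_norm_rpow_add_le hp0 (u := fun ζ => u (ε * ζ))
        (hu.comp (continuous_const.mul continuous_id))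
        (fun r hr ζ => by rw [← hhom r hr, mul_left_comm]) (by simpa using hneg)
      refine ⟨A, hA, fun c => ?_⟩
      have h1 := integral_le_of_pointwise hu hu0 hmin (ε := ε) hM
        (L := fun z _ => ‖z‖ ^ p) (R := fun z w => A * ‖z + (starRingEnd ℂ) w‖ ^ p)
        (continuous_fst.norm.rpow_const fun _ => Or.inr hp0.le)
        (continuous_const.mul ((continuous_fst.add
          (Complex.continuous_conj.comp continuous_snd)).norm.rpow_const fun _ => Or.inr hp0.le))
        (fun z w => by
          have := h z w
          have := Real.rpow_nonneg (norm_nonneg w) p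
          linarith) c
      simp only [← trigPoly_eq_add] at h1
      rwa [integral_const_mul] at h1
    rcases le_total p 2 with h2 | h2
    · refine main (rePow (p / 2)) 1 (continuous_rePow (by linarith))
        (hasAnalyticMinorants_rePow (by linarith) (by linarith)) (rePow_zero (by linarith))
        (fun r hr ζ => rePow_sq_mul hr ζ) ?_
      have : Real.cos (p / 2 * Real.pi) < 0 := by
        refine Real.cos_neg_of_pi_div_two_lt_of_lt ?_ ?_ <;> nlinarith [Real.pi_pos]
      simpa [rePow, abs_of_pos Real.pi_pos] using this
    · refine main (negRePow (p / 2)) (-1) (continuous_negRePow (by linarith))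
        (hasAnalyticMinorants_negRePow (by linarith)) (negRePow_zero (by linarith))
        (fun r hr ζ => negRePow_sq_mul hr ζ) ?_
      simp [negRePow, Real.pi_pos.le]
  obtain ⟨A, hA, h⟩ := key
  refine ⟨A ^ p⁻¹, Real.rpow_nonneg hA _, fun c => ?_⟩
  have hG : Continuous fun t => analyticPart c (circlePt t) :=
    (differentiable_analyticPart c).continuous.comp continuous_circlePt
  have hT : Continuous (trigPoly c) := by
    have : trigPoly c = fun t => analyticPart c (circlePt t) +
      (starRingEnd ℂ) (coanalyticPart c (circlePt t)) := funext (trigPoly_eq_add c)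
    rw [this]
    exact hG.add (Complex.continuous_conj.comp
      ((differentiable_coanalyticPart c).continuous.comp continuous_circlePt))
  have h1 := eLpNorm_le_of_integral_le hG hT hp0 hA (h c)
  rw [Lp.norm_def, Lp.norm_def, eLpNorm_congr_ae (coeFn_analyticLp c),
    eLpNorm_congr_ae (coeFn_trigLp c), ← ENNReal.toReal_ofReal (Real.rpow_nonneg hA _),
    ← ENNReal.toReal_mul]
  exact ENNReal.toReal_mono (ENNReal.mul_ne_top ENNReal.ofReal_ne_top
    (memLp_of_continuous hT _).eLpNorm_ne_top) h1

/-- The theorem of M. Riesz: if trigonometric polynomials converge to `f` in `L^p(𝕋)`, then their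
analytic parts converge to the Riesz projection of `f`. -/
lemma tendsto_analyticLp (hp : 1 < p) {f : LpT p} {c : ℕ → ℤ →₀ ℂ}
    (hc : Tendsto (fun k => trigLp p (c k)) atTop (𝓝 f)) :
    Tendsto (fun k => analyticLp p (c k)) atTop (𝓝 (rieszPlus f)) := by
  obtain ⟨C, hC, h⟩ := exists_norm_analyticLp_le hp
  have hcauchy : CauchySeq fun k => analyticLp p (c k) := by
    have h1 := hc.cauchySeq
    rw [Metric.cauchySeq_iff'] at h1 ⊢
    intro ε hε
    obtain ⟨N, hN⟩ := h1 (ε / (C + 1)) (by positivity)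
    refine ⟨N, fun n hn => ?_⟩
    have h2 := hN n hn
    rw [dist_eq_norm, ← map_sub] at h2 ⊢
    rw [lt_div_iff₀ (by positivity)] at h2
    have := h (c n - c N)
    nlinarith [norm_nonneg (trigLp p (c n - c N))]
  obtain ⟨g, hg⟩ := cauchySeq_tendsto_of_complete hcauchy
  have hproj : IsRieszProjection f g := by
    intro n
    have h1 := ((coeffCLM p n).continuous.tendsto g).comp hg
    have h2 := ((coeffCLM p n).continuous.tendsto f).comp hc
    simp only [Function.comp_def, coeffCLM_apply] at h1 h2
    simp only [isRieszProjection_trigLp (c _) n] at h1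
    refine tendsto_nhds_unique h1 ?_
    by_cases hn : 0 ≤ n
    · simpa only [hn, if_true] using h2
    · simp only [hn, if_false]; exact tendsto_const_nhds
  rwa [rieszPlus_eq hproj]

end RieszTheorem

/-! ### From trigonometric polynomials to `L^p` -/

section UpperBounds
open Filter Topology

/-- The `ℓ^s` size `(‖z‖ ^ s + ‖w‖ ^ s) ^ (1 / s)` of a pair. -/
noncomputable def pairNorm (s : ℝ) (z w : ℂ) : ℝ := (‖z‖ ^ s + ‖w‖ ^ s) ^ (1 / s)

lemma pairNorm_nonneg (s : ℝ) (z w : ℂ) : 0 ≤ pairNorm s z w := by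
  rw [pairNorm]; positivity

lemma continuous_pairNorm {s : ℝ} (hs : 0 < s) :
    Continuous fun x : ℂ × ℂ => pairNorm s x.1 x.2 :=
  ((continuous_fst.norm.rpow_const fun _ => Or.inr hs.le).add
    (continuous_snd.norm.rpow_const fun _ => Or.inr hs.le)).rpow_const
    fun _ => Or.inr (one_div_nonneg.2 hs.le)

lemma pairNorm_rpow {s : ℝ} (p : ℝ) (z w : ℂ) :
    ‖pairNorm s z w‖ ^ p = (‖z‖ ^ s + ‖w‖ ^ s) ^ (p / s) := by
  rw [Real.norm_of_nonneg (pairNorm_nonneg s z w), pairNorm, ← Real.rpow_mul (by positivity)]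
  ring_nf

lemma pairNorm_le_add {s : ℝ} (hs : 1 ≤ s) (z w z' w' : ℂ) :
    pairNorm s z w ≤ pairNorm s z' w' + (‖z - z'‖ + ‖w - w'‖) := by
  have hs0 : 0 < s := by linarith
  have tri : ∀ a b c d : ℝ, 0 ≤ a → 0 ≤ b → 0 ≤ c → 0 ≤ d →
      ((a + c) ^ s + (b + d) ^ s) ^ (1 / s) ≤
        (a ^ s + b ^ s) ^ (1 / s) + (c ^ s + d ^ s) ^ (1 / s) := by
    intro a b c d ha hb hc hd
    have := Real.Lp_add_le_of_nonneg (Finset.univ : Finset (Fin 2)) (f := ![a, b]) (g := ![c, d])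
      hs (by intro i _; fin_cases i <;> assumption) (by intro i _; fin_cases i <;> assumption)
    simpa [Fin.sum_univ_two] using this
  have h1 := tri ‖z'‖ ‖w'‖ ‖z - z'‖ ‖w - w'‖ (norm_nonneg _) (norm_nonneg _) (norm_nonneg _)
    (norm_nonneg _)
  have h2 := tri ‖z - z'‖ 0 0 ‖w - w'‖ (norm_nonneg _) le_rfl le_rfl (norm_nonneg _)
  simp only [add_zero, zero_add, Real.zero_rpow hs0.ne'] at h2
  rw [← Real.rpow_mul (norm_nonneg _), ← Real.rpow_mul (norm_nonneg _),
    mul_one_div_cancel hs0.ne', Real.rpow_one, Real.rpow_one] at h2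
  have hz : ‖z‖ ≤ ‖z'‖ + ‖z - z'‖ := by
    simpa using norm_add_le z' (z - z')
  have hw : ‖w‖ ≤ ‖w'‖ + ‖w - w'‖ := by
    simpa using norm_add_le w' (w - w')
  have h3 : pairNorm s z w ≤
      ((‖z'‖ + ‖z - z'‖) ^ s + (‖w'‖ + ‖w - w'‖) ^ s) ^ (1 / s) := by
    rw [pairNorm]; gcongr
  have h4 : pairNorm s z' w' = (‖z'‖ ^ s + ‖w'‖ ^ s) ^ (1 / s) := rfl
  linarith

lemma aestronglyMeasurable_pairNorm {f g : CircleT → ℂ} (s : ℝ)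
    (hf : AEStronglyMeasurable f arcLength) (hg : AEStronglyMeasurable g arcLength) :
    AEStronglyMeasurable (fun t => pairNorm s (f t) (g t)) arcLength :=
  (((hf.norm.aemeasurable.pow_const s).add (hg.norm.aemeasurable.pow_const s)).pow_const
    (1 / s)).aestronglyMeasurable

lemma mem_reverseRieszConstants_iff {p s B : ℝ} :
    B ∈ reverseRieszConstants p s ↔ ∀ f : LpT p,
      eLpNorm (f : CircleT → ℂ) (ENNReal.ofReal p) arcLength ≤ ENNReal.ofReal B *
        eLpNorm (fun t => pairNorm s ((rieszPlus f : CircleT → ℂ) t)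
          ((rieszMinus f : CircleT → ℂ) t)) (ENNReal.ofReal p) arcLength := Iff.rfl

lemma one_le_ofReal {p : ℝ} (hp : 1 < p) : 1 ≤ ENNReal.ofReal p := by
  rw [ENNReal.one_le_ofReal]; exact hp.le

/-- It suffices to prove the inequality for trigonometric polynomials. -/
lemma mem_reverseRieszConstants_of_trigPoly {p s B : ℝ} (hp : 1 < p) (hs : 1 ≤ s)
    (h : ∀ c : ℤ →₀ ℂ, eLpNorm (trigPoly c) (ENNReal.ofReal p) arcLength ≤
      ENNReal.ofReal B * eLpNorm (fun t => pairNorm s (analyticPart c (circlePt t))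
        (coanalyticPart c (circlePt t))) (ENNReal.ofReal p) arcLength) :
    B ∈ reverseRieszConstants p s := by
  have : Fact (1 ≤ ENNReal.ofReal p) := ⟨one_le_ofReal hp⟩
  rw [mem_reverseRieszConstants_iff]
  intro f
  obtain ⟨c, hc⟩ := exists_tendsto_trigLp f
  have hg := tendsto_analyticLp hp hc
  have hh : Tendsto (fun k => trigLp p (c k) - analyticLp p (c k)) atTop (𝓝 (rieszMinus f)) :=
    hc.sub hg
  set N := eLpNorm (fun t => pairNorm s ((rieszPlus f : CircleT → ℂ) t)
    ((rieszMinus f : CircleT → ℂ) t)) (ENNReal.ofReal p) arcLength with hN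
  have hlim : ∀ {F : ℕ → LpT p} {F₀ : LpT p}, Tendsto F atTop (𝓝 F₀) →
      Tendsto (fun k => ‖F k - F₀‖ₑ) atTop (𝓝 0) := fun {F F₀} hF => by
    have := (continuous_enorm.tendsto _).comp (hF.sub_const F₀)
    simpa [Function.comp_def] using this
  have hR : Tendsto (fun k => ENNReal.ofReal B * (N + (‖analyticLp p (c k) - rieszPlus f‖ₑ +
      ‖(trigLp p (c k) - analyticLp p (c k)) - rieszMinus f‖ₑ))) atTop
      (𝓝 (ENNReal.ofReal B * (N + (0 + 0)))) :=
    ENNReal.Tendsto.const_mul (tendsto_const_nhds.add ((hlim hg).add (hlim hh)))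
      (Or.inr ENNReal.ofReal_ne_top)
  rw [add_zero, add_zero] at hR
  have hL := (continuous_enorm.tendsto _).comp hc
  rw [← Lp.enorm_def]
  refine le_of_tendsto_of_tendsto' hL hR fun k => ?_
  have e1 : ‖trigLp p (c k)‖ₑ = eLpNorm (trigPoly (c k)) (ENNReal.ofReal p) arcLength := by
    rw [Lp.enorm_def, eLpNorm_congr_ae (coeFn_trigLp _)]
  show ‖trigLp p (c k)‖ₑ ≤ _
  rw [e1]
  refine (h (c k)).trans (mul_le_mul_right ?_ _)
  set G := analyticLp p (c k) with hG
  set W := trigLp p (c k) - analyticLp p (c k) with hW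
  have hWc : ∀ᵐ t ∂arcLength, ‖coanalyticPart (c k) (circlePt t)‖ = ‖(W : CircleT → ℂ) t‖ := by
    filter_upwards [Lp.coeFn_sub (trigLp p (c k)) (analyticLp p (c k)), coeFn_trigLp (p := p) (c k),
      coeFn_analyticLp (p := p) (c k)] with t h1 h2 h3
    rw [hW, h1, Pi.sub_apply, h2, h3, trigPoly_eq_add, add_sub_cancel_left, RCLike.norm_conj]
  have hm1 := aestronglyMeasurable_pairNorm s (Lp.aestronglyMeasurable (rieszPlus f))
    (Lp.aestronglyMeasurable (rieszMinus f))
  have hm2 := (Lp.aestronglyMeasurable (G - rieszPlus f)).norm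
  have hm3 := (Lp.aestronglyMeasurable (W - rieszMinus f)).norm
  calc eLpNorm (fun t => pairNorm s (analyticPart (c k) (circlePt t))
        (coanalyticPart (c k) (circlePt t))) (ENNReal.ofReal p) arcLength
      ≤ eLpNorm ((fun t => pairNorm s ((rieszPlus f : CircleT → ℂ) t)
          ((rieszMinus f : CircleT → ℂ) t)) + ((fun t => ‖(G - rieszPlus f : LpT p) t‖) +
          fun t => ‖(W - rieszMinus f : LpT p) t‖)) (ENNReal.ofReal p) arcLength := by
        refine eLpNorm_mono_ae ?_
        filter_upwards [hWc, coeFn_analyticLp (p := p) (c k), Lp.coeFn_sub G (rieszPlus f),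
          Lp.coeFn_sub W (rieszMinus f)] with t h1 h2 h3 h4
        have h5 := pairNorm_le_add hs ((G : CircleT → ℂ) t) ((W : CircleT → ℂ) t)
          ((rieszPlus f : CircleT → ℂ) t) ((rieszMinus f : CircleT → ℂ) t)
        have h6 : pairNorm s (analyticPart (c k) (circlePt t)) (coanalyticPart (c k) (circlePt t))
            = pairNorm s ((G : CircleT → ℂ) t) ((W : CircleT → ℂ) t) := by
          rw [pairNorm, pairNorm, h1, h2]
        simp only [Pi.add_apply, h3, h4, Pi.sub_apply]
        rw [h6, Real.norm_of_nonneg (pairNorm_nonneg _ _ _)]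
        exact h5.trans (Real.le_norm_self _)
    _ ≤ N + (‖G - rieszPlus f‖ₑ + ‖W - rieszMinus f‖ₑ) := by
        refine (eLpNorm_add_le hm1 (hm2.add hm3) Fact.out).trans ?_
        refine add_le_add le_rfl ((eLpNorm_add_le hm2 hm3 Fact.out).trans ?_)
        rw [eLpNorm_norm, eLpNorm_norm, Lp.enorm_def, Lp.enorm_def]

/-- The power mean inequality for two numbers. -/
lemma pairNorm_le_mul_pairNorm {s₀ s : ℝ} (h0 : 0 < s₀) (h : s₀ ≤ s) (z w : ℂ) :
    pairNorm s₀ z w ≤ 2 ^ (1 / s₀ - 1 / s) * pairNorm s z w := by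
  have hs : 0 < s := by linarith
  have h1 : (‖z‖ ^ s₀ + ‖w‖ ^ s₀) ^ (s / s₀) ≤
      2 ^ (s / s₀ - 1) * ((‖z‖ ^ s₀) ^ (s / s₀) + (‖w‖ ^ s₀) ^ (s / s₀)) := by
    exact_mod_cast NNReal.rpow_add_le_mul_rpow_add_rpow (‖z‖₊ ^ s₀) (‖w‖₊ ^ s₀)
      ((one_le_div h0).2 h)
  rw [← Real.rpow_mul (norm_nonneg z), ← Real.rpow_mul (norm_nonneg w),
    mul_div_cancel₀ _ h0.ne'] at h1
  have h2 := Real.rpow_le_rpow (by positivity) h1 (one_div_nonneg.2 hs.le)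
  rw [← Real.rpow_mul (by positivity), Real.mul_rpow (by positivity) (by positivity),
    ← Real.rpow_mul two_pos.le] at h2
  rw [pairNorm, pairNorm]
  convert h2 using 3 <;> field_simp

/-- Passing from the exponent `s₀` to a larger exponent. -/
lemma mem_reverseRieszConstants_of_le {p s₀ s B : ℝ} (hB : 0 ≤ B) (h0 : 0 < s₀) (h : s₀ ≤ s)
    (hmem : B ∈ reverseRieszConstants p s₀) :
    2 ^ (1 / s₀ - 1 / s) * B ∈ reverseRieszConstants p s := by
  rw [mem_reverseRieszConstants_iff] at *
  intro f
  have hk : (0 : ℝ) ≤ 2 ^ (1 / s₀ - 1 / s) := by positivity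
  refine (hmem f).trans ?_
  rw [mul_comm _ B, ENNReal.ofReal_mul hB, mul_assoc]
  refine mul_le_mul_right ?_ _
  refine eLpNorm_le_mul_eLpNorm_of_ae_le_mul (ae_of_all _ fun t => ?_) _
  rw [Real.norm_of_nonneg (pairNorm_nonneg _ _ _), Real.norm_of_nonneg (pairNorm_nonneg _ _ _)]
  exact pairNorm_le_mul_pairNorm h0 h _ _

/-- A pointwise inequality with a subharmonic correction yields an admissible constant. -/
lemma mem_reverseRieszConstants_of_pointwise {p s A M : ℝ} (hp : 1 < p) (hs : 1 ≤ s) (hA : 0 ≤ A)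
    (hM : 0 ≤ M) {u : ℂ → ℝ} (hu : Continuous u) (hu0 : u 0 = 0) (hmin : HasAnalyticMinorants u)
    {ε : ℂ} (h : ∀ z w : ℂ, ‖z + (starRingEnd ℂ) w‖ ^ p ≤
      A * (‖z‖ ^ s + ‖w‖ ^ s) ^ (p / s) - M * u (ε * (z * w))) :
    A ^ p⁻¹ ∈ reverseRieszConstants p s := by
  have hp0 : 0 < p := by linarith
  have hs0 : 0 < s := by linarith
  refine mem_reverseRieszConstants_of_trigPoly hp hs fun c => ?_
  have hG : Continuous fun t => analyticPart c (circlePt t) :=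
    (differentiable_analyticPart c).continuous.comp continuous_circlePt
  have hH : Continuous fun t => coanalyticPart c (circlePt t) :=
    (differentiable_coanalyticPart c).continuous.comp continuous_circlePt
  have hT : trigPoly c = fun t => analyticPart c (circlePt t) +
      (starRingEnd ℂ) (coanalyticPart c (circlePt t)) := funext (trigPoly_eq_add c)
  rw [hT]
  refine eLpNorm_le_of_integral_le (hG.add (Complex.continuous_conj.comp hH))
    ((continuous_pairNorm hs0).comp (hG.prodMk hH)) hp0 hA ?_
  have h1 := integral_le_of_pointwise hu hu0 hmin (ε := ε) hM
    (L := fun z w => ‖z + (starRingEnd ℂ) w‖ ^ p)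
    (R := fun z w => A * (‖z‖ ^ s + ‖w‖ ^ s) ^ (p / s))
    ((continuous_fst.add (Complex.continuous_conj.comp continuous_snd)).norm.rpow_const
      fun _ => Or.inr hp0.le)
    (continuous_const.mul (((continuous_fst.norm.rpow_const fun _ => Or.inr hs0.le).add
      (continuous_snd.norm.rpow_const fun _ => Or.inr hs0.le)).rpow_const
        fun _ => Or.inr (div_nonneg hp0.le hs0.le))) h c
  rw [integral_const_mul] at h1
  simpa only [pairNorm_rpow, Function.comp_def, Pi.add_apply] using h1

/-- The upper bound for `1 < p ≤ 2`. -/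
lemma sin_mem_reverseRieszConstants {p s : ℝ} (hp1 : 1 < p) (hp2 : p ≤ 2) (hs : p ≤ s) :
    2 ^ (1 - 1 / s) * Real.sin (Real.pi / (2 * p)) ∈ reverseRieszConstants p s := by
  have hp0 : 0 < p := by linarith
  obtain ⟨hsin, hcos⟩ := sin_cos_pi_div_pos hp1
  have h1 := mem_reverseRieszConstants_of_pointwise (p := p) (s := p)
    (A := 2 ^ (p - 1) * Real.sin (Real.pi / (2 * p)) ^ p) hp1 hp1.le (by positivity)
    (M := 2 ^ p * (Real.sin (Real.pi / (2 * p)) ^ (p - 1) * Real.cos (Real.pi / (2 * p))))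
    (by positivity) (continuous_rePow (half_pos hp0)) (rePow_zero (half_pos hp0))
    (hasAnalyticMinorants_rePow (half_pos hp0) (by linarith)) (ε := -1) fun z w => by
      rw [div_self hp0.ne', Real.rpow_one, neg_one_mul]
      exact norm_add_conj_rpow_le_of_le_two hp1 hp2 z w
  have h2 := mem_reverseRieszConstants_of_le (by positivity) hp0 hs h1
  convert h2 using 1
  rw [Real.mul_rpow (by positivity) (by positivity), ← Real.rpow_mul two_pos.le,
    ← Real.rpow_mul hsin.le, mul_inv_cancel₀ hp0.ne', Real.rpow_one, ← mul_assoc,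
    ← Real.rpow_add two_pos]
  congr 2
  field_simp
  ring

/-- The upper bound for `p ≥ 9`. -/
lemma cos_mem_reverseRieszConstants {p s : ℝ} (hp : 9 ≤ p) (hs : p / (p - 1) ≤ s) :
    2 ^ (1 - 1 / s) * Real.cos (Real.pi / (2 * p)) ∈ reverseRieszConstants p s := by
  have hp0 : 0 < p := by linarith
  have hp1 : 1 < p := by linarith
  have hpm : 0 < p - 1 := by linarith
  have hq : 1 ≤ p / (p - 1) := by rw [one_le_div hpm]; linarith
  obtain ⟨hsin, hcos⟩ := sin_cos_pi_div_pos hp1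
  have hN := cosPow_pos hp1
  have hκ := sinWeight_pos hp1
  have h1 := mem_reverseRieszConstants_of_pointwise (p := p) (s := p / (p - 1))
    (A := 2 * cosPow p) hp1 hq (by positivity) (M := 2 ^ p * sinWeight p)
    (by positivity) (continuous_negRePow (half_pos hp0)) (negRePow_zero (half_pos hp0))
    (hasAnalyticMinorants_negRePow (by linarith)) (ε := 1) fun z w => by
      rw [div_div_cancel₀ hp0.ne', one_mul]
      exact norm_add_conj_rpow_le_of_nine_le hp z w
  have h2 := mem_reverseRieszConstants_of_le (by positivity) (by linarith) hs h1
  convert h2 using 1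
  rw [Real.mul_rpow two_pos.le hN.le, cosPow, ← Real.rpow_mul hcos.le, mul_inv_cancel₀ hp0.ne',
    Real.rpow_one, ← mul_assoc, ← Real.rpow_add two_pos]
  congr 2
  field_simp
  ring

/-- For `s ≤ 1` the constant `1` is admissible by the triangle inequality. -/
lemma one_mem_reverseRieszConstants {p s : ℝ} (h0 : 0 < s) (hs : s ≤ 1) :
    1 ∈ reverseRieszConstants p s := by
  rw [mem_reverseRieszConstants_iff]
  intro f
  rw [ENNReal.ofReal_one, one_mul]
  refine eLpNorm_mono_ae ?_
  filter_upwards [Lp.coeFn_sub f (rieszPlus f)] with t ht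
  have e : (f : CircleT → ℂ) t = (rieszPlus f : CircleT → ℂ) t + (rieszMinus f : CircleT → ℂ) t := by
    rw [rieszMinus, ht, Pi.sub_apply]; ring
  rw [Real.norm_of_nonneg (pairNorm_nonneg _ _ _), e]
  refine (norm_add_le _ _).trans ?_
  have h1 := Real.rpow_add_le_add_rpow (norm_nonneg ((rieszPlus f : CircleT → ℂ) t))
    (norm_nonneg ((rieszMinus f : CircleT → ℂ) t)) h0.le hs
  have h2 := Real.rpow_le_rpow (by positivity) h1 (one_div_nonneg.2 h0.le)
  rwa [← Real.rpow_mul (by positivity), mul_one_div_cancel h0.ne', Real.rpow_one] at h2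

end UpperBounds

/-! ### Sharpness of the constants -/

section Sharpness
open Filter Topology

/-- The norm of `L^p(𝕋)`, on continuous functions. -/
noncomputable def circleNorm (p : ℝ) (f : CircleT → ℂ) : ℝ :=
  (eLpNorm f (ENNReal.ofReal p) arcLength).toReal

lemma circleNorm_nonneg (p : ℝ) (f : CircleT → ℂ) : 0 ≤ circleNorm p f := ENNReal.toReal_nonneg

lemma circleNorm_rpow {p : ℝ} (hp : 0 < p) {f : CircleT → ℂ} (hf : Continuous f) :
    circleNorm p f ^ p = ∫ t, ‖f t‖ ^ p ∂arcLength := by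
  have hI : 0 ≤ ∫ t, ‖f t‖ ^ p ∂arcLength :=
    integral_nonneg fun t => Real.rpow_nonneg (norm_nonneg _) p
  rw [circleNorm, (memLp_of_continuous hf _).eLpNorm_eq_integral_rpow_norm (by simpa using hp)
    ENNReal.ofReal_ne_top, ENNReal.toReal_ofReal hp.le,
    ENNReal.toReal_ofReal (Real.rpow_nonneg hI _), ← Real.rpow_mul hI, inv_mul_cancel₀ hp.ne',
    Real.rpow_one]

lemma circleNorm_add_le {p : ℝ} (hp : 1 < p) {f g : CircleT → ℂ} (hf : Continuous f)
    (hg : Continuous g) : circleNorm p (f + g) ≤ circleNorm p f + circleNorm p g := by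
  have h1 := memLp_of_continuous hf (ENNReal.ofReal p)
  have h2 := memLp_of_continuous hg (ENNReal.ofReal p)
  rw [circleNorm, circleNorm, circleNorm,
    ← ENNReal.toReal_add h1.eLpNorm_ne_top h2.eLpNorm_ne_top]
  exact ENNReal.toReal_mono (ENNReal.add_ne_top.2 ⟨h1.eLpNorm_ne_top, h2.eLpNorm_ne_top⟩)
    (eLpNorm_add_le h1.1 h2.1 (one_le_ofReal hp))

lemma circleNorm_const {p : ℝ} (hp : 1 < p) (a : ℂ) : circleNorm p (fun _ => a) = ‖a‖ := by
  rw [circleNorm, eLpNorm_const _ (by simp; linarith) (IsProbabilityMeasure.ne_zero arcLength)]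
  simp

lemma circleNorm_const_mul {p : ℝ} (a : ℂ) (f : CircleT → ℂ) :
    circleNorm p (fun t => a * f t) = ‖a‖ * circleNorm p f := by
  have := eLpNorm_const_smul a f (ENNReal.ofReal p) arcLength
  rw [circleNorm, circleNorm, show (fun t => a * f t) = a • f from rfl, this]
  simp

variable {Q : ℂ → ℂ}

lemma continuous_comp_circlePt (hQ : DiffContOnCl ℂ Q (Metric.ball 0 1)) :
    Continuous fun t => Q (circlePt t) := by
  refine hQ.continuousOn.comp_continuous continuous_circlePt fun t => ?_
  rw [closure_ball _ one_ne_zero]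
  simp [norm_circlePt]

lemma integral_pow_mul (hQ : DiffContOnCl ℂ Q (Metric.ball 0 1)) (n : ℕ) :
    ∫ t, circlePt t ^ n * Q (circlePt t) ∂arcLength = 0 ^ n * Q 0 :=
  integral_comp_circlePt_of_diffContOnCl (Q := fun z => z ^ n * Q z)
    (((differentiable_id.pow n).diffContOnCl).smul hQ)

lemma fourierCoeff_of_neg (hQ : DiffContOnCl ℂ Q (Metric.ball 0 1)) {n : ℤ} (hn : n < 0) :
    fourierCoeff (fun t => Q (circlePt t)) n = 0 := by
  obtain ⟨m, rfl⟩ : ∃ m : ℕ, n = -((m : ℤ) + 1) := ⟨(-n - 1).toNat, by omega⟩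
  have := integral_pow_mul hQ (m + 1)
  rw [zero_pow (by omega), zero_mul] at this
  rw [fourierCoeff, ← this]
  refine integral_congr_ae (ae_of_all _ fun t => ?_)
  simp only
  rw [neg_neg, fourier_eq_circlePt_zpow, smul_eq_mul]
  norm_cast

lemma fourierCoeff_conj_of_nonneg (hQ : DiffContOnCl ℂ Q (Metric.ball 0 1)) (hQ0 : Q 0 = 0) {n : ℤ}
    (hn : 0 ≤ n) : fourierCoeff (fun t => (starRingEnd ℂ) (Q (circlePt t))) n = 0 := by
  lift n to ℕ using hn
  have := congrArg (starRingEnd ℂ) (integral_pow_mul hQ n)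
  rw [hQ0, mul_zero, map_zero, ← integral_conj] at this
  rw [fourierCoeff, ← this]
  refine integral_congr_ae (ae_of_all _ fun t => ?_)
  simp only
  rw [fourier_eq_circlePt_zpow, smul_eq_mul, map_mul, map_pow, conj_circlePt, zpow_neg, inv_pow,
    zpow_natCast]

/-- Testing the inequality on `G + ε conj G`, where `G` is analytic and vanishes at the origin. -/
lemma circleNorm_add_conj_le {p s B : ℝ} (hp : 1 < p) (hs : 0 < s)
    (hB : B ∈ reverseRieszConstants p s) (hQ : DiffContOnCl ℂ Q (Metric.ball 0 1)) (hQ0 : Q 0 = 0)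
    {ε : ℂ} (hε : ‖ε‖ = 1) :
    circleNorm p (fun t => Q (circlePt t) + ε * (starRingEnd ℂ) (Q (circlePt t))) ≤
      max B 0 * 2 ^ (1 / s) * circleNorm p fun t => Q (circlePt t) := by
  have : Fact (1 ≤ ENNReal.ofReal p) := ⟨one_le_ofReal hp⟩
  have hG := continuous_comp_circlePt hQ
  have hH : Continuous fun t => ε * (starRingEnd ℂ) (Q (circlePt t)) :=
    continuous_const.mul (Complex.continuous_conj.comp hG)
  have hf : Continuous fun t => Q (circlePt t) + ε * (starRingEnd ℂ) (Q (circlePt t)) := hG.add hH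
  set f : LpT p := (memLp_of_continuous hf _).toLp _ with hfdef
  set g : LpT p := (memLp_of_continuous hG _).toLp _ with hgdef
  have hfc : (f : CircleT → ℂ) =ᵐ[arcLength] _ := MemLp.coeFn_toLp _
  have hgc : (g : CircleT → ℂ) =ᵐ[arcLength] _ := MemLp.coeFn_toLp _
  have hproj : IsRieszProjection f g := by
    intro n
    rw [fourierCoeff_congr_ae hgc, fourierCoeff_congr_ae hfc]
    have hadd : fourierCoeff (fun t => Q (circlePt t) + ε * (starRingEnd ℂ) (Q (circlePt t))) n =
        fourierCoeff (fun t => Q (circlePt t)) n +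
          ε * fourierCoeff (fun t => (starRingEnd ℂ) (Q (circlePt t))) n := by
      rw [← fourierCoeff.const_mul, ← Pi.add_apply, ← fourierCoeff.add
        (integrable_of_continuous hG) (integrable_of_continuous hH)]
      rfl
    rw [hadd]
    by_cases hn : 0 ≤ n
    · rw [if_pos hn, fourierCoeff_conj_of_nonneg hQ hQ0 hn, mul_zero, add_zero]
    · rw [if_neg hn, fourierCoeff_of_neg hQ (by omega)]
  have hplus := rieszPlus_eq hproj
  have h1 := mem_reverseRieszConstants_iff.1 hB f
  have h2 : eLpNorm (fun t => pairNorm s ((rieszPlus f : CircleT → ℂ) t)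
      ((rieszMinus f : CircleT → ℂ) t)) (ENNReal.ofReal p) arcLength =
      eLpNorm (fun t => (((2 : ℝ) ^ (1 / s) : ℝ) : ℂ) * Q (circlePt t)) (ENNReal.ofReal p) arcLength := by
    refine eLpNorm_congr_norm_ae ?_
    rw [rieszMinus, hplus]
    filter_upwards [hfc, hgc, Lp.coeFn_sub f g] with t a1 a2 a3
    rw [a3, Pi.sub_apply, a1, a2, add_sub_cancel_left, Real.norm_of_nonneg (pairNorm_nonneg _ _ _),
      pairNorm, norm_mul, norm_mul, hε, one_mul, RCLike.norm_conj, ← two_mul,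
      Real.mul_rpow two_pos.le (by positivity), ← Real.rpow_mul (norm_nonneg _),
      mul_one_div_cancel hs.ne', Real.rpow_one]
    congr 1
    rw [Complex.norm_real, Real.norm_of_nonneg (by positivity)]
  rw [h2, eLpNorm_congr_ae hfc] at h1
  have h3 := ENNReal.toReal_mono (ENNReal.mul_ne_top ENNReal.ofReal_ne_top
    (memLp_of_continuous (continuous_const.mul hG) _).eLpNorm_ne_top) h1
  rw [ENNReal.toReal_mul, ENNReal.toReal_ofReal'] at h3
  refine h3.trans (le_of_eq ?_)
  rw [mul_assoc]
  congr 1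
  refine (circleNorm_const_mul (p := p) (((2 : ℝ) ^ (1 / s) : ℝ) : ℂ) fun t =>
    Q (circlePt t)).trans ?_
  rw [Complex.norm_real, Real.norm_of_nonneg (by positivity)]

end Sharpness

/-! ### The extremal family -/

section Extremal
open Filter Topology

/-- The principal branch of `w ^ (-1 / p)`. -/
noncomputable def invRoot (p : ℝ) (w : ℂ) : ℂ := Complex.exp (-Complex.log w / p)

lemma norm_invRoot_rpow {p : ℝ} (hp : 0 < p) {w : ℂ} (hw : w ≠ 0) : ‖invRoot p w‖ ^ p = ‖w‖⁻¹ := by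
  have e : (-Complex.log w / p).re = -Real.log ‖w‖ / p := by
    rw [Complex.div_ofReal_re, Complex.neg_re, Complex.log_re]
  rw [invRoot, Complex.norm_exp, e, ← Real.exp_mul, div_mul_cancel₀ _ hp.ne', Real.exp_neg,
    Real.exp_log (norm_pos_iff.2 hw)]

lemma invRoot_im (p : ℝ) (w : ℂ) : |(invRoot p w).im| = ‖invRoot p w‖ * |Real.sin (w.arg / p)| := by
  have e : (-Complex.log w / p).im = -(w.arg / p) := by
    rw [Complex.div_ofReal_im, Complex.neg_im, Complex.log_im, neg_div]
  rw [invRoot, Complex.exp_im, Complex.norm_exp, e, Real.sin_neg, abs_mul, abs_neg,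
    abs_of_pos (Real.exp_pos _)]

lemma invRoot_re (p : ℝ) (w : ℂ) : (invRoot p w).re = ‖invRoot p w‖ * Real.cos (w.arg / p) := by
  have e : (-Complex.log w / p).im = -(w.arg / p) := by
    rw [Complex.div_ofReal_im, Complex.neg_im, Complex.log_im, neg_div]
  rw [invRoot, Complex.exp_re, Complex.norm_exp, e, Real.cos_neg]

lemma abs_arg_div_le {p : ℝ} (hp : 0 < p) {w : ℂ} (hw : 0 < w.re) :
    |w.arg / p| ≤ Real.pi / (2 * p) := by
  have h := (Complex.abs_arg_le_pi_div_two_iff).2 hw.le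
  rw [abs_div, abs_of_pos hp, ← div_div]
  exact div_le_div_of_nonneg_right h hp.le

lemma cos_mul_norm_invRoot_le {p : ℝ} (hp : 1 < p) {w : ℂ} (hw : 0 < w.re) :
    Real.cos (Real.pi / (2 * p)) * ‖invRoot p w‖ ≤ |(invRoot p w).re| := by
  have h := abs_arg_div_le (by linarith : 0 < p) hw
  obtain ⟨h0, h1⟩ := pi_div_two_mul_mem hp
  rw [invRoot_re, mul_comm]
  refine le_trans (mul_le_mul_of_nonneg_left ?_ (norm_nonneg _)) (le_abs_self _)
  rw [← Real.cos_abs (w.arg / p)]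
  exact Real.cos_le_cos_of_nonneg_of_le_pi (abs_nonneg _) (by linarith [Real.pi_pos]) h

/-- The imaginary part of `w ^ (-1 / p)` is as large as possible up to an error of bounded mean:
for `w = 1 - r ζ` the function `Re (1 / w)` has mean `1` on the circle. -/
lemma sin_rpow_mul_inv_norm_le {p : ℝ} (hp : 1 < p) {w : ℂ} (hw : 0 < w.re) :
    Real.sin (Real.pi / (2 * p)) ^ p * ‖w‖⁻¹ - Real.pi / 2 * (w⁻¹).re ≤ |(invRoot p w).im| ^ p := by
  have hp0 : 0 < p := by linarith
  have hw0 : w ≠ 0 := by rintro rfl; simp at hw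
  have hn : 0 < ‖w‖ := norm_pos_iff.2 hw0
  have hre : (w⁻¹).re = ‖w‖⁻¹ * Real.cos |w.arg| := by
    rw [Real.cos_abs, Complex.cos_arg hw0, Complex.inv_re, Complex.normSq_eq_norm_sq]
    field_simp
  have hφ : |w.arg| ≤ Real.pi / 2 := (Complex.abs_arg_le_pi_div_two_iff).2 hw.le
  have hle := abs_arg_div_le hp0 hw
  obtain ⟨h0, h1⟩ := pi_div_two_mul_mem hp
  have hs := (sin_cos_pi_div_pos hp).1
  have hsa : |Real.sin (w.arg / p)| = Real.sin (|w.arg| / p) := by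
    have e : |w.arg| / p = |w.arg / p| := by rw [abs_div, abs_of_pos hp0]
    rw [e, Real.abs_sin_eq_sin_abs_of_abs_le_pi (by linarith [Real.pi_pos])]
  have hs2 : 0 ≤ Real.sin (|w.arg| / p) := by rw [← hsa]; exact abs_nonneg _
  rw [invRoot_im, Real.mul_rpow (norm_nonneg _) (abs_nonneg _), norm_invRoot_rpow hp0 hw0, hre, hsa]
  have key : Real.sin (Real.pi / (2 * p)) ^ p - Real.pi / 2 * Real.cos |w.arg| ≤
      Real.sin (|w.arg| / p) ^ p := by
    have a1 := rpow_tangent_le hp.le hs2 hs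
    rw [← Real.rpow_add_one hs.ne', sub_add_cancel] at a1
    have a2 : Real.sin (Real.pi / (2 * p)) - Real.sin (|w.arg| / p) ≤
        Real.pi / (2 * p) - |w.arg| / p := by
      have b1 := Real.sin_sub_sin (Real.pi / (2 * p)) (|w.arg| / p)
      have b2 : |w.arg| / p ≤ Real.pi / (2 * p) := by
        rw [abs_div, abs_of_pos hp0] at hle; exact hle
      have b3 : Real.sin ((Real.pi / (2 * p) - |w.arg| / p) / 2) ≤
          (Real.pi / (2 * p) - |w.arg| / p) / 2 := Real.sin_le (by linarith)
      have b4 : 0 ≤ Real.sin ((Real.pi / (2 * p) - |w.arg| / p) / 2) :=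
        Real.sin_nonneg_of_nonneg_of_le_pi (by linarith)
          (by have : 0 ≤ |w.arg| / p := by positivity
              linarith)
      have b5 := Real.cos_le_one ((Real.pi / (2 * p) + |w.arg| / p) / 2)
      nlinarith
    have a3 : Real.sin (Real.pi / (2 * p)) ^ (p - 1) ≤ 1 :=
      Real.rpow_le_one hs.le (Real.sin_le_one _) (by linarith)
    have a4 : 0 ≤ Real.pi / (2 * p) - |w.arg| / p := by
      rw [abs_div, abs_of_pos hp0] at hle; linarith
    have a5 : p * (Real.pi / (2 * p) - |w.arg| / p) = Real.pi / 2 - |w.arg| := by field_simp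
    have a6 : Real.pi / 2 - |w.arg| ≤ Real.pi / 2 * Real.cos |w.arg| := by
      have := Real.mul_le_sin (by linarith : 0 ≤ Real.pi / 2 - |w.arg|)
        (by linarith [abs_nonneg w.arg])
      rw [Real.sin_pi_div_two_sub] at this
      have h3 := mul_le_mul_of_nonneg_left this (by positivity : 0 ≤ Real.pi / 2)
      refine le_trans (le_of_eq ?_) h3
      have := Real.pi_ne_zero
      field_simp
    have a7 : 0 ≤ Real.sin (Real.pi / (2 * p)) ^ (p - 1) := by positivity
    have a8 : p * Real.sin (Real.pi / (2 * p)) ^ (p - 1) *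
        (Real.sin (Real.pi / (2 * p)) - Real.sin (|w.arg| / p)) ≤ Real.pi / 2 - |w.arg| := by
      rw [← a5, mul_assoc]
      refine mul_le_mul_of_nonneg_left ?_ hp0.le
      exact (mul_le_mul_of_nonneg_left a2 a7).trans (mul_le_of_le_one_left a4 a3)
    linarith
  have := mul_le_mul_of_nonneg_left key (inv_nonneg.2 hn.le)
  linarith

variable {p r : ℝ}

lemma one_sub_mul_re_pos (h0 : 0 < r) (h1 : r < 1) {z : ℂ} (hz : ‖z‖ ≤ 1) :
    0 < (1 - (r : ℂ) * z).re := by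
  have := (Complex.re_le_norm z).trans hz
  rw [Complex.sub_re, Complex.one_re, Complex.re_ofReal_mul]
  nlinarith

lemma diffContOnCl_invRoot (h0 : 0 < r) (h1 : r < 1) :
    DiffContOnCl ℂ (fun z => invRoot p (1 - (r : ℂ) * z)) (Metric.ball 0 1) := by
  refine DifferentiableOn.diffContOnCl fun z hz => ?_
  rw [closure_ball _ one_ne_zero, mem_closedBall_zero_iff] at hz
  refine DifferentiableAt.differentiableWithinAt ?_
  have hs : (1 - (r : ℂ) * z) ∈ Complex.slitPlane := Or.inl (one_sub_mul_re_pos h0 h1 hz)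
  have hd : DifferentiableAt ℂ (fun z : ℂ => 1 - (r : ℂ) * z) z := by fun_prop
  exact (((hd.clog hs).neg).div_const _).cexp

lemma integral_inv_re (h0 : 0 < r) (h1 : r < 1) :
    ∫ t, ((1 - (r : ℂ) * circlePt t)⁻¹).re ∂arcLength = 1 := by
  have hd : DiffContOnCl ℂ (fun z => (1 - (r : ℂ) * z)⁻¹) (Metric.ball 0 1) := by
    refine DifferentiableOn.diffContOnCl fun z hz => ?_
    rw [closure_ball _ one_ne_zero, mem_closedBall_zero_iff] at hz
    have hne : 1 - (r : ℂ) * z ≠ 0 := by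
      intro h; have := one_sub_mul_re_pos h0 h1 hz; rw [h] at this; simp at this
    have hd : DifferentiableAt ℂ (fun z : ℂ => 1 - (r : ℂ) * z) z := by fun_prop
    exact (hd.inv hne).differentiableWithinAt
  have h2 := integral_re (𝕜 := ℂ) (integrable_of_continuous (continuous_comp_circlePt hd))
  simp only [RCLike.re_eq_complex_re] at h2
  rw [h2, integral_comp_circlePt_of_diffContOnCl hd]
  simp

/-- The mean of `1 / |1 - r ζ|` is unbounded as `r → 1`. -/
lemma log_le_integral_inv_norm (h0 : 0 < r) (h1 : r < 1) :
    (2 * Real.pi)⁻¹ * Real.log (1 / (1 - r)) ≤ ∫ t, ‖1 - (r : ℂ) * circlePt t‖⁻¹ ∂arcLength := by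
  have hδ : 0 < 1 - r := by linarith
  rw [integral_comp_circlePt (fun z => ‖1 - (r : ℂ) * z‖⁻¹), Real.circleAverage_def, smul_eq_mul]
  refine mul_le_mul_of_nonneg_left ?_ (by positivity)
  have hpos : ∀ x : ℝ, 0 < ‖1 - (r : ℂ) * circleMap 0 1 x‖ := fun x => by
    rw [norm_pos_iff]
    intro h
    have := one_sub_mul_re_pos h0 h1 (z := circleMap 0 1 x) (by simp)
    rw [h] at this
    simp at this
  have hcont : Continuous fun x : ℝ => ‖1 - (r : ℂ) * circleMap 0 1 x‖⁻¹ := by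
    refine Continuous.inv₀ ?_ fun x => (hpos x).ne'
    have := continuous_circleMap 0 1
    fun_prop
  have hle : ∀ x ∈ Set.Icc (0 : ℝ) 1, (x + (1 - r))⁻¹ ≤ ‖1 - (r : ℂ) * circleMap 0 1 x‖⁻¹ := by
    intro x hx
    refine inv_anti₀ (hpos x) ?_
    have e : 1 - (r : ℂ) * circleMap 0 1 x =
        ((1 - r : ℝ) : ℂ) - (r : ℂ) * (Complex.exp (Complex.I * x) - 1) := by
      rw [circleMap]; push_cast; rw [mul_comm Complex.I]; ring
    rw [e]
    refine (norm_sub_le _ _).trans ?_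
    have h2 := Real.norm_exp_I_mul_ofReal_sub_one_le (x := x)
    rw [Real.norm_of_nonneg hx.1] at h2
    rw [norm_mul, Complex.norm_real, Complex.norm_real, Real.norm_of_nonneg hδ.le,
      Real.norm_of_nonneg h0.le]
    nlinarith [norm_nonneg (Complex.exp (Complex.I * x) - 1)]
  have hint : IntervalIntegrable (fun x : ℝ => (x + (1 - r))⁻¹) volume 0 1 := by
    refine ContinuousOn.intervalIntegrable_of_Icc zero_le_one ?_
    refine ContinuousOn.inv₀ (by fun_prop) fun x hx => ?_
    have := hx.1
    linarith
  calc Real.log (1 / (1 - r)) ≤ Real.log ((1 + (1 - r)) / (1 - r)) := by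
        refine Real.log_le_log (by positivity) ?_
        gcongr
        linarith
    _ = ∫ x in (0 : ℝ)..1, (x + (1 - r))⁻¹ := by
        rw [intervalIntegral.integral_comp_add_right (fun x => x⁻¹), zero_add,
          integral_inv_of_pos hδ (by linarith)]
    _ ≤ ∫ x in (0 : ℝ)..1, ‖1 - (r : ℂ) * circleMap 0 1 x‖⁻¹ :=
        intervalIntegral.integral_mono_on zero_le_one hint (hcont.intervalIntegrable _ _) hle
    _ ≤ _ := by
        refine intervalIntegral.integral_mono_interval le_rfl zero_le_one
          (by linarith [Real.pi_gt_three]) (ae_of_all _ fun x => (inv_pos.2 (hpos x)).le)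
          (hcont.intervalIntegrable _ _)

end Extremal

/-! ### Lower bounds for the constants -/

section LowerBounds
open Filter Topology

lemma le_of_frequently_rpow_le {p a D C : ℝ} (hp : 0 < p) (hD : 0 ≤ D)
    (h : ∀ M : ℝ, ∃ x, M ≤ x ∧ a ^ p * x ^ p - C ≤ (D * (x + 1) + 2) ^ p) : a ≤ D := by
  by_contra! hlt
  have hinv := tendsto_inv_atTop_zero (𝕜 := ℝ)
  have h1 : Tendsto (fun x : ℝ => (D * (1 + x⁻¹) + 2 * x⁻¹) ^ p + C * x⁻¹ ^ p) atTop
      (𝓝 ((D * (1 + 0) + 2 * 0) ^ p + C * 0 ^ p)) :=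
    (((tendsto_const_nhds.mul (tendsto_const_nhds.add hinv)).add
      (tendsto_const_nhds.mul hinv)).rpow_const (Or.inr hp.le)).add
      (tendsto_const_nhds.mul (hinv.rpow_const (Or.inr hp.le)))
  rw [Real.zero_rpow hp.ne', mul_zero, mul_zero, add_zero, add_zero, add_zero, mul_one] at h1
  have h2 := h1.eventually_lt_const (Real.rpow_lt_rpow hD hlt hp)
  obtain ⟨M, hM⟩ := eventually_atTop.1 (h2.and (eventually_gt_atTop 0))
  obtain ⟨x, hx, hxi⟩ := h M
  obtain ⟨h3, hx0⟩ := hM x hx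
  have hxp : 0 < x ^ p := Real.rpow_pos_of_pos hx0 p
  have e1 : x ^ p * (D * (1 + x⁻¹) + 2 * x⁻¹) ^ p = (D * (x + 1) + 2) ^ p := by
    rw [← Real.mul_rpow hx0.le (by positivity)]
    congr 1
    field_simp
  have e2 : x ^ p * x⁻¹ ^ p = 1 := by
    rw [← Real.mul_rpow hx0.le (by positivity), mul_inv_cancel₀ hx0.ne', Real.one_rpow]
  have h4 := mul_lt_mul_of_pos_left h3 hxp
  rw [mul_add, e1, mul_left_comm, e2, mul_one] at h4
  linarith

variable {p : ℝ}

lemma exists_le_circleNorm_invRoot (hp : 1 < p) (M : ℝ) :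
    ∃ r : ℝ, 0 < r ∧ r < 1 ∧
      M ≤ circleNorm p fun t => invRoot p (1 - (r : ℂ) * circlePt t) := by
  have hp0 : 0 < p := by linarith
  set K := max M 1 with hK
  have hK1 : 1 ≤ K := le_max_right _ _
  set L := 2 * Real.pi * K ^ p with hL
  have hL0 : 0 < L := by have := Real.pi_pos; positivity
  refine ⟨1 - Real.exp (-L), ?_, by linarith [Real.exp_pos (-L)], ?_⟩
  · have := Real.exp_lt_one_iff.2 (neg_lt_zero.2 hL0); linarith
  have h0 : 0 < 1 - Real.exp (-L) := by
    have := Real.exp_lt_one_iff.2 (neg_lt_zero.2 hL0); linarith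
  have h1 : 1 - Real.exp (-L) < 1 := by linarith [Real.exp_pos (-L)]
  have hint := log_le_integral_inv_norm h0 h1
  rw [sub_sub_cancel, one_div, Real.exp_neg, inv_inv, Real.log_exp, hL, ← Real.exp_neg,
    inv_mul_cancel_left₀ (by have := Real.pi_pos; positivity)] at hint
  have hc := continuous_comp_circlePt (diffContOnCl_invRoot (p := p) h0 h1)
  refine (le_max_left M 1).trans ?_
  rw [← hK, ← Real.rpow_le_rpow_iff (by linarith) (circleNorm_nonneg _ _) hp0,
    circleNorm_rpow hp0 hc]
  refine hint.trans (le_of_eq (integral_congr_ae (ae_of_all _ fun t => ?_)))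
  simp only
  rw [norm_invRoot_rpow hp0]
  intro h
  have := one_sub_mul_re_pos h0 h1 (norm_circlePt t).le
  rw [h] at this
  simp at this

/-- If testing on the extremal family gives `S` up to bounded errors, then `2 ^ (1 - 1 / s) S` is a
lower bound for the admissible constants. -/
lemma le_of_mem_reverseRieszConstants {s B S C : ℝ} {ε : ℂ} (hp : 1 < p) (hs : 0 < s) (hS : 0 < S)
    (hε : ‖ε‖ = 1) (hB : B ∈ reverseRieszConstants p s)
    (h : ∀ r : ℝ, 0 < r → r < 1 →
      (2 * S) ^ p * circleNorm p (fun t => invRoot p (1 - (r : ℂ) * circlePt t)) ^ p - C ≤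
      (circleNorm p (fun t => (invRoot p (1 - (r : ℂ) * circlePt t) - 1) +
        ε * (starRingEnd ℂ) (invRoot p (1 - (r : ℂ) * circlePt t) - 1)) + 2) ^ p) :
    2 ^ (1 - 1 / s) * S ≤ B := by
  have hp0 : 0 < p := by linarith
  have hD : 2 * S ≤ max B 0 * 2 ^ (1 / s) := by
    refine le_of_frequently_rpow_le (C := C) hp0 (by positivity) fun M => ?_
    obtain ⟨r, h0, h1, hM⟩ := exists_le_circleNorm_invRoot hp M
    refine ⟨_, hM, (h r h0 h1).trans ?_⟩
    refine Real.rpow_le_rpow (add_nonneg (circleNorm_nonneg p _) two_pos.le) ?_ hp0.le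
    have hd : DiffContOnCl ℂ (fun z => invRoot p (1 - (r : ℂ) * z) - 1) (Metric.ball 0 1) :=
      (diffContOnCl_invRoot h0 h1).sub diffContOnCl_const
    have h2 := circleNorm_add_conj_le hp hs hB hd (by simp [invRoot]) hε
    have hc := continuous_comp_circlePt (diffContOnCl_invRoot (p := p) h0 h1)
    have h3 := circleNorm_add_le hp hc (continuous_const (y := (-1 : ℂ)))
    rw [circleNorm_const hp, norm_neg, norm_one] at h3
    have h4 : circleNorm p (fun t => invRoot p (1 - (r : ℂ) * circlePt t) - 1) ≤
        circleNorm p (fun t => invRoot p (1 - (r : ℂ) * circlePt t)) + 1 := by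
      simpa only [sub_eq_add_neg, Pi.add_def] using h3
    have h5 := mul_le_mul_of_nonneg_left h4 (by positivity : 0 ≤ max B 0 * 2 ^ (1 / s))
    linarith
  have h2 : 2 ^ (1 - 1 / s) * S ≤ max B 0 := by
    rw [Real.rpow_sub two_pos, Real.rpow_one, div_mul_eq_mul_div, div_le_iff₀ (by positivity)]
    exact hD
  rcases le_total B 0 with h0 | h0
  · rw [max_eq_right h0] at h2
    have : 0 < (2 : ℝ) ^ (1 - 1 / s) * S := by positivity
    linarith
  · rwa [max_eq_left h0] at h2

lemma sin_le_of_mem_reverseRieszConstants {s B : ℝ} (hp : 1 < p) (hs : 0 < s)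
    (hB : B ∈ reverseRieszConstants p s) :
    2 ^ (1 - 1 / s) * Real.sin (Real.pi / (2 * p)) ≤ B := by
  have hp0 : 0 < p := by linarith
  have hS := (sin_cos_pi_div_pos hp).1
  refine le_of_mem_reverseRieszConstants (C := 2 ^ p * (Real.pi / 2)) (ε := -1) hp hs hS (by simp)
    hB fun r h0 h1 => ?_
  have hc := continuous_comp_circlePt (diffContOnCl_invRoot (p := p) h0 h1)
  have hpos := fun t => one_sub_mul_re_pos h0 h1 (norm_circlePt t).le
  have hwc : Continuous fun t => 1 - (r : ℂ) * circlePt t := by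
    have := continuous_circlePt; fun_prop
  have hne : ∀ t, 1 - (r : ℂ) * circlePt t ≠ 0 := fun t h => by
    have := hpos t; rw [h] at this; simp at this
  have hf : Continuous fun t => (invRoot p (1 - (r : ℂ) * circlePt t) - 1) +
      -1 * (starRingEnd ℂ) (invRoot p (1 - (r : ℂ) * circlePt t) - 1) :=
    (hc.sub continuous_const).add (continuous_const.mul
      (Complex.continuous_conj.comp (hc.sub continuous_const)))
  have hmono : ∀ x : ℝ, 0 ≤ x → x ^ p ≤ (x + 2) ^ p := fun x hx =>
    Real.rpow_le_rpow hx (by linarith) hp0.le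
  refine le_trans ?_ (hmono _ (circleNorm_nonneg _ _))
  rw [circleNorm_rpow hp0 hc, circleNorm_rpow hp0 hf, Real.mul_rpow two_pos.le hS.le]
  have e1 : ∀ t, ‖(invRoot p (1 - (r : ℂ) * circlePt t) - 1) +
      -1 * (starRingEnd ℂ) (invRoot p (1 - (r : ℂ) * circlePt t) - 1)‖ ^ p =
      2 ^ p * |(invRoot p (1 - (r : ℂ) * circlePt t)).im| ^ p := by
    intro t
    have : (invRoot p (1 - (r : ℂ) * circlePt t) - 1) +
        -1 * (starRingEnd ℂ) (invRoot p (1 - (r : ℂ) * circlePt t) - 1) =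
        ((2 * (invRoot p (1 - (r : ℂ) * circlePt t)).im : ℝ) : ℂ) * Complex.I := by
      apply Complex.ext <;> simp
      ring
    rw [this, norm_mul, Complex.norm_I, mul_one, Complex.norm_real, Real.norm_eq_abs, abs_mul,
      abs_two, Real.mul_rpow two_pos.le (abs_nonneg _)]
  simp only [e1]
  have i1 : Integrable (fun t => ‖1 - (r : ℂ) * circlePt t‖⁻¹) arcLength :=
    integrable_of_continuous (hwc.norm.inv₀ fun t => norm_ne_zero_iff.2 (hne t))
  have i2 : Integrable (fun t => ((1 - (r : ℂ) * circlePt t)⁻¹).re) arcLength :=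
    integrable_of_continuous (Complex.continuous_re.comp (hwc.inv₀ hne))
  have i3 : Integrable (fun t => |(invRoot p (1 - (r : ℂ) * circlePt t)).im| ^ p) arcLength :=
    integrable_of_continuous ((Complex.continuous_im.comp hc).abs.rpow_const
      fun _ => Or.inr hp0.le)
  have h2 := integral_mono ((i1.const_mul _).sub (i2.const_mul _)) i3
    fun t => sin_rpow_mul_inv_norm_le hp (hpos t)
  simp only [Pi.sub_apply] at h2
  rw [integral_sub (i1.const_mul _) (i2.const_mul _), integral_const_mul, integral_const_mul,
    integral_inv_re h0 h1, mul_one] at h2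
  simp only [norm_invRoot_rpow hp0 (hne _)]
  rw [integral_const_mul]
  have := mul_le_mul_of_nonneg_left h2 (by positivity : (0 : ℝ) ≤ 2 ^ p)
  linarith

lemma cos_le_of_mem_reverseRieszConstants {s B : ℝ} (hp : 1 < p) (hs : 0 < s)
    (hB : B ∈ reverseRieszConstants p s) :
    2 ^ (1 - 1 / s) * Real.cos (Real.pi / (2 * p)) ≤ B := by
  have hp0 : 0 < p := by linarith
  have hS := (sin_cos_pi_div_pos hp).2
  refine le_of_mem_reverseRieszConstants (C := 0) (ε := 1) hp hs hS (by simp)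
    hB fun r h0 h1 => ?_
  have hc := continuous_comp_circlePt (diffContOnCl_invRoot (p := p) h0 h1)
  have hpos := fun t => one_sub_mul_re_pos h0 h1 (norm_circlePt t).le
  have hf : Continuous fun t => (invRoot p (1 - (r : ℂ) * circlePt t) - 1) +
      1 * (starRingEnd ℂ) (invRoot p (1 - (r : ℂ) * circlePt t) - 1) :=
    (hc.sub continuous_const).add (continuous_const.mul
      (Complex.continuous_conj.comp (hc.sub continuous_const)))
  have hR : Continuous fun t => ((2 * (invRoot p (1 - (r : ℂ) * circlePt t)).re : ℝ) : ℂ) :=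
    Complex.continuous_ofReal.comp (continuous_const.mul (Complex.continuous_re.comp hc))
  have e : (fun t => ((2 * (invRoot p (1 - (r : ℂ) * circlePt t)).re : ℝ) : ℂ)) =
      (fun t => (invRoot p (1 - (r : ℂ) * circlePt t) - 1) +
        1 * (starRingEnd ℂ) (invRoot p (1 - (r : ℂ) * circlePt t) - 1)) + fun _ => (2 : ℂ) := by
    funext t
    apply Complex.ext <;> simp
    ring
  have h2 := circleNorm_add_le hp hf (continuous_const (y := (2 : ℂ)))
  rw [← e, circleNorm_const hp, Complex.norm_ofNat] at h2
  rw [sub_zero]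
  refine le_trans ?_ (Real.rpow_le_rpow (circleNorm_nonneg _ _) h2 hp0.le)
  rw [circleNorm_rpow hp0 hc, circleNorm_rpow hp0 hR, ← integral_const_mul]
  refine integral_mono
    (integrable_of_continuous (continuous_const.mul (hc.norm.rpow_const fun _ => Or.inr hp0.le)))
    (integrable_of_continuous (hR.norm.rpow_const fun _ => Or.inr hp0.le)) fun t => ?_
  simp only
  rw [← Real.mul_rpow (by positivity) (norm_nonneg _), Complex.norm_real, Real.norm_eq_abs, abs_mul,
    abs_two, mul_assoc]
  refine Real.rpow_le_rpow (by positivity) ?_ hp0.le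
  exact mul_le_mul_of_nonneg_left (cos_mul_norm_invRoot_le hp (hpos t)) two_pos.le

/-- The function `1` shows that no constant below `1` is admissible. -/
lemma one_le_of_mem_reverseRieszConstants {s B : ℝ} (hp : 1 < p) (hs : 0 < s)
    (hB : B ∈ reverseRieszConstants p s) : 1 ≤ B := by
  have : Fact (1 ≤ ENNReal.ofReal p) := ⟨one_le_ofReal hp⟩
  have hproj := isRieszProjection_trigLp (p := p) (Finsupp.single 0 1)
  have e : analyticLp p (Finsupp.single 0 1) = trigLp p (Finsupp.single 0 1) := by
    simp [analyticLp, trigLp]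
  rw [e] at hproj
  set f : LpT p := trigLp p (Finsupp.single 0 1) with hf
  have h1 := mem_reverseRieszConstants_iff.1 hB f
  have hfc : (f : CircleT → ℂ) =ᵐ[arcLength] fun _ => (1 : ℂ) :=
    (coeFn_trigLp (p := p) (Finsupp.single 0 1)).trans (ae_of_all _ fun t => by simp [trigPoly])
  have h2 : eLpNorm (fun t => pairNorm s ((rieszPlus f : CircleT → ℂ) t)
      ((rieszMinus f : CircleT → ℂ) t)) (ENNReal.ofReal p) arcLength =
      eLpNorm (f : CircleT → ℂ) (ENNReal.ofReal p) arcLength := by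
    refine eLpNorm_congr_norm_ae ?_
    rw [rieszMinus, rieszPlus_eq hproj, sub_self]
    filter_upwards [Lp.coeFn_zero ℂ (ENNReal.ofReal p) arcLength] with t ht
    rw [ht, Pi.zero_apply, Real.norm_of_nonneg (pairNorm_nonneg _ _ _), pairNorm, norm_zero,
      Real.zero_rpow hs.ne', add_zero, ← Real.rpow_mul (norm_nonneg _), mul_one_div_cancel hs.ne',
      Real.rpow_one]
  rw [h2, eLpNorm_congr_ae hfc, eLpNorm_const _ (by simp; linarith)
    (IsProbabilityMeasure.ne_zero arcLength)] at h1
  simpa using h1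

end LowerBounds

theorem theorem1p1 :
    (∀ p s : ℝ, 1 < p → p ≤ 2 → p ≤ s →
      IsLeast (reverseRieszConstants p s)
        ((2 : ℝ) ^ (1 - 1 / s) * Real.sin (Real.pi / (2 * p)))) ∧
    (∀ p s : ℝ, 9 ≤ p → p / (p - 1) ≤ s →
      IsLeast (reverseRieszConstants p s)
        ((2 : ℝ) ^ (1 - 1 / s) * Real.cos (Real.pi / (2 * p)))) ∧
    (∀ p s : ℝ, 1 < p → 0 < s → s ≤ 1 →
      IsLeast (reverseRieszConstants p s) 1) := by
  refine ⟨fun p s hp1 hp2 hs => ⟨sin_mem_reverseRieszConstants hp1 hp2 hs, fun B hB => ?_⟩,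
    fun p s hp hs => ⟨cos_mem_reverseRieszConstants hp hs, fun B hB => ?_⟩,
    fun p s hp hs0 hs1 => ⟨one_mem_reverseRieszConstants hs0 hs1, fun B hB => ?_⟩⟩
  · exact sin_le_of_mem_reverseRieszConstants hp1 (by linarith) hB
  · exact cos_le_of_mem_reverseRieszConstants (by linarith)
      (lt_of_lt_of_le (div_pos (by linarith) (by linarith)) hs) hB
  · exact one_le_of_mem_reverseRieszConstants hp hs0 hB
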